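/- For an integer $m\ge 2$ and a nonempty finite multiset $Z=\{z_1,\dots,z_n\}$ of integers, let \[ \operatorname{disc}(Z,m)=\max_{k=1,\dots,m-1}\left|\frac1n\sum_{j=1}^n\omega^{kz_j}\right|,\qquad \omega=e^{2\pi i/m}. \] For every real $0<\epsilon\le 1$ there are a constant $C_\epsilon\ge 1$ and an algorithm $A_\epsilon$ that takes as input an integer $m\ge 2$, runs in time polynomial in $\log_2 m$ (the polynomial may depend on $\epsilon$), and outputs a nonempty set $Z\subseteq\{0,1,\dots,m-1\}$ with \[ \operatorname{disc}(Z,m)\le\epsilon\qquad\text{and}\qquad |Z|\le C_\epsilon\log_2 m . \] Moreover, $C_\epsilon$ and $A_\epsilon$ are given explicitly, in the following sense: $C_\epsilon=C(\lceil 1/\epsilon\rceil)$ for a computable function $C\colon\mathbb N\to\mathbb N$, and there is a single program $A$, independent of $\epsilon$, such that $A_\epsilon$ is $A$ run with the number $\lceil 1/\epsilon\rceil$ supplied to it as a constant. Algorithms are programs of a random access machine with registers that hold natural numbers, with addition, truncated subtraction, multiplication, integer division and remainder, with indirect addressing, conditionals and loops; time is measured by the logarithmic cost criterion (each instruction or test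 costs one plus the number of bits of the numbers and the computed addresses that it handles). The set $Z$ is output as a list without repetitions. -/

import Mathlib

/-- The `m`-discrepancy of a finite multiset `Z = {z₁, …, zₙ}` of integers,
`max_{k = 1, …, m - 1} |(1 / n) * ∑ j, ω ^ (k * zⱼ)|` with `ω = exp (2 * π * i / m)`.
The maximum is over a finite set, which is nonempty for `m ≥ 2`; the empty multiset has
discrepancy `0`. -/
noncomputable def disc (Z : Multiset ℤ) (m : ℕ) : ℝ :=
  ⨆ k : Finset.Ico 1 m,
    ‖(1 / (Multiset.card Z : ℂ)) *
      (Z.map fun z : ℤ =>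
        Complex.exp (2 * (Real.pi : ℂ) * Complex.I / (m : ℂ)) ^ (((k : ℕ) : ℤ) * z)).sum‖

/-! ## Random access machines with logarithmic cost -/

namespace RAM

/-- The memory: registers `0, 1, 2, …`, each of which holds a natural number. -/
abbrev Mem := ℕ → ℕ

/-- The arithmetic instructions: addition, truncated subtraction, multiplication, integer
quotient and remainder. -/
inductive Op
  | add
  | sub
  | mul
  | div
  | mod

/-- The value of an arithmetic instruction (with `x / 0 = 0` and `x % 0 = x`). -/
def Op.eval : Op → ℕ → ℕ → ℕ
  | .add, x, y => x + y
  | .sub, x, y => x - y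
  | .mul, x, y => x * y
  | .div, x, y => x / y
  | .mod, x, y => x % y

/-- Programs of a random access machine, in structured form. -/
inductive Prog
  /-- `r[d] := n` -/
  | const (d n : ℕ)
  /-- `r[d] := r[a] o r[b]` -/
  | arith (o : Op) (d a b : ℕ)
  /-- `r[d] := r[r[a]]` -/
  | load (d a : ℕ)
  /-- `r[r[a]] := r[b]` -/
  | store (a b : ℕ)
  /-- do nothing -/
  | skip
  /-- `p; q` -/
  | seq (p q : Prog)
  /-- if `r[a] ≠ 0` then `p` else `q` -/
  | branch (a : ℕ) (p q : Prog)
  /-- while `r[a] ≠ 0` do `p` -/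
  | loop (a : ℕ) (p : Prog)

/-- `Run p s t s'`: started with memory `s`, the program `p` halts after time `t` with memory
`s'`. Time is measured by the logarithmic cost criterion: an elementary instruction or a test
costs one plus the number of bits (`Nat.size`) of all the numbers and the computed addresses
that it handles, which is time on a multitape Turing machine up to a polynomial. -/
inductive Run : Prog → Mem → ℕ → Mem → Prop
  | const (d n : ℕ) (s : Mem) :
      Run (.const d n) s (1 + Nat.size n) (Function.update s d n)
  | arith (o : Op) (d a b : ℕ) (s : Mem) :
      Run (.arith o d a b) s (1 + Nat.size (s a) + Nat.size (s b))
        (Function.update s d (o.eval (s a) (s b)))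
  | load (d a : ℕ) (s : Mem) :
      Run (.load d a) s (1 + Nat.size (s a) + Nat.size (s (s a)))
        (Function.update s d (s (s a)))
  | store (a b : ℕ) (s : Mem) :
      Run (.store a b) s (1 + Nat.size (s a) + Nat.size (s b))
        (Function.update s (s a) (s b))
  | skip (s : Mem) : Run .skip s 1 s
  | seq {p q : Prog} {s s' s'' : Mem} {t t' : ℕ} (hp : Run p s t s') (hq : Run q s' t' s'') :
      Run (.seq p q) s (t + t') s''
  | branch_true {a : ℕ} {p q : Prog} {s s' : Mem} {t : ℕ} (h : s a ≠ 0) (hp : Run p s t s') :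
      Run (.branch a p q) s (1 + Nat.size (s a) + t) s'
  | branch_false {a : ℕ} {p q : Prog} {s s' : Mem} {t : ℕ} (h : s a = 0) (hq : Run q s t s') :
      Run (.branch a p q) s (1 + Nat.size (s a) + t) s'
  | loop_done {a : ℕ} {p : Prog} {s : Mem} (h : s a = 0) :
      Run (.loop a p) s (1 + Nat.size (s a)) s
  | loop_step {a : ℕ} {p : Prog} {s s' s'' : Mem} {t t' : ℕ} (h : s a ≠ 0)
      (hp : Run p s t s') (hl : Run (.loop a p) s' t' s'') :
      Run (.loop a p) s (1 + Nat.size (s a) + t + t') s''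

/-- The initial memory on input `m`: register `0` holds `m`, all others hold `0`. -/
def input (m : ℕ) : Mem := Function.update (fun _ => 0) 0 m

/-- The output list of a final memory: register `0` holds its length `n`, and the registers
`1, …, n` hold its entries. -/
def output (s : Mem) : List ℕ := (List.range (s 0)).map fun i => s (i + 1)

/-- On input `m`, the program `p` halts in time at most `T` and lists the elements of the finite
set `Z`, each of them once. -/
def OutputsWithin (p : Prog) (m T : ℕ) (Z : Finset ℕ) : Prop :=
  ∃ (t : ℕ) (s : Mem), Run p (input m) t s ∧ t ≤ T ∧ (output s : Multiset ℕ) = Z.val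

end RAM

set_option linter.constructorNameAsVariable false


/-! The construction divides a small balanced set by many primes. Write `E = ⌈1/ε⌉` and let `L` be
the bit length of `m`. Take for `q` a power of two of order `E^8 * L`, let `R = (40 * E^2 + 1) * q`,
and let `T` be a set of residues modulo `q`, with `|T|` of order `E^2 * log q`, whose nontrivial
exponential sums modulo `q` are at most `|T| / (4 * E)`. For every prime `p` in `(R, 8 * R]` with `p
∤ m`, every `i < 40 * E^2` and every `t ∈ T`, output the `z < m` with `p * z ≡ q * (i + 1) + t`
modulo `m`.

Fix `0 < k < m` and one `p`. With `p * x ≡ k` modulo `m` and `θ = x / m`, the residue `z` that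
belongs to `s` contributes `e (s * θ)`. If `θ` is farther than `1 / (2 * q)` from all integers, the
sum over `i` and `t` is at most a proportion `1 / (2 * E)` of its number of terms
(`norm_sum_translates_le`): either the geometric sum over `i` cancels, or `θ` is so close to a
nonintegral fraction `a / q` that the balance of `T` takes over. If `θ` is close to an integer, then
`p` divides one of `O(E^2)` nonzero integers `k + i * m`; each has few prime factors above `R`
(`card_bad_mul_log_le`), so at most a proportion `1 / (2 * E)` of the primes is bad. The total is `1
/ E` (`norm_sum_goodPrimes_le`).

There are `O(R / log R)` primes and `|T|` is of order `log q`, so the logarithms cancel and the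
output has `O_E(L)` elements. For `m > 8 * R^2` the outputs are distinct (`quot_injective`).
Otherwise `m` is bounded in terms of `E` alone, and all residues are output, with discrepancy `0`.

The set `T` comes from conditional expectations (`Greedy.cons`, `Greedy.norm_sum_le`). A residue `t`
is represented by the odd number `2 * t + 1` modulo `2 * q`, and chosen together with its mirror
image, which represents `-(2 * t + 1)`; exponential sums are then real up to a unimodular factor.
The potential is the sum over the frequencies `k ≠ 0, q` of the products of `32 * E + 2 * cos (π * k
* (2 * t + 1) / q)`. By Fourier inversion the effect of a new `t` on it is governed by one
coefficient of an integer polynomial modulo `Y^(2 * q) - 1`. The polynomial is kept as one large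
integer through evaluation at a large base (`enc_coef_cons`), so the minimization is exact integer
arithmetic. As `q` is of order `log m` for fixed `E`, all numbers have polynomially many bits.

For the running time, a small imperative language is compiled to the machine. Its predicate
transformer `Cmd.wp` bounds loop counts by `N` and assigned values by `V`; `Cmd.exists_run` turns
these bounds into the time bound `cost.eval N * Nat.size V`. -/

namespace SmallBias
-- Arithmetic expressions and their compilation to the machine
open RAM

/-- The registers with a name. -/
inductive Var
  | m | E | L | x | K | I | D | q | l | g | n | R | M | X | XM | Q2 | F | U
  | best | by' | bb | Y | b | v | p | t
  | i₁ | c₁ | i₂ | c₂ | i₃ | c₃ | i₄ | c₄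
  deriving DecidableEq

/-- The address of a named register. -/
def Var.idx : Var → ℕ
  | .m => 0 | .E => 1 | .L => 2 | .x => 3 | .K => 4 | .I => 5 | .D => 6 | .q => 7 | .l => 8
  | .g => 9 | .n => 10 | .R => 11 | .M => 12 | .X => 13 | .XM => 14 | .Q2 => 15 | .F => 16
  | .U => 17 | .best => 18 | .by' => 19 | .bb => 20 | .Y => 21 | .b => 22 | .v => 23 | .p => 24
  | .t => 25 | .i₁ => 26 | .c₁ => 27 | .i₂ => 28 | .c₂ => 29 | .i₃ => 30 | .c₃ => 31
  | .i₄ => 32 | .c₄ => 33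

lemma Var.idx_lt (x : Var) : x.idx < 40 := by cases x <;> simp [Var.idx]

lemma Var.idx_injective : Function.Injective Var.idx := by
  intro x y h
  cases x <;> cases y <;> first | rfl | (simp [Var.idx] at h)

/-- Arithmetic expressions in the named registers. -/
inductive Expr
  | lit (n : ℕ)
  | var (x : Var)
  | op (o : Op) (a b : Expr)

namespace Expr

/-- The value of an expression. -/
def eval (v : Var → ℕ) : Expr → ℕ
  | lit n => n
  | var x => v x
  | op o a b => o.eval (a.eval v) (b.eval v)

/-- Code that puts the value of an expression into register `d`, with scratch registers
above `d`. -/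
def code : Expr → ℕ → Prog
  | lit n, d => .const d n
  | var x, d => .seq (.const d 0) (.arith .add d x.idx d)
  | op o a b, d => .seq (a.code d) (.seq (b.code (d + 1)) (.arith o d d (d + 1)))

/-- The number of scratch registers that `code` uses. -/
def depth : Expr → ℕ
  | lit _ => 1
  | var _ => 1
  | op _ a b => max a.depth (b.depth + 1)

/-- If all registers are at most `V`, then the value is at most `V ^ deg`. -/
def deg : Expr → ℕ
  | lit n => n.size + 1
  | var _ => 1
  | op _ a b => a.deg + b.deg

/-- The running time of `code` in units of `Nat.size V`. -/
def cost : Expr → ℕ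
  | lit n => 1 + n.size
  | var _ => 3
  | op _ a b => a.cost + b.cost + (1 + a.deg + b.deg)

lemma one_le_deg (e : Expr) : 1 ≤ e.deg := by
  induction e with
  | op o a b ha hb => simp only [deg]; omega
  | _ => simp [deg]

lemma one_le_depth (e : Expr) : 1 ≤ e.depth := by
  induction e <;> simp [depth]

/-- Only sums and products can grow, and for numbers that are at least `2` a sum is at most the
product. Degrees therefore add under every operation. -/
lemma eval_le {v : Var → ℕ} {V : ℕ} (hV : 2 ≤ V) (h : ∀ x, v x ≤ V) (e : Expr) :
    e.eval v ≤ V ^ e.deg := by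
  induction e with
  | lit n =>
    calc n ≤ 2 ^ n.size := n.lt_size_self.le
      _ ≤ V ^ n.size := Nat.pow_le_pow_left hV _
      _ ≤ V ^ (n.size + 1) := Nat.pow_le_pow_right (by omega) (by omega)
  | var x => simpa [eval, deg] using h x
  | op o a b iha ihb =>
    have ha : V ≤ V ^ a.deg := Nat.le_self_pow (by have := a.one_le_deg; omega) V
    have hb : V ≤ V ^ b.deg := Nat.le_self_pow (by have := b.one_le_deg; omega) V
    have hm : V ^ a.deg ≤ V ^ a.deg * V ^ b.deg := Nat.le_mul_of_pos_right _ (by omega)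
    simp only [eval, deg, pow_add]
    cases o <;> simp only [Op.eval]
    · calc _ ≤ V ^ a.deg + V ^ b.deg := add_le_add iha ihb
        _ ≤ _ := Nat.add_le_mul (hV.trans ha) (hV.trans hb)
    · exact (Nat.sub_le _ _).trans (iha.trans hm)
    · exact Nat.mul_le_mul iha ihb
    · exact (Nat.div_le_self _ _).trans (iha.trans hm)
    · exact (Nat.mod_le _ _).trans (iha.trans hm)

end Expr

lemma size_pow_le {V d : ℕ} (hd : 1 ≤ d) : Nat.size (V ^ d) ≤ d * Nat.size V := by
  rw [Nat.size_le, mul_comm, pow_mul]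
  exact Nat.pow_lt_pow_left V.lt_size_self (by omega)

lemma Expr.size_eval_le {v : Var → ℕ} {V : ℕ} (hV : 2 ≤ V) (h : ∀ x, v x ≤ V) (e : Expr) :
    Nat.size (e.eval v) ≤ e.deg * Nat.size V :=
  (Nat.size_le_size (e.eval_le hV h)).trans (size_pow_le e.one_le_deg)

lemma one_le_size {V : ℕ} (hV : 2 ≤ V) : 1 ≤ Nat.size V := by
  have := Nat.size_pos.2 (show 0 < V by omega); omega

/-- The right operand is computed one register higher, so the left value in register `d` survives.
The frame clause protects the named registers below `40` and the output list above the scratch area.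
-/
lemma Expr.run_code {v : Var → ℕ} {V : ℕ} (hV : 2 ≤ V) (h : ∀ x, v x ≤ V) (e : Expr) (d : ℕ)
    (hd : 40 ≤ d) (s : Mem) (hs : ∀ x : Var, s x.idx = v x) :
    ∃ t s', Run (e.code d) s t s' ∧ t ≤ e.cost * Nat.size V ∧ s' d = e.eval v ∧
      ∀ a, a < d ∨ d + e.depth ≤ a → s' a = s a := by
  have h1 := one_le_size hV
  induction e generalizing d s with
  | lit n =>
    refine ⟨_, _, Run.const d n s, ?_, by simp [eval], ?_⟩
    · simp only [cost]; exact Nat.le_mul_of_pos_right _ h1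
    · intro a ha
      simp only [depth] at ha
      exact Function.update_of_ne (by omega) _ _
  | var x =>
    have hx := x.idx_lt
    refine ⟨_, _, Run.seq (Run.const d 0 s) (Run.arith _ _ _ _ _), ?_, ?_, ?_⟩
    · rw [Function.update_self, Function.update_of_ne (by omega), hs]
      have := Nat.size_le_size (h x)
      simp only [cost, Nat.size_zero]; omega
    · simp [Op.eval, eval, Function.update_of_ne (show x.idx ≠ d by omega), hs]
    · intro a ha
      simp only [depth] at ha
      rw [Function.update_of_ne (by omega), Function.update_of_ne (by omega)]
  | op o a b iha ihb =>
    obtain ⟨t₁, s₁, r₁, ht₁, e₁, f₁⟩ := iha d hd s hs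
    obtain ⟨t₂, s₂, r₂, ht₂, e₂, f₂⟩ := ihb (d + 1) (by omega) s₁
      (fun x => by rw [f₁ _ (Or.inl (by have := x.idx_lt; omega)), hs])
    have e₃ : s₂ d = a.eval v := by rw [f₂ _ (Or.inl (by omega)), e₁]
    refine ⟨_, _, r₁.seq (r₂.seq (Run.arith _ _ _ _ _)), ?_, ?_, ?_⟩
    · rw [e₂, e₃]
      have ha := a.size_eval_le hV h
      have hb := b.size_eval_le hV h
      simp only [cost]
      nlinarith
    · simp [e₂, e₃, eval]
    · intro c hc
      simp only [depth] at hc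
      rw [Function.update_of_ne (by have := a.one_le_depth; omega), f₂ _ (by omega),
        f₁ _ (by omega)]

/-! ### Commands, their compilation and a predicate transformer with resource bounds -/

/-- Commands: structured programs over named registers and an output list. -/
inductive Cmd
  | skip
  | assign (x : Var) (e : Expr)
  | push (e : Expr)
  | seq (c d : Cmd)
  | ite (e : Expr) (c d : Cmd)
  | loop (x : Var) (c : Cmd)

/-- States: the named registers and the output list. -/
structure St where
  v : Var → ℕ
  out : List ℕ

namespace St

/-- Assignment to a register. -/
def set (σ : St) (x : Var) (a : ℕ) : St := ⟨Function.update σ.v x a, σ.out⟩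

/-- Output of a number. -/
def push (σ : St) (a : ℕ) : St := ⟨σ.v, σ.out ++ [a]⟩

@[simp] lemma set_v (σ : St) (x y : Var) (a : ℕ) :
    (σ.set x a).v y = if y = x then a else σ.v y := by
  simp [set, Function.update_apply]

@[simp] lemma set_out (σ : St) (x : Var) (a : ℕ) : (σ.set x a).out = σ.out := rfl
@[simp] lemma push_v (σ : St) (a : ℕ) : (σ.push a).v = σ.v := rfl
@[simp] lemma push_out (σ : St) (a : ℕ) : (σ.push a).out = σ.out ++ [a] := rfl

/-- All numbers that occur in the state are at most `V`. -/
def Good (V : ℕ) (σ : St) : Prop := (∀ x, σ.v x ≤ V) ∧ σ.out.length ≤ V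

/-- The memory `s` represents the state `σ`. -/
def Rep (σ : St) (s : Mem) : Prop :=
  (∀ x : Var, s x.idx = σ.v x) ∧ s 40 = σ.out.length ∧ ∀ i, s (64 + i) = σ.out.getD i 0

end St

namespace Cmd

/-- The program of a command. -/
def code : Cmd → Prog
  | skip => .skip
  | assign x e => .seq (e.code 41) (.seq (.const 42 0) (.arith .add x.idx 41 42))
  | push e => .seq (e.code 41) (.seq (.const 42 64) (.seq (.arith .add 42 40 42)
      (.seq (.store 42 41) (.seq (.const 42 1) (.arith .add 40 40 42)))))
  | seq c d => .seq c.code d.code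
  | ite e c d => .seq (e.code 41) (.branch 41 c.code d.code)
  | loop x c => .loop x.idx c.code

/-- All expressions fit into the scratch registers. -/
def Fits : Cmd → Prop
  | skip => True
  | assign _ e => e.depth ≤ 20
  | push e => e.depth ≤ 20
  | seq c d => c.Fits ∧ d.Fits
  | ite e c d => e.depth ≤ 20 ∧ c.Fits ∧ d.Fits
  | loop _ c => c.Fits

/-- The running time, in units of `Nat.size V`, as a polynomial in the bound for the number of
iterations of each loop. -/
noncomputable def cost : Cmd → Polynomial ℕ
  | skip => 1
  | assign _ e => Polynomial.C (e.cost + e.deg + 2)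
  | push e => Polynomial.C (e.cost + e.deg + 60)
  | seq c d => c.cost + d.cost
  | ite e c d => Polynomial.C (e.cost + e.deg + 1) + c.cost + d.cost
  | loop _ c => Polynomial.X * (2 + c.cost) + 2

/-- `k` iterations at most of a loop with test register `x`, where `w` is the predicate
transformer of the body. -/
def iter (x : Var) (w : (St → Prop) → St → Prop) (Q : St → Prop) : ℕ → St → Prop
  | 0, σ => σ.v x = 0 ∧ Q σ
  | k + 1, σ => (σ.v x = 0 ∧ Q σ) ∨ (σ.v x ≠ 0 ∧ w (iter x w Q k) σ)

/-- `wp N V c Q σ`: started in `σ`, the command `c` runs each loop for at most `N` iterations,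
assigns no number above `V`, and halts in a state with `Q`. -/
def wp (N V : ℕ) : Cmd → (St → Prop) → St → Prop
  | skip, Q, σ => Q σ
  | assign x e, Q, σ => e.eval σ.v ≤ V ∧ Q (σ.set x (e.eval σ.v))
  | push e, Q, σ => σ.out.length < V ∧ Q (σ.push (e.eval σ.v))
  | seq c d, Q, σ => wp N V c (wp N V d Q) σ
  | ite e c d, Q, σ => (e.eval σ.v ≠ 0 → wp N V c Q σ) ∧ (e.eval σ.v = 0 → wp N V d Q σ)
  | loop x c, Q, σ => iter x (wp N V c) Q N σ

/-- Intermediate values of an expression are at most a fixed power of `V`, so each instruction costs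
a multiple of `Nat.size V` that depends only on the code; nested loops multiply the powers of `N`.
Entries of the output list are never read back by a command, so `St.Good` bounds only their number.
-/
lemma exists_run (N V : ℕ) (hV : 2 ≤ V) (c : Cmd) (hc : c.Fits) (Q : St → Prop) (σ : St)
    (hσ : σ.Good V) (h : wp N V c Q σ) (s : Mem) (hs : σ.Rep s) :
    ∃ t s' σ', Run c.code s t s' ∧ t ≤ c.cost.eval N * Nat.size V ∧ σ'.Rep s' ∧ σ'.Good V ∧
      Q σ' := by
  have h1 := one_le_size hV
  induction c generalizing Q σ s with
  | skip => exact ⟨_, _, σ, Run.skip s, by simpa [cost] using h1, hs, hσ, h⟩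
  | assign x e =>
    obtain ⟨he, hQ⟩ := h
    simp only [Fits] at hc
    obtain ⟨t, s', r, ht, hv, hf⟩ := e.run_code hV hσ.1 41 (by omega) s hs.1
    refine ⟨_, _, _, r.seq ((Run.const _ _ _).seq (Run.arith _ _ _ _ _)), ?_, ?_, ?_, hQ⟩
    · have := e.size_eval_le hV hσ.1
      simp only [cost, Polynomial.eval_C, Function.update_self, ne_eq, Nat.reduceEqDiff,
        not_false_eq_true, Function.update_of_ne, hv, Nat.size_zero]
      nlinarith
    · refine ⟨fun y => ?_, ?_, fun i => ?_⟩
      · have hy := y.idx_lt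
        by_cases hxy : y = x
        · subst hxy; simp [hv, Op.eval]
        · rw [Function.update_of_ne (fun h => hxy (Var.idx_injective h)),
            Function.update_of_ne (by omega), hf _ (Or.inl (by omega)), hs.1]
          simp [hxy]
      · have hx := x.idx_lt
        rw [Function.update_of_ne (by omega), Function.update_of_ne (by omega),
          hf _ (Or.inl (by omega)), hs.2.1]
        rfl
      · have hx := x.idx_lt
        rw [Function.update_of_ne (by omega), Function.update_of_ne (by omega),
          hf _ (Or.inr (by omega)), hs.2.2]
        rfl
    · refine ⟨fun y => ?_, hσ.2⟩
      rw [St.set_v]; split_ifs; exacts [he, hσ.1 y]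
  | push e =>
    obtain ⟨hl, hQ⟩ := h
    simp only [Fits] at hc
    obtain ⟨t, s', r, ht, hv, hf⟩ := e.run_code hV hσ.1 41 (by omega) s hs.1
    have hcnt : s' 40 = σ.out.length := by rw [hf _ (Or.inl (by omega)), hs.2.1]
    refine ⟨_, _, _, r.seq ((Run.const _ _ _).seq ((Run.arith _ _ _ _ _).seq
      ((Run.store _ _ _).seq ((Run.const _ _ _).seq (Run.arith _ _ _ _ _))))), ?_, ?_, ?_, hQ⟩
    · have := e.size_eval_le hV hσ.1
      have h2 : Nat.size σ.out.length ≤ Nat.size V := Nat.size_le_size hσ.2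
      have h3 : Nat.size (σ.out.length + 64) ≤ Nat.size V + 7 := by
        rw [Nat.size_le]
        have := (Nat.size_le.1 h2)
        rw [pow_add]
        have : 1 ≤ 2 ^ Nat.size V := Nat.one_le_two_pow
        omega
      have h64 : Nat.size 64 = 7 := rfl
      simp [cost, hv, Op.eval, hcnt, h64]
      nlinarith
    · refine ⟨fun y => ?_, ?_, fun i => ?_⟩
      · have hy := y.idx_lt
        have h1 : y.idx ≠ 40 := by omega
        have h2 : y.idx ≠ 42 := by omega
        have h3 : y.idx ≠ σ.out.length + 64 := by omega
        simp [h1, h2, h3, hcnt, Op.eval]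
        rw [hf _ (Or.inl (by omega)), hs.1]
      · simp [hcnt, Op.eval]
      · have h1 : 64 + i ≠ 40 := by omega
        have h2 : 64 + i ≠ 42 := by omega
        simp [Function.update_apply, h1, h2, hcnt, Op.eval, hv]
        by_cases hi : i = σ.out.length
        · subst hi
          simp [add_comm]
        · rw [if_neg (by omega), hf _ (Or.inr (by omega)), hs.2.2]
          by_cases hil : i < σ.out.length
          · simp [hil, List.getElem?_append_left]
          · simp only [not_lt] at hil
            have : σ.out.length + 1 ≤ i := by omega
            simp [hil, List.getElem?_eq_none, this]
    · refine ⟨fun y => hσ.1 y, by simpa using hl⟩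
  | seq c d ihc ihd =>
    obtain ⟨t, s₁, σ₁, r₁, ht₁, hr₁, hg₁, hQ₁⟩ := ihc hc.1 _ σ hσ h s hs
    obtain ⟨t', s₂, σ₂, r₂, ht₂, hr₂, hg₂, hQ₂⟩ := ihd hc.2 _ σ₁ hg₁ hQ₁ s₁ hr₁
    refine ⟨_, s₂, σ₂, r₁.seq r₂, ?_, hr₂, hg₂, hQ₂⟩
    simp only [cost, Polynomial.eval_add]
    nlinarith
  | ite e c d ihc ihd =>
    obtain ⟨hd, hc, hd'⟩ := hc
    obtain ⟨t, s', r, ht, hv, hf⟩ := e.run_code hV hσ.1 41 (by omega) s hs.1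
    have hsz := e.size_eval_le hV hσ.1
    have hs' : σ.Rep s' := by
      refine ⟨fun x => ?_, ?_, fun i => ?_⟩
      · have := x.idx_lt
        rw [hf _ (Or.inl (by omega)), hs.1]
      · rw [hf _ (Or.inl (by omega)), hs.2.1]
      · rw [hf _ (Or.inr (by omega)), hs.2.2]
    by_cases h0 : e.eval σ.v = 0
    · obtain ⟨t', s₂, σ₂, r₂, ht₂, hr₂, hg₂, hQ₂⟩ := ihd hd' _ σ hσ (h.2 h0) s' hs'
      refine ⟨_, s₂, σ₂, r.seq (Run.branch_false (by rw [hv, h0]) r₂), ?_, hr₂, hg₂, hQ₂⟩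
      simp only [cost, Polynomial.eval_add, Polynomial.eval_C, hv]
      nlinarith [Nat.zero_le (Polynomial.eval N c.cost * Nat.size V)]
    · obtain ⟨t', s₂, σ₂, r₂, ht₂, hr₂, hg₂, hQ₂⟩ := ihc hc _ σ hσ (h.1 h0) s' hs'
      refine ⟨_, s₂, σ₂, r.seq (Run.branch_true (by rwa [hv]) r₂), ?_, hr₂, hg₂, hQ₂⟩
      simp only [cost, Polynomial.eval_add, Polynomial.eval_C, hv]
      nlinarith [Nat.zero_le (Polynomial.eval N d.cost * Nat.size V)]
  | loop x c ih =>
    have key : ∀ k σ s, σ.Good V → σ.Rep s → iter x (wp N V c) Q k σ →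
        ∃ t s' σ', Run (Prog.loop x.idx c.code) s t s' ∧
          t ≤ (k * (2 + c.cost.eval N) + 2) * Nat.size V ∧ σ'.Rep s' ∧ σ'.Good V ∧ Q σ' := by
      intro k
      have hdone : ∀ k (σ : St) s, σ.Good V → σ.Rep s → (σ.v x = 0 ∧ Q σ) →
          ∃ t s' σ', Run (Prog.loop x.idx c.code) s t s' ∧
          t ≤ (k * (2 + c.cost.eval N) + 2) * Nat.size V ∧ σ'.Rep s' ∧ σ'.Good V ∧ Q σ' := by
        intro k σ s hσ hs h
        refine ⟨_, s, σ, Run.loop_done (by rw [hs.1, h.1]), ?_, hs, hσ, h.2⟩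
        rw [hs.1, h.1, Nat.size_zero]
        nlinarith [Nat.zero_le (k * (2 + c.cost.eval N) * Nat.size V)]
      induction k with
      | zero => intro σ s hσ hs h; exact hdone 0 σ s hσ hs h
      | succ k ihk =>
        intro σ s hσ hs h
        rcases h with h | ⟨h0, h⟩
        · exact hdone _ σ s hσ hs h
        · obtain ⟨t₁, s₁, σ₁, r₁, ht₁, hr₁, hg₁, hQ₁⟩ := ih hc _ σ hσ h s hs
          obtain ⟨t₂, s₂, σ₂, r₂, ht₂, hr₂, hg₂, hQ₂⟩ := ihk σ₁ s₁ hg₁ hr₁ hQ₁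
          refine ⟨_, s₂, σ₂, Run.loop_step (by rwa [hs.1]) r₁ r₂, ?_, hr₂, hg₂, hQ₂⟩
          have := Nat.size_le_size (hσ.1 x)
          rw [hs.1]
          nlinarith
    obtain ⟨t, s', σ', h⟩ := key N σ s hσ hs h
    refine ⟨t, s', σ', h.1, ?_, h.2.2⟩
    simpa [cost] using h.2.1

/-- The registers that a command may change. -/
def mods : Cmd → List Var
  | skip => []
  | assign x _ => [x]
  | push _ => []
  | seq c d => c.mods ++ d.mods
  | ite _ c d => c.mods ++ d.mods
  | loop _ c => c.mods

/-- The command writes no output. -/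
def silent : Cmd → Bool
  | skip => true
  | assign _ _ => true
  | push _ => false
  | seq c d => c.silent && d.silent
  | ite _ c d => c.silent && d.silent
  | loop _ c => c.silent

/-- `σ'` differs from `σ` only in what `c` may change. -/
def Frame (c : Cmd) (σ σ' : St) : Prop :=
  (∀ x, x ∉ c.mods → σ'.v x = σ.v x) ∧ (c.silent = true → σ'.out = σ.out)

lemma Frame.refl (c : Cmd) (σ : St) : Frame c σ σ := ⟨fun _ _ => rfl, fun _ => rfl⟩

lemma Frame.trans {c : Cmd} {σ σ' σ'' : St} (h : Frame c σ σ') (h' : Frame c σ' σ'') :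
    Frame c σ σ'' :=
  ⟨fun x hx => (h'.1 x hx).trans (h.1 x hx), fun hc => (h'.2 hc).trans (h.2 hc)⟩

lemma Frame.mono {c d : Cmd} {σ σ' : St} (h : Frame c σ σ')
    (hm : ∀ x, x ∈ c.mods → x ∈ d.mods) (hs : d.silent = true → c.silent = true) :
    Frame d σ σ' :=
  ⟨fun x hx => h.1 x fun hx' => hx (hm x hx'), fun hd => h.2 (hs hd)⟩

lemma iter_mono {x : Var} {w : (St → Prop) → St → Prop}
    (hw : ∀ (P Q : St → Prop) (σ : St), (∀ σ, P σ → Q σ) → w P σ → w Q σ)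
    {P Q : St → Prop} (h : ∀ σ, P σ → Q σ) (k : ℕ) (σ : St) (hP : iter x w P k σ) :
    iter x w Q k σ := by
  induction k generalizing σ with
  | zero => exact ⟨hP.1, h _ hP.2⟩
  | succ k ih =>
    rcases hP with hP | hP
    · exact Or.inl ⟨hP.1, h _ hP.2⟩
    · exact Or.inr ⟨hP.1, hw _ _ _ ih hP.2⟩

lemma wp_mono {N V : ℕ} {c : Cmd} {P Q : St → Prop} {σ : St} (h : ∀ σ, P σ → Q σ)
    (hP : wp N V c P σ) : wp N V c Q σ := by
  induction c generalizing P Q σ with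
  | skip => exact h _ hP
  | assign x e => exact ⟨hP.1, h _ hP.2⟩
  | push e => exact ⟨hP.1, h _ hP.2⟩
  | seq c d ihc ihd => exact ihc (fun σ => ihd h) hP
  | ite e c d ihc ihd => exact ⟨fun h0 => ihc h (hP.1 h0), fun h0 => ihd h (hP.2 h0)⟩
  | loop x c ih => exact iter_mono (w := wp N V c) (fun _ _ _ h => ih h) h N σ hP

/-- What the syntax alone guarantees can be added to any postcondition. Loop invariants can then
omit the registers that the body leaves alone; membership in `mods` is decidable by evaluation. -/
lemma wp_frame {N V : ℕ} {c : Cmd} {Q : St → Prop} {σ : St} (h : wp N V c Q σ) :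
    wp N V c (fun σ' => Q σ' ∧ Frame c σ σ') σ := by
  induction c generalizing Q σ with
  | skip => exact ⟨h, Frame.refl _ _⟩
  | assign x e =>
    refine ⟨h.1, h.2, fun y hy => ?_, fun _ => rfl⟩
    simp only [mods, List.mem_singleton] at hy
    simp [hy]
  | push e => exact ⟨h.1, h.2, fun _ _ => rfl, fun h => by simp [silent] at h⟩
  | seq c d ihc ihd =>
    change wp N V c _ σ
    refine wp_mono (fun σ₁ h₁ => ?_) (ihc h)
    refine wp_mono (fun σ₂ h₂ => ⟨h₂.1, ?_⟩) (ihd h₁.1)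
    refine (h₁.2.mono ?_ ?_).trans (h₂.2.mono ?_ ?_) <;> simp +contextual [mods, silent]
  | ite e c d ihc ihd =>
    refine ⟨fun h0 => wp_mono (fun σ₁ h₁ => ⟨h₁.1, h₁.2.mono ?_ ?_⟩) (ihc (h.1 h0)),
      fun h0 => wp_mono (fun σ₁ h₁ => ⟨h₁.1, h₁.2.mono ?_ ?_⟩) (ihd (h.2 h0))⟩ <;>
      simp +contextual [mods, silent]
  | loop x c ih =>
    have key : ∀ k σ, iter x (wp N V c) Q k σ →
        iter x (wp N V c) (fun σ' => Q σ' ∧ Frame (loop x c) σ σ') k σ := by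
      intro k
      induction k with
      | zero => exact fun σ h => ⟨h.1, h.2, Frame.refl _ _⟩
      | succ k ihk =>
        rintro σ (h | h)
        · exact Or.inl ⟨h.1, h.2, Frame.refl _ _⟩
        · refine Or.inr ⟨h.1, wp_mono (fun σ₁ h₁ => ?_) (ih h.2)⟩
          refine iter_mono (w := wp N V c) (fun _ _ _ h => wp_mono h) (fun σ₂ h₂ => ⟨h₂.1, ?_⟩) k σ₁ (ihk _ h₁.1)
          exact (h₁.2.mono (fun _ => id) id).trans h₂.2
    exact key N σ h

/-- The index of the invariant counts completed iterations, so `i < N` in the step is the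
termination argument. -/
lemma wp_loop {N V : ℕ} {x : Var} {c : Cmd} {Q : St → Prop} {σ : St} (Inv : ℕ → St → Prop)
    (h0 : Inv 0 σ)
    (hstep : ∀ i τ, Inv i τ → τ.v x ≠ 0 → i < N ∧ wp N V c (Inv (i + 1)) τ)
    (hQ : ∀ i τ, Inv i τ → τ.v x = 0 → Q τ) : wp N V (loop x c) Q σ := by
  have key : ∀ k i τ, i + k = N → Inv i τ → iter x (wp N V c) Q k τ := by
    intro k
    induction k with
    | zero =>
      intro i τ hi hI
      have hx : τ.v x = 0 := by
        by_contra hx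
        have := (hstep i τ hI hx).1
        omega
      exact ⟨hx, hQ i τ hI hx⟩
    | succ k ih =>
      intro i τ hi hI
      by_cases hx : τ.v x = 0
      · exact Or.inl ⟨hx, hQ i τ hI hx⟩
      · exact Or.inr ⟨hx, wp_mono (fun τ' h => ih (i + 1) τ' (by omega) h) (hstep i τ hI hx).2⟩
  exact key N 0 σ (by omega) h0

/-- The loop that runs `c` with `x = 0, 1, …, e - 1`; the register `y` counts downwards. -/
def forLoop (x y : Var) (e : Expr) (c : Cmd) : Cmd :=
  .seq (.assign y e) (.seq (.assign x (.lit 0)) (.loop y (.seq c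
    (.seq (.assign x (.op .add (.var x) (.lit 1))) (.assign y (.op .sub (.var y) (.lit 1)))))))

/-- The body must not touch the two counters, and `hI` makes the invariant blind to them, so that
their updates after the body are harmless. -/
lemma wp_forLoop {N V : ℕ} {x y : Var} {e : Expr} {c : Cmd} {Q : St → Prop} {σ : St} (n : ℕ)
    (Inv : ℕ → St → Prop) (hn : e.eval σ.v = n) (hN : n ≤ N) (hV : n ≤ V)
    (hxy : x ≠ y) (hx : x ∉ c.mods) (hy : y ∉ c.mods) (h0 : Inv 0 σ)
    (hI : ∀ i τ a, Inv i τ → Inv i (τ.set x a) ∧ Inv i (τ.set y a))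
    (hstep : ∀ i < n, ∀ τ, Inv i τ → τ.v x = i → Frame (forLoop x y e c) σ τ →
      wp N V c (Inv (i + 1)) τ)
    (hQ : ∀ τ, Inv n τ → Frame (forLoop x y e c) σ τ → Q τ) : wp N V (forLoop x y e c) Q σ := by
  have hfs : ∀ τ : St, ∀ a, Frame (forLoop x y e c) σ τ →
      Frame (forLoop x y e c) σ (τ.set x a) ∧ Frame (forLoop x y e c) σ (τ.set y a) := by
    intro τ a h
    refine ⟨⟨fun z hz => ?_, h.2⟩, fun z hz => ?_, h.2⟩ <;>
    · rw [← h.1 z hz]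
      simp only [forLoop, mods, List.mem_append, List.mem_singleton, not_or] at hz
      simp [hz]
  refine ⟨hn ▸ hV, Nat.zero_le _, wp_loop
    (fun i τ => i ≤ n ∧ Inv i τ ∧ τ.v x = i ∧ τ.v y = n - i ∧ Frame (forLoop x y e c) σ τ) ?_ ?_ ?_⟩
  · refine ⟨Nat.zero_le _, (hI _ _ _ (hI _ _ _ h0).2).1, by simp [Expr.eval], ?_, ?_⟩
    · simp [hn, Ne.symm hxy]
    · exact (hfs _ _ (hfs _ _ (Frame.refl _ _)).2).1
  · rintro i τ ⟨hin, hi, hix, hiy, hf⟩ h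
    have hin' : i < n := by omega
    refine ⟨by omega, ?_⟩
    change wp N V c _ τ
    refine wp_mono (fun τ' h' => ?_) (wp_frame (hstep i hin' τ hi hix hf))
    have e1 : τ'.v x = i := by rw [h'.2.1 x hx, hix]
    have e2 : τ'.v y = n - i := by rw [h'.2.1 y hy, hiy]
    refine ⟨?_, ?_, hin', (hI _ _ _ (hI _ _ _ h'.1).1).2, ?_, ?_, ?_⟩
    · simp only [Expr.eval, Op.eval, e1]; omega
    · simp only [Expr.eval, Op.eval, St.set_v, if_neg (Ne.symm hxy), e2]; omega
    · simp [Expr.eval, Op.eval, hxy, e1]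
    · simp [Expr.eval, Op.eval, Ne.symm hxy, e2]; omega
    · refine (hfs _ _ (hfs _ _ (hf.trans (h'.2.mono ?_ ?_))).1).2 <;>
        simp +contextual [forLoop, mods, silent]
  · rintro i τ ⟨hin, hi, hix, hiy, hf⟩ h
    obtain rfl : i = n := by omega
    exact hQ τ hi hf

end Cmd

/-! ### Delivery of the output list in the registers `1, …, n` -/

/-- Copies register `63 + i` to register `i` for `i = 1, …, k`. -/
def copyLow : ℕ → Prog
  | 0 => .skip
  | k + 1 => .seq (copyLow k) (.seq (.const (k + 1) (64 + k)) (.load (k + 1) (k + 1)))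

/-- Copies register `r₀ + i` to register `i` for `i = 1, …, k`. -/
def copyHigh : ℕ → Prog
  | 0 => .skip
  | k + 1 => .seq (copyHigh k) (.seq (.const (k + 1) (k + 1))
      (.seq (.arith .add (k + 1) (k + 1) 0) (.load (k + 1) (k + 1))))

/-- Moves the output list from the registers `64, 65, …` to the registers `1, 2, …`, up to its
order. -/
def epilogue : Prog :=
  .seq (.const 2 0) (.seq (.arith .add 0 40 2) (.seq (.const 1 63) (.seq (.arith .sub 1 1 40)
    (.branch 1 (copyLow 63) (copyHigh 63)))))

lemma size_add_le {a V : ℕ} (h : a ≤ V + 64) : Nat.size a ≤ Nat.size V + 7 := by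
  rw [Nat.size_le]
  have := V.lt_size_self
  rw [pow_add]
  have : 1 ≤ 2 ^ Nat.size V := Nat.one_le_two_pow
  omega

lemma run_copyLow (k : ℕ) (hk : k ≤ 63) (s : Mem) (V : ℕ) (hV : 2 ≤ V)
    (hs : ∀ i, s (64 + i) ≤ V) :
    ∃ t s', Run (copyLow k) s t s' ∧ t ≤ (1 + k * 40) * Nat.size V ∧
      ∀ a, s' a = if 1 ≤ a ∧ a ≤ k then s (63 + a) else s a := by
  have h1 := one_le_size hV
  induction k with
  | zero => exact ⟨_, _, Run.skip s, by simpa using h1, fun a => by rw [if_neg (by omega)]⟩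
  | succ k ih =>
    obtain ⟨t, s', r, ht, h⟩ := ih (by omega)
    refine ⟨_, _, r.seq ((Run.const _ _ _).seq (Run.load _ _ _)), ?_, ?_⟩
    · have e : Function.update s' (k + 1) (64 + k) (64 + k) = s (64 + k) := by
        rw [Function.update_of_ne (by omega), h, if_neg (by omega)]
      have h3 : Nat.size (64 + k) ≤ 7 := Nat.size_le.2 (by norm_num; omega)
      have h4 := Nat.size_le_size (hs k)
      simp only [Function.update_self, e]
      nlinarith
    · intro a
      by_cases ha : a = k + 1
      · subst ha
        rw [Function.update_self, Function.update_self, Function.update_of_ne (by omega), h,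
          if_neg (by omega), if_pos (by omega)]
        congr 1; omega
      · rw [Function.update_of_ne ha, Function.update_of_ne ha, h]
        congr 1
        simp only [eq_iff_iff]; omega

lemma run_copyHigh (k : ℕ) (hk : k ≤ 63) (s : Mem) (V : ℕ) (hV : 2 ≤ V) (h0 : 63 ≤ s 0)
    (h0V : s 0 ≤ V) (hs : ∀ i, s (64 + i) ≤ V) :
    ∃ t s', Run (copyHigh k) s t s' ∧ t ≤ (1 + k * 70) * Nat.size V ∧
      ∀ a, s' a = if 1 ≤ a ∧ a ≤ k then s (s 0 + a) else s a := by
  have h1 := one_le_size hV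
  induction k with
  | zero => exact ⟨_, _, Run.skip s, by simpa using h1, fun a => by rw [if_neg (by omega)]⟩
  | succ k ih =>
    obtain ⟨t, s', r, ht, h⟩ := ih (by omega)
    have e0 : s' 0 = s 0 := by rw [h, if_neg (by omega)]
    refine ⟨_, _, r.seq ((Run.const _ _ _).seq ((Run.arith _ _ _ _ _).seq (Run.load _ _ _))),
      ?_, ?_⟩
    · have h3 : Nat.size (k + 1) ≤ 7 := Nat.size_le.2 (by norm_num; omega)
      have h5 : Nat.size (k + 1 + s 0) ≤ Nat.size V + 7 := size_add_le (by omega)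
      have h6 : Nat.size (s 0) ≤ Nat.size V := Nat.size_le_size h0V
      have e : s' (k + 1 + s 0) = s (64 + (s 0 - 63 + k)) := by
        rw [h, if_neg (by omega)]; congr 1; omega
      have h4 := Nat.size_le_size (hs (s 0 - 63 + k))
      have hne : k + 1 + s 0 ≠ k + 1 := by omega
      simp only [Function.update_self, Op.eval, Function.update_of_ne (show 0 ≠ k + 1 by omega),
        e0, Function.update_of_ne hne, e]
      nlinarith
    · intro a
      by_cases ha : a = k + 1
      · subst ha
        have hne : k + 1 + s 0 ≠ k + 1 := by omega
        simp only [Function.update_self, Op.eval,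
          Function.update_of_ne (show 0 ≠ k + 1 by omega), e0, Function.update_of_ne hne]
        rw [h, if_neg (by omega), if_pos (by omega)]
        congr 1; omega
      · rw [Function.update_of_ne ha, Function.update_of_ne ha, Function.update_of_ne ha, h]
        congr 1
        simp only [eq_iff_iff]; omega

/-- A list with fewer than `63` entries is copied down as a whole. In a longer list, the entries in
registers `64, …, n` already lie in the output range, and only the last `63` are moved, into the
registers `1, …, 63`. The output is a rotation of the list, which is enough for a multiset. -/
lemma run_epilogue (σ : St) (V : ℕ) (hV : 2 ≤ V) (hσ : σ.Good V) (hout : ∀ a ∈ σ.out, a ≤ V)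
    (s : Mem) (hs : σ.Rep s) :
    ∃ t s', Run epilogue s t s' ∧ t ≤ 5000 * Nat.size V ∧
      (output s' : Multiset ℕ) = (σ.out : Multiset ℕ) := by
  have h1 := one_le_size hV
  set n := σ.out.length with hn
  have hnV : Nat.size n ≤ Nat.size V := Nat.size_le_size hσ.2
  have h40 : s 40 = n := hs.2.1
  set s₄ : Mem := Function.update (Function.update (Function.update s 2 0) 0 n) 1 (63 - n)
    with hs₄
  have r₄ : ∀ t s', Run (.branch 1 (copyLow 63) (copyHigh 63)) s₄ t s' →
      ∃ t', Run epilogue s t' s' ∧ t' ≤ t + 20 * Nat.size V := by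
    intro t s' r
    have e2 : (Function.update s 2 0) 40 = n := by simpa using h40
    have a1 := Run.arith .add 0 40 2 (Function.update s 2 0)
    have a2 := Run.arith .sub 1 1 40 (Function.update (Function.update (Function.update s 2 0)
      0 n) 1 63)
    have h63 : Nat.size 63 = 6 := rfl
    simp [Op.eval, h40, h63] at a1 a2
    refine ⟨_, (Run.const 2 0 s).seq (a1.seq ((Run.const 1 63 _).seq (a2.seq r))), ?_⟩
    simp only [h63, Nat.size_zero]
    omega
  have hs64 : ∀ i, s₄ (64 + i) = σ.out.getD i 0 := by
    intro i
    rw [← hs.2.2 i, hs₄, Function.update_of_ne (by omega), Function.update_of_ne (by omega),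
      Function.update_of_ne (by omega)]
  -- The copying may read past the end of the list; those registers still hold their initial `0`, so
  -- their cost is bounded as well.
  have hle : ∀ i, s₄ (64 + i) ≤ V := by
    intro i
    rw [hs64]
    by_cases hi : i < n
    · rw [List.getD_eq_getElem _ _ hi]
      exact hout _ (List.getElem_mem hi)
    · rw [List.getD_eq_default _ _ (by omega)]; omega
  have e0 : s₄ 0 = n := by simp [hs₄]
  have e1 : s₄ 1 = 63 - n := by simp [hs₄]
  have hsz1 : Nat.size (63 - n) ≤ 7 := Nat.size_le.2 (by norm_num; omega)
  by_cases hn63 : 63 - n = 0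
  · obtain ⟨t, s', r, ht, h⟩ := run_copyHigh 63 le_rfl s₄ V hV (by omega) (by rw [e0]; exact hσ.2) hle
    obtain ⟨t', r', ht'⟩ := r₄ _ _ (Run.branch_false (by rw [e1, hn63]) r)
    refine ⟨t', s', r', ?_, ?_⟩
    · rw [e1] at ht'; omega
    · have key : output s' = σ.out.drop (n - 63) ++ σ.out.take (n - 63) := by
        have hs0 : s' 0 = n := by rw [h, if_neg (by omega), e0]
        refine List.ext_getElem (by simp [output, hs0, ← hn]) fun i hi hi' => ?_
        simp only [output, List.length_map, List.length_range, hs0] at hi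
        simp only [output, List.getElem_map, List.getElem_range, h, e0]
        by_cases hi63 : i < 63
        · rw [List.getElem_append_left (by simp [← hn]; omega), if_pos (by omega),
            show n + (i + 1) = 64 + (n - 63 + i) by omega, hs64,
            List.getD_eq_getElem _ _ (by omega)]
          simp
        · rw [List.getElem_append_right (by simp [← hn]; omega), if_neg (by omega),
            show i + 1 = 64 + (i - 63) by omega, hs64, List.getD_eq_getElem _ _ (by omega)]
          simp only [List.getElem_take, List.length_drop, ← hn]
          congr 1; omega
      rw [key, Multiset.coe_eq_coe]
      exact List.perm_append_comm.trans (by rw [List.take_append_drop])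
  · obtain ⟨t, s', r, ht, h⟩ := run_copyLow 63 le_rfl s₄ V hV hle
    obtain ⟨t', r', ht'⟩ := r₄ _ _ (Run.branch_true (by rwa [e1]) r)
    refine ⟨t', s', r', ?_, ?_⟩
    · rw [e1] at ht'; omega
    · have key : output s' = σ.out := by
        have hs0 : s' 0 = n := by rw [h, if_neg (by omega), e0]
        refine List.ext_getElem (by simp [output, hs0, ← hn]) fun i hi hi' => ?_
        simp only [output, List.getElem_map, List.getElem_range, h]
        rw [if_pos (by omega), show 63 + (i + 1) = 64 + i by omega, hs64,
          List.getD_eq_getElem _ _ hi']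
      rw [key]

/-- The initial state of a command on input `m` with the constant `E`. -/
def St.init (m E : ℕ) : St := ⟨fun x => if x = .m then m else if x = .E then E else 0, []⟩

/-- The program that runs a command and delivers its output list. -/
def Cmd.program (c : Cmd) : Prog := .seq c.code epilogue

lemma Cmd.run_program (N V m E : ℕ) (hV : 2 ≤ V) (hm : m ≤ V) (hE : E ≤ V) (c : Cmd)
    (hc : c.Fits) (Q : List ℕ → Prop) (hQ : ∀ Z, Q Z → ∀ a ∈ Z, a ≤ V)
    (h : c.wp N V (fun σ => Q σ.out) (St.init m E)) :
    ∃ t s Z, Run (.seq (.const 1 E) c.program) (input m) t s ∧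
      t ≤ (c.cost.eval N + 5002) * Nat.size V ∧ Q Z ∧
      (output s : Multiset ℕ) = (Z : Multiset ℕ) := by
  have h1 := one_le_size hV
  have hg : (St.init m E).Good V := by
    refine ⟨fun x => ?_, Nat.zero_le _⟩
    simp only [St.init]; split_ifs <;> omega
  have hr : (St.init m E).Rep (Function.update (input m) 1 E) := by
    refine ⟨fun x => ?_, rfl, fun i => ?_⟩
    · cases x <;> rfl
    · rw [Function.update_of_ne (by omega), input, Function.update_of_ne (by omega)]; rfl
  obtain ⟨t, s, σ, r, ht, hrep, hgood, hσ⟩ := c.exists_run N V hV hc _ _ hg h _ hr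
  obtain ⟨t', s', r', ht', ho⟩ := run_epilogue σ V hV hgood (hQ _ hσ) s hrep
  refine ⟨_, s', _, (Run.const 1 E _).seq (r.seq r'), ?_, hσ, ho⟩
  have := Nat.size_le_size hE
  nlinarith

end SmallBias

/-! ### A balanced symmetric set modulo `q` by the method of conditional expectations -/

namespace SmallBias
open Finset

/-- The odd residue `2 * τ + 1` modulo `2 * q`. -/
def oddRes (q τ : ℕ) : ZMod (2 * q) := ((2 * τ + 1 : ℕ) : ZMod (2 * q))

/-- This is the reason for odd residues modulo `2 * q`: the reflection of `{0, …, q - 1}` becomes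
negation, which makes the character sums real. -/
lemma oddRes_mirror {q t : ℕ} (ht : t < q) : oddRes q (q - 1 - t) = -oddRes q t := by
  rw [eq_neg_iff_add_eq_zero, oddRes, oddRes, ← Nat.cast_add,
    show 2 * (q - 1 - t) + 1 + (2 * t + 1) = 2 * q by omega, ZMod.natCast_self]

/-- The coefficients of the product over `τ` in the list of `Δ + X ^ (2 τ + 1) + X ^ -(2 τ + 1)`
modulo `X ^ (2 q) - 1`. -/
def coef (q Δ : ℕ) : List ℕ → ZMod (2 * q) → ℕ
  | [] => fun y => if y = 0 then 1 else 0
  | τ :: ts => fun y =>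
      Δ * coef q Δ ts y + coef q Δ ts (y - oddRes q τ) + coef q Δ ts (y + oddRes q τ)

section
variable {q : ℕ} [NeZero q]

/-- The real part of the standard additive character. -/
noncomputable def cosChar (q : ℕ) [NeZero q] (y : ZMod (2 * q)) : ℝ :=
  (ZMod.stdAddChar y : ℂ).re

/-- The Fourier coefficients of `coef`. -/
noncomputable def coefHat (q : ℕ) [NeZero q] (Δ : ℕ) (ts : List ℕ) (k : ZMod (2 * q)) : ℝ :=
  (ts.map fun τ => (Δ : ℝ) + 2 * cosChar q (k * oddRes q τ)).prod

/-- The sum of the Fourier coefficients at the frequencies other than `0` and `q`. -/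
noncomputable def potential (q : ℕ) [NeZero q] (Δ : ℕ) (ts : List ℕ) : ℝ :=
  ∑ k ∈ univ.filter (fun k : ZMod (2 * q) => k ≠ 0 ∧ k ≠ (q : ZMod (2 * q))), coefHat q Δ ts k

lemma stdAddChar_neg (y : ZMod (2 * q)) :
    (ZMod.stdAddChar (-y) : ℂ) = starRingEnd ℂ (ZMod.stdAddChar y) :=
  AddChar.map_neg_eq_conj _ _

lemma abs_cosChar_le (y : ZMod (2 * q)) : |cosChar q y| ≤ 1 := by
  refine (Complex.abs_re_le_norm _).trans (le_of_eq ?_)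
  exact AddChar.norm_apply _ _

lemma cosChar_neg (y : ZMod (2 * q)) : cosChar q (-y) = cosChar q y := by
  simp [cosChar, stdAddChar_neg]

lemma stdAddChar_add_neg (y : ZMod (2 * q)) :
    (ZMod.stdAddChar y : ℂ) + ZMod.stdAddChar (-y) = ((2 * cosChar q y : ℝ) : ℂ) := by
  rw [stdAddChar_neg, Complex.add_conj]; rfl

lemma sum_coef_mul_stdAddChar (Δ : ℕ) (ts : List ℕ) (k : ZMod (2 * q)) :
    ∑ y, (coef q Δ ts y : ℂ) * ZMod.stdAddChar (k * y) = (coefHat q Δ ts k : ℂ) := by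
  induction ts with
  | nil => simp [coef, coefHat]
  | cons τ ts ih =>
    have h1 : ∑ y, (coef q Δ ts (y - oddRes q τ) : ℂ) * ZMod.stdAddChar (k * y) =
        ZMod.stdAddChar (k * oddRes q τ) * (coefHat q Δ ts k : ℂ) := by
      rw [← ih, ← Equiv.sum_comp (Equiv.addRight (oddRes q τ)), mul_sum]
      refine sum_congr rfl fun y _ => ?_
      simp [mul_add, AddChar.map_add_eq_mul]; ring
    have h2 : ∑ y, (coef q Δ ts (y + oddRes q τ) : ℂ) * ZMod.stdAddChar (k * y) =
        ZMod.stdAddChar (-(k * oddRes q τ)) * (coefHat q Δ ts k : ℂ) := by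
      rw [← ih, ← Equiv.sum_comp (Equiv.subRight (oddRes q τ)), mul_sum]
      refine sum_congr rfl fun y _ => ?_
      rw [Equiv.subRight_apply, sub_add_cancel, mul_sub, sub_eq_add_neg, AddChar.map_add_eq_mul]
      ring
    simp only [coef, Nat.cast_add, Nat.cast_mul, add_mul, sum_add_distrib, h1, h2]
    simp only [mul_assoc, ← mul_sum, ih]
    rw [add_assoc, ← add_mul, stdAddChar_add_neg, ← add_mul]
    simp [coefHat]

/-- Fourier inversion; as `coefHat` is real, taking real parts leaves only cosines. -/
lemma sum_coefHat_mul_cosChar (Δ : ℕ) (ts : List ℕ) (z : ZMod (2 * q)) :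
    ∑ k, coefHat q Δ ts k * cosChar q (k * z) = (2 * q : ℕ) * (coef q Δ ts z : ℝ) := by
  have key : ∑ k : ZMod (2 * q), (coefHat q Δ ts k : ℂ) * ZMod.stdAddChar (-(k * z)) =
      (2 * q : ℕ) * (coef q Δ ts z : ℂ) := by
    simp only [← sum_coef_mul_stdAddChar, sum_mul]
    rw [sum_comm]
    have : ∀ y : ZMod (2 * q), ∑ k : ZMod (2 * q), (coef q Δ ts y : ℂ) *
        ZMod.stdAddChar (k * y) * ZMod.stdAddChar (-(k * z)) =
        if y = z then (2 * q : ℕ) * (coef q Δ ts z : ℂ) else 0 := by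
      intro y
      have h := AddChar.sum_mulShift (y - z) (ZMod.isPrimitive_stdAddChar (2 * q))
      have e : ∀ k : ZMod (2 * q), k * y + -(k * z) = k * (y - z) := fun k => by ring
      simp only [mul_assoc, ← AddChar.map_add_eq_mul, ← mul_sum, e]
      rw [h]
      by_cases hyz : y = z
      · subst hyz; simp [ZMod.card]; ring
      · have : y - z ≠ 0 := by rwa [sub_ne_zero]
        simp [hyz, this]
    simp [this]
  have h2 := congrArg Complex.re key
  rw [Complex.re_sum] at h2
  rw [show ((2 * q : ℕ) : ℝ) * (coef q Δ ts z : ℝ) =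
    (((2 * q : ℕ) : ℂ) * (coef q Δ ts z : ℂ)).re by norm_cast, ← h2]
  refine sum_congr rfl fun k _ => ?_
  rw [Complex.re_ofReal_mul]
  congr 1
  exact (cosChar_neg _).symm

lemma coefHat_cons (Δ τ : ℕ) (ts : List ℕ) (k : ZMod (2 * q)) :
    coefHat q Δ (τ :: ts) k = (Δ + 2 * cosChar q (k * oddRes q τ)) * coefHat q Δ ts k := by
  simp [coefHat]

lemma factor_nonneg {Δ : ℕ} (hΔ : 2 ≤ Δ) (y : ZMod (2 * q)) :
    0 ≤ (Δ : ℝ) + 2 * cosChar q y := by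
  have h := abs_le.1 (abs_cosChar_le y)
  have : (2 : ℝ) ≤ Δ := by exact_mod_cast hΔ
  linarith

lemma coefHat_nonneg {Δ : ℕ} (hΔ : 2 ≤ Δ) (ts : List ℕ) (k : ZMod (2 * q)) :
    0 ≤ coefHat q Δ ts k := by
  refine List.prod_nonneg fun a ha => ?_
  obtain ⟨τ, -, rfl⟩ := List.mem_map.1 ha
  exact factor_nonneg hΔ _

lemma potential_nonneg {Δ : ℕ} (hΔ : 2 ≤ Δ) (ts : List ℕ) : 0 ≤ potential q Δ ts :=
  sum_nonneg fun _ _ => coefHat_nonneg hΔ _ _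

lemma stdAddChar_half : (ZMod.stdAddChar (q : ZMod (2 * q)) : ℂ) = -1 := by
  have hq : (q : ℂ) ≠ 0 := by exact_mod_cast NeZero.ne q
  have := ZMod.stdAddChar_coe (N := 2 * q) (q : ℤ)
  rw [Int.cast_natCast] at this
  rw [this, ← Complex.exp_pi_mul_I]
  congr 1
  push_cast
  field_simp

lemma stdAddChar_half_mul_oddRes (τ : ℕ) :
    (ZMod.stdAddChar ((q : ZMod (2 * q)) * oddRes q τ) : ℂ) = -1 := by
  have : (q : ZMod (2 * q)) * oddRes q τ = q := by
    have h0 : ((2 * q : ℕ) : ZMod (2 * q)) = 0 := ZMod.natCast_self _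
    push_cast at h0
    rw [oddRes]; push_cast
    linear_combination (τ : ZMod (2 * q)) * h0
  rw [this, stdAddChar_half]

/-- The frequency `q` has the value `-1` at every odd residue. An upper bound for cosine sums at all
frequencies therefore yields a lower bound too. -/
lemma cosChar_add_half (k : ZMod (2 * q)) (τ : ℕ) :
    cosChar q ((k + q) * oddRes q τ) = -cosChar q (k * oddRes q τ) := by
  rw [cosChar, add_mul, AddChar.map_add_eq_mul, stdAddChar_half_mul_oddRes]
  simp [cosChar]

lemma half_ne_zero : (q : ZMod (2 * q)) ≠ 0 := by
  intro h
  have := stdAddChar_half (q := q)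
  rw [h, AddChar.map_zero_eq_one] at this
  norm_num at this

lemma sum_eq_filter_add (g : ZMod (2 * q) → ℝ) : ∑ k, g k =
    ∑ k ∈ univ.filter (fun k : ZMod (2 * q) => k ≠ 0 ∧ k ≠ (q : ZMod (2 * q))), g k +
      g 0 + g q := by
  have : (univ.filter fun k : ZMod (2 * q) => k ≠ 0 ∧ k ≠ (q : ZMod (2 * q))) =
      (univ.erase 0).erase (q : ZMod (2 * q)) := by
    ext k; simp [and_comm]
  rw [this, ← add_sum_erase univ g (mem_univ 0),
    ← add_sum_erase (univ.erase (0 : ZMod (2 * q))) g (a := (q : ZMod (2 * q)))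
      (mem_erase.2 ⟨half_ne_zero, mem_univ _⟩)]
  ring

lemma cosChar_zero : cosChar q 0 = 1 := by simp [cosChar]

lemma coefHat_zero (Δ : ℕ) (ts : List ℕ) :
    coefHat q Δ ts 0 = ((Δ : ℝ) + 2) ^ ts.length := by
  simp [coefHat, cosChar_zero]

lemma coefHat_half (Δ : ℕ) (ts : List ℕ) :
    coefHat q Δ ts q = ((Δ : ℝ) - 2) ^ ts.length := by
  simp [coefHat, cosChar, stdAddChar_half_mul_oddRes, sub_eq_add_neg]

/-- By Fourier inversion, with the terms at the frequencies `0` and `q` subtracted, the new element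
enters only through one integer coefficient. Comparing candidates needs no real arithmetic. -/
lemma potential_cons (Δ τ : ℕ) (ts : List ℕ) :
    potential q Δ (τ :: ts) = Δ * potential q Δ ts + 2 * ((2 * q : ℕ) *
      (coef q Δ ts (oddRes q τ) : ℝ) - ((Δ : ℝ) + 2) ^ ts.length +
      ((Δ : ℝ) - 2) ^ ts.length) := by
  rw [← sum_coefHat_mul_cosChar, sum_eq_filter_add, coefHat_zero, coefHat_half, zero_mul,
    cosChar_zero, show cosChar q ((q : ZMod (2 * q)) * oddRes q τ) = -1 by
      rw [cosChar, stdAddChar_half_mul_oddRes]; simp]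
  simp only [potential, coefHat_cons, add_mul, sum_add_distrib, ← mul_sum]
  simp only [mul_assoc, ← mul_sum]
  have : ∀ k : ZMod (2 * q), cosChar q (k * oddRes q τ) * coefHat q Δ ts k =
    coefHat q Δ ts k * cosChar q (k * oddRes q τ) := fun k => mul_comm _ _
  simp only [this]
  ring

lemma two_mul_ne_zero {k : ZMod (2 * q)} (h0 : k ≠ 0) (hq : k ≠ q) : 2 * k ≠ 0 := by
  intro h
  have hk := k.val_lt
  have h1 : ((2 * k.val : ℕ) : ZMod (2 * q)) = 0 := by
    push_cast; rw [ZMod.natCast_zmod_val, h]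
  rw [ZMod.natCast_eq_zero_iff] at h1
  have h2 : q ∣ k.val := Nat.dvd_of_mul_dvd_mul_left two_pos h1
  obtain ⟨a, ha⟩ := h2
  have ha2 : a < 2 := by
    by_contra hc
    have : q * 2 ≤ q * a := Nat.mul_le_mul_left _ (by omega)
    omega
  interval_cases a
  · exact h0 ((ZMod.val_eq_zero k).1 (by omega))
  · apply hq
    rw [← ZMod.natCast_zmod_val k, ha, mul_one]

lemma sum_cosChar_mul_oddRes {k : ZMod (2 * q)} (h0 : k ≠ 0) (hq : k ≠ q) :
    ∑ τ ∈ range q, cosChar q (k * oddRes q τ) = 0 := by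
  have h1 : ∀ τ, (ZMod.stdAddChar (k * oddRes q τ) : ℂ) =
      ZMod.stdAddChar k * (ZMod.stdAddChar (2 * k)) ^ τ := by
    intro τ
    rw [← AddChar.map_nsmul_eq_pow, ← AddChar.map_add_eq_mul]
    congr 1
    rw [oddRes, nsmul_eq_mul]; push_cast; ring
  have hne : (ZMod.stdAddChar (2 * k) : ℂ) ≠ 1 := by
    intro h
    apply two_mul_ne_zero h0 hq
    apply ZMod.injective_stdAddChar
    rw [h, AddChar.map_zero_eq_one]
  have hpow : (ZMod.stdAddChar (2 * k) : ℂ) ^ q = 1 := by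
    rw [← AddChar.map_nsmul_eq_pow, nsmul_eq_mul, show (q : ZMod (2 * q)) * (2 * k) = 0 by
      have h0 : ((2 * q : ℕ) : ZMod (2 * q)) = 0 := ZMod.natCast_self _
      push_cast at h0
      linear_combination k * h0, AddChar.map_zero_eq_one]
  have h2 : ∑ τ ∈ range q, (ZMod.stdAddChar (k * oddRes q τ) : ℂ) = 0 := by
    simp only [h1, ← mul_sum]
    rw [geom_sum_eq hne, hpow]; simp
  have := congrArg Complex.re h2
  rwa [Complex.re_sum] at this

/-- On average over `τ` the cosine term vanishes at every frequency other than `0` and `q`; these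
two are left out of the potential because their cosines are constant. -/
lemma sum_potential_cons (Δ : ℕ) (ts : List ℕ) :
    ∑ τ ∈ range q, potential q Δ (τ :: ts) = q * (Δ * potential q Δ ts) := by
  simp only [potential, coefHat_cons]
  rw [sum_comm, mul_sum, mul_sum]
  refine sum_congr rfl fun k hk => ?_
  simp only [mem_filter] at hk
  rw [← sum_mul, sum_add_distrib, ← mul_sum, sum_cosChar_mul_oddRes hk.2.1 hk.2.2]
  simp; ring

/-- The potential increases with the coefficient in `potential_cons`, so `τ` is no worse than the
average over `A`; since potentials are nonnegative, the sum over `A` is at most the full sum. -/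
lemma potential_cons_le {Δ : ℕ} (hΔ : 2 ≤ Δ) (ts : List ℕ) (A : Finset ℕ) (hA : A ⊆ range q)
    (τ : ℕ) (hτ : ∀ a ∈ A, coef q Δ ts (oddRes q τ) ≤ coef q Δ ts (oddRes q a)) :
    A.card * potential q Δ (τ :: ts) ≤ q * (Δ * potential q Δ ts) := by
  rw [← sum_potential_cons]
  calc (A.card : ℝ) * potential q Δ (τ :: ts) = ∑ a ∈ A, potential q Δ (τ :: ts) := by simp
    _ ≤ ∑ a ∈ A, potential q Δ (a :: ts) := by
      refine sum_le_sum fun a ha => ?_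
      rw [potential_cons, potential_cons]
      have : (coef q Δ ts (oddRes q τ) : ℝ) ≤ coef q Δ ts (oddRes q a) := by
        exact_mod_cast hτ a ha
      gcongr
    _ ≤ _ := sum_le_sum_of_subset_of_nonneg hA fun _ _ _ => potential_nonneg hΔ _

lemma potential_nil_le (Δ : ℕ) : potential q Δ [] ≤ (2 * q : ℕ) := by
  simp only [potential, coefHat, List.map_nil, List.prod_nil, sum_const, nsmul_eq_mul, mul_one]
  exact_mod_cast (card_filter_le _ _).trans (by simp [ZMod.card])

lemma sum_coef (Δ : ℕ) (ts : List ℕ) : ∑ y, coef q Δ ts y = (Δ + 2) ^ ts.length := by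
  have := sum_coef_mul_stdAddChar Δ ts (0 : ZMod (2 * q))
  simp only [zero_mul, AddChar.map_zero_eq_one, mul_one, coefHat_zero] at this
  exact_mod_cast this

lemma coef_le (Δ : ℕ) (ts : List ℕ) (y : ZMod (2 * q)) :
    coef q Δ ts y ≤ (Δ + 2) ^ ts.length := by
  rw [← sum_coef (q := q)]
  exact single_le_sum (f := coef q Δ ts) (fun _ _ => Nat.zero_le _) (mem_univ y)

/-- From the potential to a bound for the exponential sums. -/
lemma abs_sum_cosChar_le {E : ℕ} (hE : 1 ≤ E) (ts : List ℕ) (P : ℝ)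
    (hP : potential q (32 * E) ts ≤ P * (32 * E : ℕ) ^ ts.length)
    (hlen : 128 * E ^ 2 * Real.log P ≤ ts.length) {k : ZMod (2 * q)} (h0 : k ≠ 0)
    (hq : k ≠ q) :
    (ts.map fun τ => cosChar q (k * oddRes q τ)).sum ≤ ts.length / (4 * E) := by
  have hE' : (1 : ℝ) ≤ E := by exact_mod_cast hE
  set D : ℝ := ((32 * E : ℕ) : ℝ) with hD
  have hD32 : D = 32 * E := by rw [hD]; push_cast; ring
  have hDpos : 0 < D := by rw [hD32]; linarith
  have hle : coefHat q (32 * E) ts k ≤ P * D ^ ts.length := by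
    refine le_trans ?_ hP
    exact single_le_sum (f := coefHat q (32 * E) ts)
      (fun _ _ => coefHat_nonneg (by omega) _ _) (by simp [h0, hq])
  have hprod : (ts.map fun τ => 1 + 2 * cosChar q (k * oddRes q τ) / D).prod ≤ P := by
    have : coefHat q (32 * E) ts k =
        D ^ ts.length * (ts.map fun τ => 1 + 2 * cosChar q (k * oddRes q τ) / D).prod := by
      clear hP hlen hle
      induction ts with
      | nil => simp [coefHat]
      | cons τ ts ih =>
        rw [coefHat_cons, ih, ← hD, List.length_cons, List.map_cons, List.prod_cons]
        field_simp
        ring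
    rw [this, mul_comm] at hle
    exact le_of_mul_le_mul_right hle (by positivity)
  -- For `y ≥ -1/2`, `log (1 + y) ≥ y / (1 + y) ≥ y - 2 * y^2`; here `y = 2 * c / D` with `|c| ≤ 1`,
  -- so `2 * y^2 ≤ 8 / D^2`.
  have hfac : ∀ τ, Real.exp (2 * cosChar q (k * oddRes q τ) / D - 8 / D ^ 2) ≤
      1 + 2 * cosChar q (k * oddRes q τ) / D := by
    intro τ
    have hc := abs_le.1 (abs_cosChar_le (k * oddRes q τ))
    set c := cosChar q (k * oddRes q τ)
    set y := 2 * c / D with hy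
    have hy2 : y ^ 2 ≤ 4 / D ^ 2 := by
      rw [hy, div_pow]
      gcongr
      nlinarith
    have hyl : -(1 / 2) ≤ y := by
      rw [hy, le_div_iff₀ hDpos]; nlinarith
    have hpos : 0 < 1 + y := by linarith
    rw [← Real.le_log_iff_exp_le hpos]
    have h1 := Real.one_sub_inv_le_log_of_pos hpos
    have h2 : y - 2 * y ^ 2 ≤ 1 - (1 + y)⁻¹ := by
      rw [inv_eq_one_div, le_sub_iff_add_le, ← le_sub_iff_add_le', div_le_iff₀ hpos]
      nlinarith [sq_nonneg y]
    have h3 : (8 : ℝ) / D ^ 2 = 2 * (4 / D ^ 2) := by ring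
    linarith
  have hexp : Real.exp ((ts.map fun τ => 2 * cosChar q (k * oddRes q τ) / D - 8 / D ^ 2).sum) ≤
      (ts.map fun τ => 1 + 2 * cosChar q (k * oddRes q τ) / D).prod := by
    clear hP hlen hle hprod
    induction ts with
    | nil => simp
    | cons τ ts ih =>
      simp only [List.map_cons, List.sum_cons, List.prod_cons, Real.exp_add]
      exact mul_le_mul (hfac τ) ih (Real.exp_pos _).le ((Real.exp_pos _).le.trans (hfac τ))
  have hPpos : 0 < P := (Real.exp_pos _).trans_le (hexp.trans hprod)
  have hlog := (Real.le_log_iff_exp_le hPpos).2 (hexp.trans hprod)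
  have hsum : (ts.map fun τ => 2 * cosChar q (k * oddRes q τ) / D - 8 / D ^ 2).sum =
      2 / D * (ts.map fun τ => cosChar q (k * oddRes q τ)).sum - ts.length * (8 / D ^ 2) := by
    clear hP hlen hle hprod hexp hlog
    induction ts with
    | nil => simp
    | cons τ ts ih =>
      simp only [List.map_cons, List.sum_cons, ih, List.length_cons]; push_cast; ring
  rw [hsum, hD32] at hlog
  set S := (ts.map fun τ => cosChar q (k * oddRes q τ)).sum
  set n : ℝ := (ts.length : ℝ)
  -- With `D = 32 * E` the quadratic loss is `n / (128 * E^2)`. Hence `8 * E * S ≤ n + 128 * E^2 *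
  -- log P ≤ 2 * n`.
  have e1 : 2 / (32 * (E : ℝ)) * S - n * (8 / (32 * E) ^ 2) =
      (8 * E * S - n) / (128 * E ^ 2) := by
    field_simp; ring
  rw [e1, div_le_iff₀ (by positivity)] at hlog
  rw [le_div_iff₀ (by positivity)]
  nlinarith

/-- The numbers `τ` in the list and their mirror images `q - 1 - τ`. -/
def symm (q : ℕ) (ts : List ℕ) : Finset ℕ := (ts ++ ts.map (q - 1 - ·)).toFinset

/-- The list is the result of the first steps of the greedy choice, of which there are `n`. -/
structure Greedy (q E n : ℕ) [NeZero q] (ts : List ℕ) : Prop where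
  lt : ∀ τ ∈ ts, τ < q
  nodup : (ts ++ ts.map (q - 1 - ·)).Nodup
  potential_le : potential q (32 * E) ts * (1 - 2 * n / q) ^ ts.length ≤
    (2 * q : ℕ) * ((32 * E : ℕ) : ℝ) ^ ts.length

lemma Greedy.nil (q E n : ℕ) [NeZero q] : Greedy q E n [] :=
  ⟨by simp, by simp, by simpa using potential_nil_le (32 * E)⟩

lemma Greedy.card_symm {E n : ℕ} {ts : List ℕ} (h : Greedy q E n ts) :
    (symm q ts).card = 2 * ts.length := by
  rw [symm, List.toFinset_card_of_nodup h.nodup]; simp; omega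

lemma Greedy.symm_subset {E n : ℕ} {ts : List ℕ} (h : Greedy q E n ts) :
    symm q ts ⊆ range q := by
  intro a ha
  simp only [symm, List.toFinset_append, mem_union, List.mem_toFinset, List.mem_map] at ha
  have hq := NeZero.pos q
  rcases ha with ha | ⟨b, hb, rfl⟩
  · exact mem_range.2 (h.lt a ha)
  · simp only [mem_range]; omega

/-- At most `2 * n` of the `q` candidates are excluded as used, so the step loses at most a factor
`1 / (1 - 2 * n / q)` against the average. Evenness of `q` keeps `τ` apart from its own mirror
image. -/
lemma Greedy.cons {E n : ℕ} (hE : 1 ≤ E) {ts : List ℕ} (h : Greedy q E n ts) (hq : Even q)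
    (hn : ts.length < n) (hnq : 2 * n ≤ q) {τ : ℕ} (hτ : τ < q) (hτs : τ ∉ symm q ts)
    (hmin : ∀ a < q, a ∉ symm q ts →
      coef q (32 * E) ts (oddRes q τ) ≤ coef q (32 * E) ts (oddRes q a)) :
    Greedy q E n (τ :: ts) := by
  refine ⟨?_, ?_, ?_⟩
  · rintro a (_ | ⟨_, ha⟩)
    exacts [hτ, h.lt a ha]
  · simp only [symm, List.toFinset_append, mem_union, List.mem_toFinset, List.mem_map,
      not_or, not_exists, not_and] at hτs
    rw [List.map_cons, List.cons_append, List.nodup_cons, List.nodup_middle, List.nodup_cons]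
    obtain ⟨r, hr⟩ := hq
    refine ⟨?_, ?_, h.nodup⟩
    · simp only [List.mem_append, List.mem_cons, List.mem_map, not_or, not_exists, not_and]
      exact ⟨hτs.1, by omega, hτs.2⟩
    · simp only [List.mem_append, List.mem_map, not_or, not_exists, not_and]
      refine ⟨fun hm => hτs.2 _ hm (by omega), fun a ha haa => ?_⟩
      have := h.lt a ha
      have : a = τ := by omega
      exact hτs.1 (this ▸ ha)
  · have h1 := potential_cons_le (q := q) (Δ := 32 * E) (by omega) ts (range q \ symm q ts)
      sdiff_subset τ (fun a ha => by
        simp only [mem_sdiff, mem_range] at ha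
        exact hmin a ha.1 ha.2)
    rw [card_sdiff_of_subset h.symm_subset, h.card_symm, card_range] at h1
    have hqpos : (0 : ℝ) < q := by exact_mod_cast NeZero.pos q
    have h2 : ((q - 2 * ts.length : ℕ) : ℝ) = q - 2 * ts.length := by
      rw [Nat.cast_sub (by omega)]; push_cast; ring
    rw [h2] at h1
    have hp := potential_nonneg (q := q) (Δ := 32 * E) (by omega) (τ :: ts)
    have hnl : (ts.length : ℝ) ≤ n := by exact_mod_cast hn.le
    have h3 : (1 - 2 * n / q) * potential q (32 * E) (τ :: ts) ≤
        (32 * E : ℕ) * potential q (32 * E) ts := by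
      have : (q : ℝ) * ((1 - 2 * n / q) * potential q (32 * E) (τ :: ts)) =
          (q - 2 * n) * potential q (32 * E) (τ :: ts) := by field_simp
      refine le_of_mul_le_mul_left ?_ hqpos
      rw [this]
      refine le_trans ?_ h1
      gcongr
    have h4 : (0 : ℝ) ≤ 1 - 2 * n / q := by
      rw [sub_nonneg, div_le_one hqpos]; exact_mod_cast hnq
    calc potential q (32 * E) (τ :: ts) * (1 - 2 * n / q) ^ (τ :: ts).length
        = ((1 - 2 * n / q) * potential q (32 * E) (τ :: ts)) * (1 - 2 * n / q) ^ ts.length := by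
          rw [List.length_cons, pow_succ]; ring
      _ ≤ ((32 * E : ℕ) * potential q (32 * E) ts) * (1 - 2 * n / q) ^ ts.length := by gcongr
      _ = (32 * E : ℕ) * (potential q (32 * E) ts * (1 - 2 * n / q) ^ ts.length) := by ring
      _ ≤ (32 * E : ℕ) * ((2 * q : ℕ) * ((32 * E : ℕ) : ℝ) ^ ts.length) := by
          exact mul_le_mul_of_nonneg_left h.potential_le (by positivity)
      _ = _ := by rw [List.length_cons, pow_succ]; ring

lemma Greedy.exists_unused {E n : ℕ} {ts : List ℕ} (h : Greedy q E n ts)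
    (hn : ts.length < n) (hnq : 2 * n ≤ q) : ∃ a < q, a ∉ symm q ts := by
  by_contra! hc
  have : range q ⊆ symm q ts := fun a ha => hc a (mem_range.1 ha)
  have := card_le_card this
  rw [card_range, h.card_symm] at this
  omega

/-- From `2 * t = (2 * t + 1) - 1`: passing to odd residues costs a unimodular factor that does not
depend on `t`. -/
lemma exp_eq_stdAddChar (k : ℤ) (t : ℕ) :
    Complex.exp (2 * Real.pi * Complex.I * k * t / q) =
      ZMod.stdAddChar (-(k : ZMod (2 * q))) * ZMod.stdAddChar ((k : ZMod (2 * q)) * oddRes q t) := by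
  have hq : (q : ℂ) ≠ 0 := by exact_mod_cast NeZero.ne q
  rw [← AddChar.map_add_eq_mul]
  have : -(k : ZMod (2 * q)) + (k : ZMod (2 * q)) * oddRes q t =
      ((k * (2 * t) : ℤ) : ZMod (2 * q)) := by
    rw [oddRes]; push_cast; ring
  rw [this, ZMod.stdAddChar_coe]
  congr 1
  push_cast
  field_simp

/-- The set that the greedy choice produces has small Fourier coefficients modulo `q`. -/
lemma Greedy.norm_sum_le {E n : ℕ} (hE : 1 ≤ E) {ts : List ℕ} (h : Greedy q E n ts)
    (hn : ts.length = n) (hnq : 4 * n ^ 2 ≤ q)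
    (hlog : 128 * E ^ 2 * Real.log (4 * q) ≤ n) (k : ℤ) (hk : ¬ (q : ℤ) ∣ k) :
    ‖∑ t ∈ symm q ts, Complex.exp (2 * Real.pi * Complex.I * k * t / q)‖ ≤
      (symm q ts).card / (4 * E) := by
  have hqpos : (0 : ℝ) < q := by exact_mod_cast NeZero.pos q
  have hpot : potential q (32 * E) ts ≤ 4 * q * (32 * E : ℕ) ^ ts.length := by
    have h1 := h.potential_le
    rw [hn] at h1
    have hx : 2 * (n : ℝ) / q ≤ 1 := by
      rw [div_le_one hqpos]
      have : 2 * n ≤ q := by nlinarith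
      exact_mod_cast this
    -- Bernoulli's inequality: the accumulated loss is at most a factor `2`, because `2 * n^2 / q ≤
    -- 1/2`.
    have h2 : (1 / 2 : ℝ) ≤ (1 - 2 * n / q) ^ n := by
      have := one_add_mul_le_pow (a := -(2 * (n : ℝ) / q)) (by linarith) n
      rw [← sub_eq_add_neg] at this
      refine le_trans ?_ this
      have h5 : (n : ℝ) * (2 * n / q) ≤ 1 / 2 := by
        rw [← mul_div_assoc, div_le_iff₀ hqpos]
        have : (4 * n ^ 2 : ℝ) ≤ q := by exact_mod_cast hnq
        linarith
      linarith
    have hp := potential_nonneg (q := q) (Δ := 32 * E) (by omega) ts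
    rw [hn]
    push_cast at h1 ⊢
    nlinarith
  have hdvd : ∀ j : ℤ, ¬ (q : ℤ) ∣ j → (j : ZMod (2 * q)) ≠ 0 := by
    intro j hj h0
    rw [ZMod.intCast_zmod_eq_zero_iff_dvd] at h0
    exact hj (dvd_trans ⟨2, by push_cast; ring⟩ h0)
  have hk0 := hdvd k hk
  have hkq : (k : ZMod (2 * q)) ≠ q := by
    intro hc
    refine hdvd (k - q) (fun hd => hk ?_) (by push_cast; rw [hc, sub_self])
    simpa using hd
  have hlog' : 128 * (E : ℝ) ^ 2 * Real.log (4 * q) ≤ ts.length := by rw [hn]; exact hlog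
  have hup := abs_sum_cosChar_le hE ts _ hpot hlog' hk0 hkq
  have hk0' : (k : ZMod (2 * q)) + q ≠ 0 := by
    intro hc
    refine hdvd (k + q) (fun hd => hk ?_) (by push_cast; rw [hc])
    simpa using hd
  have hkq' : (k : ZMod (2 * q)) + q ≠ q := by simpa using hk0
  -- At the frequency `k + q` all cosines change sign, so the same one-sided estimate bounds the sum
  -- from below.
  have hlo := abs_sum_cosChar_le hE ts _ hpot hlog' hk0' hkq'
  simp only [cosChar_add_half] at hlo
  set S := (ts.map fun τ => cosChar q (k * oddRes q τ)).sum with hS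
  have hlo' : -S ≤ ts.length / (4 * E) := by
    refine le_trans (le_of_eq ?_) hlo
    rw [hS]
    clear_value S
    clear * -
    induction ts with
    | nil => simp
    | cons τ ts ih => simp only [List.map_cons, List.sum_cons, ← ih]; ring
  have hsum : ∑ t ∈ symm q ts, Complex.exp (2 * Real.pi * Complex.I * k * t / q) =
      ZMod.stdAddChar (-(k : ZMod (2 * q))) * ((2 * S : ℝ) : ℂ) := by
    simp only [exp_eq_stdAddChar]
    rw [← mul_sum, symm, List.sum_toFinset _ h.nodup, List.map_append, List.sum_append]
    congr 1
    have hlt := h.lt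
    rw [hS]
    clear * - hlt
    induction ts with
    | nil => simp
    | cons τ ts ih =>
      have ih := ih fun a ha => hlt a (List.mem_cons_of_mem _ ha)
      have h1 := stdAddChar_add_neg ((k : ZMod (2 * q)) * oddRes q τ)
      simp only [List.map_cons, List.sum_cons, oddRes_mirror (hlt τ List.mem_cons_self), mul_neg]
      push_cast at ih h1 ⊢
      linear_combination ih + h1
  rw [hsum, norm_mul, AddChar.norm_apply, one_mul, Complex.norm_real, Real.norm_eq_abs,
    h.card_symm, abs_mul, abs_two]
  have := abs_le.2 ⟨by linarith, hup⟩
  push_cast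
  rw [mul_div_assoc]
  gcongr

end

/-! ### Integer encodings of polynomials and sets -/

lemma sum_range_mul_pow_lt {X : ℕ} (c : ℕ → ℕ) (hc : ∀ i, c i < X) (t : ℕ) :
    ∑ i ∈ range t, c i * X ^ i < X ^ t := by
  induction t with
  | zero => simp
  | succ t ih =>
    rw [sum_range_succ, pow_succ]
    have := hc t
    nlinarith [Nat.zero_le (X ^ t)]

lemma sum_range_div_mod {X : ℕ} (c : ℕ → ℕ) (hc : ∀ i, c i < X) {M t : ℕ} (ht : t < M) :
    (∑ i ∈ range M, c i * X ^ i) / X ^ t % X = c t := by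
  obtain ⟨r, rfl⟩ := Nat.exists_eq_add_of_lt ht
  have h1 := sum_range_mul_pow_lt c hc t
  have : ∑ i ∈ range (t + r + 1), c i * X ^ i =
      (∑ i ∈ range t, c i * X ^ i) + X ^ t * (c t + X * ∑ i ∈ range r, c (t + 1 + i) * X ^ i) := by
    rw [show t + r + 1 = t + 1 + r by ring, sum_range_add, sum_range_succ, mul_add, mul_sum,
      mul_sum]
    have : ∀ i, c (t + 1 + i) * X ^ (t + 1 + i) = X ^ t * (X * (c (t + 1 + i) * X ^ i)) :=
      fun i => by rw [pow_add, pow_succ]; ring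
    simp only [this]
    ring
  rw [this, Nat.add_mul_div_left _ _ (by omega), Nat.div_eq_of_lt h1, zero_add,
    Nat.add_mul_mod_self_left, Nat.mod_eq_of_lt (hc t)]

lemma sum_two_pow_div_mod {A : Finset ℕ} {q t : ℕ} (hA : A ⊆ range q) (ht : t < q) :
    (∑ i ∈ A, 2 ^ i) / 2 ^ t % 2 = if t ∈ A then 1 else 0 := by
  have := sum_range_div_mod (X := 2) (fun i => if i ∈ A then 1 else 0)
    (fun i => by split_ifs <;> omega) ht
  rw [← this]
  congr 2
  simp only [ite_mul, one_mul, zero_mul, ← sum_filter]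
  congr 1
  ext i
  simp only [mem_filter]
  exact ⟨fun h => ⟨hA h, h⟩, fun h => h.2⟩

/-- The number with the digits `f 0, f 1, …` in base `X`. -/
def enc (q X : ℕ) (f : ZMod (2 * q) → ℕ) : ℕ := ∑ i ∈ range (2 * q), f i * X ^ i

lemma enc_div_mod {q X : ℕ} (f : ZMod (2 * q) → ℕ) (hf : ∀ y, f y < X) {τ : ℕ} (hτ : τ < q) :
    enc q X f / X ^ (2 * τ + 1) % X = f (oddRes q τ) :=
  sum_range_div_mod (fun i => f i) (fun _ => hf _) (by omega)

section
variable {q : ℕ} [NeZero q]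

lemma enc_eq (X : ℕ) (f : ZMod (2 * q) → ℕ) : enc q X f = ∑ y, f y * X ^ y.val := by
  refine sum_nbij' (fun i => (i : ZMod (2 * q))) (fun y => y.val) (by simp) ?_ ?_ (by simp) ?_
  · intro y _; exact mem_range.2 y.val_lt
  · intro i hi; exact ZMod.val_cast_of_lt (mem_range.1 hi)
  · intro i hi; rw [ZMod.val_cast_of_lt (mem_range.1 hi)]

lemma enc_nil (X Δ : ℕ) : enc q X (coef q Δ []) = 1 := by
  rw [enc_eq]; simp [coef]

/-- Raising every digit by one still leaves digits below `X`. This slack gives strict inequality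
against `X ^ (2 * q) - 1`, so that a remainder by this modulus is the encoding itself. -/
lemma enc_lt {X : ℕ} (f : ZMod (2 * q) → ℕ) (hf : ∀ y, f y + 2 ≤ X) :
    enc q X f < X ^ (2 * q) - 1 := by
  have h1 : enc q X f + ∑ i ∈ range (2 * q), 1 * X ^ i < X ^ (2 * q) := by
    rw [enc, ← sum_add_distrib]
    simp only [← add_mul]
    exact sum_range_mul_pow_lt (fun i => f i + 1) (fun i => hf _) _
  have h2 : 1 ≤ ∑ i ∈ range (2 * q), 1 * X ^ i := by
    have := single_le_sum (f := fun i => 1 * X ^ i) (fun i _ => Nat.zero_le _)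
      (mem_range.2 (show 0 < 2 * q by have := NeZero.pos q; omega))
    simpa using this
  omega

lemma pow_modEq {X M a b : ℕ} (hX : 1 ≤ X) (h : a ≡ b [MOD M]) :
    X ^ a ≡ X ^ b [MOD (X ^ M - 1)] := by
  have key : ∀ a, X ^ a ≡ X ^ (a % M) [MOD (X ^ M - 1)] := by
    intro a
    have h1 : X ^ M ≡ 1 [MOD (X ^ M - 1)] :=
      ((Nat.modEq_iff_dvd' (Nat.one_le_pow _ _ hX)).2 dvd_rfl).symm
    conv_lhs => rw [← Nat.div_add_mod a M, pow_add, pow_mul]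
    simpa using (h1.pow (a / M)).mul_right (X ^ (a % M))
  exact (key a).trans (h ▸ (key b).symm)

/-- Since `X ^ (2 * q) ≡ 1`, exponents matter only modulo `2 * q`, and a cyclic shift is
multiplication by a power of `X`. -/
lemma enc_shift {X : ℕ} (hX : 1 ≤ X) (f : ZMod (2 * q) → ℕ) (z : ZMod (2 * q)) (j : ℕ)
    (hj : (j : ZMod (2 * q)) = z) :
    enc q X (fun y => f (y - z)) ≡ enc q X f * X ^ j [MOD (X ^ (2 * q) - 1)] := by
  rw [enc_eq, enc_eq, ← Equiv.sum_comp (Equiv.addRight z), sum_mul]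
  refine Nat.ModEq.sum fun y _ => ?_
  simp only [Equiv.coe_addRight, add_sub_cancel_right, mul_assoc, ← pow_add]
  refine Nat.ModEq.mul_left _ (pow_modEq hX ?_)
  rw [← ZMod.natCast_eq_natCast_iff]
  simp [hj]

/-- Both sides agree modulo `X ^ (2 * q) - 1` by `enc_shift`, and `X` is large enough for the new
coefficients to stay digits. The exponent `2 * q - (2 * τ + 1)` represents `-oddRes q τ`. -/
lemma enc_coef_cons {X Δ : ℕ} {ts : List ℕ} (hX : (Δ + 2) ^ (ts.length + 1) + 2 ≤ X) {τ : ℕ}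
    (hτ : τ < q) : enc q X (coef q Δ (τ :: ts)) =
      enc q X (coef q Δ ts) * (Δ + X ^ (2 * τ + 1) + X ^ (2 * q - (2 * τ + 1))) %
        (X ^ (2 * q) - 1) := by
  have h1 : enc q X (coef q Δ (τ :: ts)) < X ^ (2 * q) - 1 :=
    enc_lt _ fun y => by
      have := coef_le Δ (τ :: ts) y
      rw [List.length_cons] at this
      omega
  rw [← Nat.mod_eq_of_lt h1]
  have h2 : enc q X (coef q Δ (τ :: ts)) = enc q X (coef q Δ ts) * Δ +
      enc q X (fun y => coef q Δ ts (y - oddRes q τ)) +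
      enc q X (fun y => coef q Δ ts (y - -oddRes q τ)) := by
    simp only [enc, coef, add_mul, sum_add_distrib, sum_mul, sub_neg_eq_add]
    congr 2
    exact sum_congr rfl fun i _ => by ring
  rw [h2, mul_add, mul_add]
  refine ((Nat.ModEq.refl _).add (enc_shift (by omega) _ _ _ rfl)).add
    (enc_shift (by omega) _ _ _ ?_)
  rw [eq_neg_iff_add_eq_zero, oddRes, ← Nat.cast_add,
    show 2 * q - (2 * τ + 1) + (2 * τ + 1) = 2 * q by omega, ZMod.natCast_self]

end

end SmallBias

/-! ### Real frequencies, and division by a prime modulo `m` -/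

namespace SmallBias
open Finset

/-- The complex number `exp (2 π i x)`. -/
noncomputable def e (x : ℝ) : ℂ := Complex.exp (2 * Real.pi * Complex.I * x)

lemma e_add (x y : ℝ) : e (x + y) = e x * e y := by
  rw [e, e, e, ← Complex.exp_add]; push_cast; ring_nf

lemma e_eq (x : ℝ) : e x = Complex.exp (Complex.I * (2 * Real.pi * x : ℝ)) := by
  rw [e]; push_cast; ring_nf

lemma norm_e (x : ℝ) : ‖e x‖ = 1 := by
  rw [e_eq, mul_comm]; exact Complex.norm_exp_ofReal_mul_I _

lemma e_intCast (a : ℤ) : e a = 1 := by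
  rw [e, Complex.exp_eq_one_iff]; exact ⟨a, by push_cast; ring⟩

lemma e_add_int (x : ℝ) (a : ℤ) : e (x + a) = e x := by rw [e_add, e_intCast, mul_one]

lemma e_nat_mul (n : ℕ) (x : ℝ) : e (n * x) = e x ^ n := by
  rw [e, e, ← Complex.exp_nat_mul]; push_cast; ring_nf

lemma norm_e_sub_one_le (x : ℝ) : ‖e x - 1‖ ≤ 2 * Real.pi * |x| := by
  rw [e_eq]
  refine Real.norm_exp_I_mul_ofReal_sub_one_le.trans (le_of_eq ?_)
  rw [Real.norm_eq_abs, abs_mul, abs_of_pos (by positivity)]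

lemma le_norm_e_sub_one {x : ℝ} (hx : |x| ≤ 1 / 2) : 4 * |x| ≤ ‖e x - 1‖ := by
  have h1 : ‖e x - 1‖ = 2 * |Real.sin (Real.pi * x)| := by
    rw [e_eq, Complex.norm_exp_I_mul_ofReal_sub_one, norm_mul, Real.norm_eq_abs, Real.norm_eq_abs,
      abs_two]
    congr 3; ring
  have h2 : |Real.sin (Real.pi * x)| = |Real.sin (Real.pi * |x|)| := by
    rcases abs_cases x with h | h <;> rw [h.1]
    rw [mul_neg, Real.sin_neg, abs_neg]
  have h3 := Real.mul_le_sin (x := Real.pi * |x|) (by positivity)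
    (by have := Real.pi_pos; nlinarith)
  have h4 : 2 / Real.pi * (Real.pi * |x|) = 2 * |x| := by
    have := Real.pi_ne_zero; field_simp
  rw [h1, h2]
  linarith [le_abs_self (Real.sin (Real.pi * |x|))]

/-- Translates by multiples of `q` of a set that is balanced modulo `q` are balanced at every
real frequency that is not close to an integer. -/
lemma norm_sum_translates_le {q E : ℕ} (hq : 1 ≤ q) (hE : 1 ≤ E) {T : Finset ℕ}
    (hTq : T ⊆ range q)
    (hT : ∀ k : ℤ, ¬ (q : ℤ) ∣ k →
      ‖∑ t ∈ T, Complex.exp (2 * Real.pi * Complex.I * k * t / q)‖ ≤ T.card / (4 * E))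
    {θ : ℝ} (hθ : ∀ b : ℤ, 1 / (2 * q) < |θ - b|) :
    ‖∑ i ∈ range (40 * E ^ 2), ∑ t ∈ T, e ((q * (i + 1) + t : ℕ) * θ)‖ ≤
      (40 * E ^ 2 : ℕ) * T.card / (2 * E) := by
  have hq0 : (0 : ℝ) < q := by exact_mod_cast hq
  have hE0 : (1 : ℝ) ≤ E := by exact_mod_cast hE
  set a := round (q * θ) with ha
  set β := q * θ - a with hβ
  have hβ2 : |β| ≤ 1 / 2 := abs_sub_round _
  have hθβ : θ = a / q + β / q := by rw [hβ]; field_simp; ring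
  have hprod : ∑ i ∈ range (40 * E ^ 2), ∑ t ∈ T, e ((q * (i + 1) + t : ℕ) * θ) =
      (∑ i ∈ range (40 * E ^ 2), e β ^ (i + 1)) * ∑ t ∈ T, e (t * θ) := by
    rw [sum_mul_sum]
    refine sum_congr rfl fun i _ => sum_congr rfl fun t _ => ?_
    -- As `q * θ = β + a` with `a` an integer, translation by `q * (i + 1)` contributes `e β ^ (i +
    -- 1)`.
    rw [← e_nat_mul, ← e_add, ← e_add_int (_ + _) ((i + 1) * a)]
    congr 1
    rw [hβ]; push_cast; ring
  rw [hprod, norm_mul]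
  -- Above this threshold the geometric sum is at most `20 * E`, which is `40 * E^2 / (2 * E)`.
  -- Below it, replacing `θ` by `a / q` costs at most `2 * π / (40 * E) < 1 / (4 * E)` per term of
  -- the sum over `T`.
  by_cases hb : 1 / (40 * E) ≤ |β|
  · have h1 : ‖∑ i ∈ range (40 * E ^ 2), e β ^ (i + 1)‖ ≤ 20 * E := by
      have h4 := le_norm_e_sub_one hβ2
      have h5 : 1 / (10 * (E : ℝ)) ≤ ‖e β - 1‖ := by
        refine le_trans (le_of_eq ?_) ((mul_le_mul_of_nonneg_left hb (by norm_num)).trans h4)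
        field_simp; norm_num
      have hne : e β ≠ 1 := by
        intro h
        rw [h, sub_self, norm_zero] at h5
        have : (0 : ℝ) < 1 / (10 * E) := by positivity
        linarith
      simp only [pow_succ, ← sum_mul]
      rw [geom_sum_eq hne, norm_mul, norm_div, norm_e, mul_one, div_le_iff₀ (by
        exact norm_pos_iff.2 (sub_ne_zero.2 hne))]
      calc ‖e β ^ (40 * E ^ 2) - 1‖ ≤ ‖e β ^ (40 * E ^ 2)‖ + ‖(1 : ℂ)‖ := norm_sub_le _ _
        _ = 20 * E * (1 / (10 * E)) := by
            rw [norm_pow, norm_e, one_pow, norm_one, mul_one_div, eq_div_iff (by positivity)]; ring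
        _ ≤ _ := by gcongr
    have h2 : ‖∑ t ∈ T, e (t * θ)‖ ≤ T.card := by
      refine (norm_sum_le _ _).trans (le_of_eq ?_)
      simp [norm_e]
    calc _ ≤ 20 * (E : ℝ) * T.card := by gcongr
      _ = _ := by push_cast; rw [eq_div_iff (by positivity)]; ring
  · rw [not_le] at hb
    have h1 : ‖∑ i ∈ range (40 * E ^ 2), e β ^ (i + 1)‖ ≤ (40 * E ^ 2 : ℕ) := by
      refine (norm_sum_le _ _).trans (le_of_eq ?_)
      simp [norm_e]
    -- Otherwise `a / q` would be an integer within `|β| / q ≤ 1 / (2 * q)` of `θ`.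
    have hdvd : ¬ (q : ℤ) ∣ a := by
      rintro ⟨b, hb'⟩
      have := hθ b
      rw [hθβ, hb'] at this
      push_cast at this
      rw [mul_div_cancel_left₀ _ hq0.ne', add_sub_cancel_left, abs_div, abs_of_pos hq0,
        div_lt_div_iff₀ (by positivity) hq0] at this
      nlinarith
    have h2 : ‖∑ t ∈ T, e (t * θ)‖ ≤ T.card / (2 * E) := by
      have h3 : ∑ t ∈ T, e (t * θ) =
          ∑ t ∈ T, Complex.exp (2 * Real.pi * Complex.I * a * t / q) +
            ∑ t ∈ T, Complex.exp (2 * Real.pi * Complex.I * a * t / q) * (e (t * β / q) - 1) := by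
        rw [← sum_add_distrib]
        refine sum_congr rfl fun t _ => ?_
        have : Complex.exp (2 * Real.pi * Complex.I * a * t / q) = e (t * a / q) := by
          rw [e]; push_cast; ring_nf
        rw [this, mul_sub, ← e_add, mul_one, add_sub_cancel, hθβ]
        congr 1; ring
      have h4 : ‖∑ t ∈ T, Complex.exp (2 * Real.pi * Complex.I * a * t / q) *
          (e (t * β / q) - 1)‖ ≤ T.card * (1 / (4 * E)) := by
        rw [← nsmul_eq_mul]
        refine norm_sum_le_of_le T (f := fun t => _) (n := fun _ => (1 / (4 * E) : ℝ))
          (fun t ht => ?_) |>.trans (by simp)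
        have h5 : ‖Complex.exp (2 * Real.pi * Complex.I * a * t / q)‖ = 1 := by
          rw [← norm_e (t * a / q), e]; push_cast; ring_nf
        rw [norm_mul, h5, one_mul]
        refine (norm_e_sub_one_le _).trans ?_
        have htq : (t : ℝ) ≤ q := by exact_mod_cast (mem_range.1 (hTq ht)).le
        have h6 : |t * β / q| ≤ |β| := by
          rw [abs_div, abs_mul, abs_of_pos hq0, div_le_iff₀ hq0, Nat.abs_cast, mul_comm]
          gcongr
        have h7 : |β| ≤ 1 / (40 * E) := hb.le
        calc 2 * Real.pi * |t * β / q| ≤ 2 * 3.15 * (1 / (40 * E)) := by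
              gcongr
              · exact Real.pi_lt_d2.le
              · exact h6.trans h7
          _ ≤ _ := by
            rw [mul_one_div, div_le_div_iff₀ (by positivity) (by positivity)]
            nlinarith
      rw [h3]
      refine (norm_add_le _ _).trans ((add_le_add (hT a hdvd) h4).trans (le_of_eq ?_))
      ring
    calc _ ≤ ((40 * E ^ 2 : ℕ) : ℝ) * (T.card / (2 * E)) := by gcongr
      _ = _ := by ring

/-- The number `z < m` with `p * z ≡ s` modulo `m`. -/
def quot (p m s : ℕ) : ℕ := (s + (-(s : ZMod p) * (m : ZMod p)⁻¹).val * m) / p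

section
variable {p m s : ℕ}

/-- As `m` is invertible modulo `p`, a search over `j < p` has exactly one hit; no modular inverse
has to be computed. -/
lemma quot_index_unique [Fact p.Prime] (hm : ¬ p ∣ m) {j : ℕ} (hj : j < p) :
    (s + j * m) % p = 0 ↔ j = (-(s : ZMod p) * (m : ZMod p)⁻¹).val := by
  have hm0 : (m : ZMod p) ≠ 0 := by rwa [Ne, ZMod.natCast_eq_zero_iff]
  rw [← Nat.dvd_iff_mod_eq_zero, ← ZMod.natCast_eq_zero_iff]
  constructor
  · intro h
    push_cast at h
    have : (j : ZMod p) = -(s : ZMod p) * (m : ZMod p)⁻¹ := by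
      rw [eq_mul_inv_iff_mul_eq₀ hm0]; linear_combination h
    rw [← this, ZMod.val_cast_of_lt hj]
  · intro h
    rw [h]; push_cast
    rw [ZMod.natCast_zmod_val, inv_mul_cancel_right₀ hm0]; ring

lemma mul_quot [Fact p.Prime] (hm : ¬ p ∣ m) :
    p * quot p m s = s + (-(s : ZMod p) * (m : ZMod p)⁻¹).val * m :=
  Nat.mul_div_cancel' (Nat.dvd_of_mod_eq_zero ((quot_index_unique hm (ZMod.val_lt _)).2 rfl))

lemma quot_lt [Fact p.Prime] (hm : ¬ p ∣ m) (hs : s < m) : quot p m s < m := by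
  have h1 := mul_quot (s := s) hm
  have h2 := ZMod.val_lt (-(s : ZMod p) * (m : ZMod p)⁻¹)
  set j := (-(s : ZMod p) * (m : ZMod p)⁻¹).val
  by_contra hc
  rw [not_lt] at hc
  have h3 : p * m ≤ p * quot p m s := Nat.mul_le_mul_left _ hc
  have h4 : (j + 1) * m ≤ p * m := Nat.mul_le_mul_right _ h2
  nlinarith

/-- Equal quotients give `p' * s ≡ p * s'` modulo `m`. Both sides are below `m`, so they are equal,
and `0 < s < p` forces `p ∣ p'`. -/
lemma quot_injective {p' s' B : ℕ} (hp : p.Prime) (hp' : p'.Prime) (hm : ¬ p ∣ m)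
    (hm' : ¬ p' ∣ m) (hs0 : 0 < s) (hs : s < p) (hs' : s' < p') (hsp' : s < p') (hpB : p ≤ B)
    (hpB' : p' ≤ B) (hB : B * s < m) (hB' : B * s' < m)
    (h : quot p m s = quot p' m s') : p = p' ∧ s = s' := by
  have := Fact.mk hp
  have := Fact.mk hp'
  have h1 := mul_quot (s := s) hm
  have h2 := mul_quot (s := s') hm'
  rw [← h] at h2
  have h3 : p' * s ≡ p * s' [MOD m] := by
    have e1 : s ≡ p * quot p m s [MOD m] := by
      rw [h1]; simp [Nat.ModEq]
    have e2 : s' ≡ p' * quot p m s [MOD m] := by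
      rw [h2]; simp [Nat.ModEq]
    calc p' * s ≡ p' * (p * quot p m s) [MOD m] := e1.mul_left _
      _ ≡ p * (p' * quot p m s) [MOD m] := by rw [mul_left_comm]
      _ ≡ p * s' [MOD m] := (e2.mul_left _).symm
  have h4 : p' * s = p * s' := by
    refine h3.eq_of_lt_of_lt ?_ ?_
    · exact (Nat.mul_le_mul_right _ hpB').trans_lt hB
    · exact (Nat.mul_le_mul_right _ hpB).trans_lt hB'
  have h5 : p ∣ p' * s := h4 ▸ dvd_mul_right _ _
  rcases (Nat.Prime.dvd_mul hp).1 h5 with h6 | h6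
  · have h7 := (Nat.prime_dvd_prime_iff_eq hp hp').1 h6
    subst h7
    exact ⟨rfl, Nat.eq_of_mul_eq_mul_left hp.pos h4⟩
  · exact absurd (Nat.le_of_dvd hs0 h6) (by omega)

/-- The quotient as a multiple of an inverse of `p`. -/
lemma exists_e_quot (hp : p.Prime) (hm : ¬ p ∣ m) (hm0 : 0 < m) (k : ℕ) :
    ∃ x w : ℤ, (p : ℤ) * x = k + w * m ∧
      ∀ s, e (k * quot p m s / m) = e (s * (x / m)) := by
  have := Fact.mk hp
  have hcop : IsCoprime (p : ℤ) (m : ℤ) :=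
    Nat.isCoprime_iff_coprime.2 ((Nat.Prime.coprime_iff_not_dvd hp).2 hm)
  obtain ⟨u, v, huv⟩ := hcop
  -- From `u * p + v * m = 1`, the number `k * u` represents `k / p` modulo `m`.
  refine ⟨k * u, -(k * v), by linear_combination (k : ℤ) * huv, fun s => ?_⟩
  have h1 : (p : ℤ) * quot p m s = s + (-(s : ZMod p) * (m : ZMod p)⁻¹).val * m := by
    exact_mod_cast mul_quot hm
  set j := (-(s : ZMod p) * (m : ZMod p)⁻¹).val
  have h2 : (quot p m s : ℤ) = s * u + (j * u + v * quot p m s) * m := by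
    linear_combination u * h1 - (quot p m s : ℤ) * huv
  have hmR : (m : ℝ) ≠ 0 := by exact_mod_cast hm0.ne'
  have h3 : (quot p m s : ℝ) = s * u + (j * u + v * quot p m s) * m := by exact_mod_cast h2
  rw [← e_add_int (s * (((k * u : ℤ) : ℝ) / m)) (k * (j * u + v * quot p m s))]
  congr 1
  push_cast
  conv_lhs => rw [h3]
  field_simp

end

end SmallBias

/-! ### Counting primes, and the exponential sum over all of them -/

namespace SmallBias
open Finset

/-- The product of the primes in `S` divides `N` and is at least `R ^ S.card`. -/
lemma card_mul_log_le {S : Finset ℕ} {R N : ℕ} (hR : 1 ≤ R) (hN : N ≠ 0)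
    (hS : ∀ p ∈ S, p.Prime ∧ R < p ∧ p ∣ N) : S.card * Real.log R ≤ Real.log N := by
  have h1 : ∏ p ∈ S, p ∣ N :=
    Finset.prod_primes_dvd N (fun p hp => (hS p hp).1.prime) fun p hp => (hS p hp).2.2
  have h2 : R ^ S.card ≤ N :=
    (Finset.pow_card_le_prod S id R fun p hp => (hS p hp).2.1.le).trans
      (Nat.le_of_dvd (Nat.pos_of_ne_zero hN) h1)
  rw [← Real.log_pow]
  exact Real.log_le_log (by positivity) (by exact_mod_cast h2)

lemma log_le_four_mul {s : ℝ} (hs : 0 < s) : Real.log (s ^ 4) ≤ 4 * s := by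
  rw [Real.log_pow]
  have := Real.log_le_sub_one_of_pos hs
  push_cast; linarith

/-- The primes between `R` and `8 * R`. -/
def primesAbove (R : ℕ) : Finset ℕ := (Ioc R (8 * R)).filter Nat.Prime

lemma sum_log_primesAbove (R : ℕ) : ∑ p ∈ primesAbove R, Real.log p =
    Chebyshev.theta (8 * R : ℕ) - Chebyshev.theta R := by
  rw [Chebyshev.theta_eq_sum_Icc, Chebyshev.theta_eq_sum_Icc, Nat.floor_natCast, Nat.floor_natCast,
    eq_sub_iff_add_eq, ← sum_union]
  · congr 1
    ext p
    simp only [primesAbove, mem_union, mem_filter, mem_Ioc, mem_Icc]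
    constructor
    · rintro (⟨h, hp⟩ | ⟨h, hp⟩) <;> exact ⟨by omega, hp⟩
    · rintro ⟨h, hp⟩
      by_cases hpR : p ≤ R
      exacts [Or.inr ⟨by omega, hp⟩, Or.inl ⟨by omega, hp⟩]
  · rw [Finset.disjoint_left]
    intro p
    simp only [primesAbove, mem_filter, mem_Ioc, mem_Icc]
    omega

/-- Chebyshev's constants are `log 2` from below and `log 4` from above, so the main term is `(8 -
2) * R * log 2`; the ratio `8` leaves ample room for the error terms. -/
lemma le_sum_log_primesAbove {R : ℕ} (hR : 2 ^ 20 ≤ R) :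
    (R : ℝ) ≤ ∑ p ∈ primesAbove R, Real.log p := by
  rw [sum_log_primesAbove]
  have hR' : (1048576 : ℝ) ≤ R := by exact_mod_cast (by omega : 1048576 ≤ R)
  have h1 := Chebyshev.theta_ge (8 * R)
  have h2 := Chebyshev.theta_le_log4_mul_x (x := R) (by positivity)
  have h4 : Real.log 4 = 2 * Real.log 2 := by
    rw [show (4 : ℝ) = 2 ^ 2 by norm_num, Real.log_pow]; norm_num
  have hl2 := Real.log_two_gt_d9
  -- With `s^4 = 8 * R` and `log (s^4) ≤ 4 * s`, the error terms are of order `s^3`, and `s ≥ 32`.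
  set s := √√(8 * (R : ℝ)) with hs
  have hs2 : s ^ 2 = √(8 * (R : ℝ)) := Real.sq_sqrt (Real.sqrt_nonneg _)
  have hs4 : s ^ 4 = 8 * R := by
    rw [show s ^ 4 = (s ^ 2) ^ 2 by ring, hs2, Real.sq_sqrt (by positivity)]
  have hs32 : 32 ≤ s := by
    refine Real.le_sqrt_of_sq_le (Real.le_sqrt_of_sq_le ?_)
    norm_num; linarith
  have h5 : Real.log (8 * R) ≤ 4 * s := by rw [← hs4]; exact log_le_four_mul (by linarith)
  have h6 : Real.log (8 * R + 1) ≤ 4 * s + 1 := by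
    have : Real.log (8 * R + 1) ≤ Real.log (2 * (8 * R)) :=
      Real.log_le_log (by positivity) (by linarith)
    rw [Real.log_mul (by norm_num) (by positivity)] at this
    have := Real.log_two_lt_d9
    linarith
  push_cast at h1
  rw [← hs2] at h1
  have h7 : s ^ 2 * Real.log (8 * R) ≤ s ^ 2 * (4 * s) := by gcongr
  have h8 : 0.69 * R ≤ R * Real.log 2 := by nlinarith
  rw [h4] at h2
  push_cast
  have h9 : 32 * s ^ 3 ≤ 8 * R := by rw [← hs4]; nlinarith [pow_pos (show 0 < s by linarith) 3]
  have h10 : 1024 * s ≤ s ^ 3 := by nlinarith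
  nlinarith

lemma card_primesAbove_mul_log_le (R : ℕ) :
    (primesAbove R).card * Real.log R ≤ Real.log 4 * (8 * R) := by
  have h1 : (primesAbove R).card * Real.log R ≤ ∑ p ∈ primesAbove R, Real.log p := by
    rw [← nsmul_eq_mul]
    refine card_nsmul_le_sum _ _ _ fun p hp => ?_
    simp only [primesAbove, mem_filter, mem_Ioc] at hp
    rcases Nat.eq_zero_or_pos R with rfl | h
    · simpa using Real.log_natCast_nonneg p
    · exact Real.log_le_log (by exact_mod_cast h) (by exact_mod_cast hp.1.1.le)
  rw [sum_log_primesAbove] at h1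
  have h2 := Chebyshev.theta_le_log4_mul_x (x := (8 * R : ℕ)) (by positivity)
  have := Chebyshev.theta_nonneg (R : ℝ)
  push_cast at h2 h1
  linarith

/-- The primes between `R` and `8 * R` that do not divide `m`. -/
def goodPrimes (R m : ℕ) : Finset ℕ := (primesAbove R).filter fun p => ¬ p ∣ m

lemma mem_goodPrimes {R m p : ℕ} :
    p ∈ goodPrimes R m ↔ ((R < p ∧ p ≤ 8 * R) ∧ p.Prime) ∧ ¬ p ∣ m := by
  simp [goodPrimes, primesAbove]

/-- Each prime of the interval contributes at most `log (8 * R) ≤ 2 * log R` to the Chebyshev sum,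
and at most `log m / log R` of them divide `m`. -/
lemma le_card_goodPrimes {R m : ℕ} (hR : 2 ^ 20 ≤ R) (hm : m ≠ 0) :
    (R : ℝ) - 2 * Real.log m ≤ (goodPrimes R m).card * (2 * Real.log R) := by
  have hR' : (1048576 : ℝ) ≤ R := by exact_mod_cast (by omega : 1048576 ≤ R)
  have h0 : Real.log (8 * R) ≤ 2 * Real.log R := by
    rw [two_mul, Real.log_mul (by norm_num) (by positivity)]
    have := Real.log_le_log (x := 8) (y := R) (by norm_num) (by linarith)
    linarith
  have h1 : (R : ℝ) ≤ (primesAbove R).card * (2 * Real.log R) := by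
    refine (le_sum_log_primesAbove hR).trans ?_
    rw [← nsmul_eq_mul]
    refine sum_le_card_nsmul _ _ _ fun p hp => le_trans ?_ h0
    simp only [primesAbove, mem_filter, mem_Ioc] at hp
    exact Real.log_le_log (by exact_mod_cast hp.2.pos) (by exact_mod_cast hp.1.2)
  have h2 := card_mul_log_le (S := (primesAbove R).filter fun p => p ∣ m) (R := R) (N := m)
    (by omega) hm (fun p hp => by
      simp only [primesAbove, mem_filter, mem_Ioc] at hp
      exact ⟨hp.1.2, hp.1.1.1, hp.2⟩)
  have h3 := card_filter_add_card_filter_not (s := primesAbove R) (fun p => p ∣ m)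
  have h4 : ((primesAbove R).card : ℝ) =
    ((primesAbove R).filter fun p => p ∣ m).card + (goodPrimes R m).card := by
    rw [← h3]; push_cast; rfl
  rw [h4] at h1
  linarith

/-- Union bound over `i`: since `0 < k < m`, no `k + i * m` vanishes, so each has at most `log ((J +
1) * m) / log R` prime factors above `R`. -/
lemma card_bad_mul_log_le {R m k J : ℕ} (hR : 1 ≤ R) (hk : 0 < k) (hkm : k < m)
    (S : Finset ℕ) (hS : ∀ p ∈ S, p.Prime ∧ R < p ∧ ∃ i : ℤ, |i| ≤ J ∧ (p : ℤ) ∣ k + i * m) :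
    S.card * Real.log R ≤ (2 * J + 1) * Real.log ((J + 1) * m) := by
  have hsub : S ⊆ (Icc (-J : ℤ) J).biUnion fun i =>
      S.filter fun p => p ∣ (k + i * m : ℤ).natAbs := by
    intro p hp
    obtain ⟨-, -, i, hi, hd⟩ := hS p hp
    refine mem_biUnion.2 ⟨i, mem_Icc.2 (abs_le.1 hi), mem_filter.2 ⟨hp, ?_⟩⟩
    exact Int.natCast_dvd.1 hd
  have hlogR : 0 ≤ Real.log R := Real.log_natCast_nonneg R
  have h1 : (S.card : ℝ) ≤
      ∑ i ∈ Icc (-J : ℤ) J, ((S.filter fun p => p ∣ (k + i * m : ℤ).natAbs).card : ℝ) := by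
    exact_mod_cast (card_le_card hsub).trans card_biUnion_le
  calc S.card * Real.log R ≤ (∑ i ∈ Icc (-J : ℤ) J,
        ((S.filter fun p => p ∣ (k + i * m : ℤ).natAbs).card : ℝ)) * Real.log R := by gcongr
    _ ≤ ∑ i ∈ Icc (-J : ℤ) J, Real.log ((J + 1) * m) := by
      rw [sum_mul]
      refine sum_le_sum fun i hi => ?_
      have hi' := mem_Icc.1 hi
      have hne : (k + i * m : ℤ) ≠ 0 := by
        intro h0
        have hd : (m : ℤ) ∣ k := ⟨-i, by linear_combination h0⟩
        have := Nat.le_of_dvd hk (Int.natCast_dvd_natCast.1 hd)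
        omega
      refine (card_mul_log_le hR (Int.natAbs_ne_zero.2 hne) fun p hp => ?_).trans ?_
      · simp only [mem_filter] at hp
        exact ⟨(hS p hp.1).1, (hS p hp.1).2.1, hp.2⟩
      · refine Real.log_le_log (by exact_mod_cast Int.natAbs_pos.2 hne) ?_
        have h2 : |(k + i * m : ℤ)| ≤ (J + 1) * m := by
          refine (abs_add_le _ _).trans ?_
          rw [abs_mul, Nat.abs_cast, Nat.abs_cast]
          have := abs_le.2 hi'
          have hkm' : (k : ℤ) ≤ m := by exact_mod_cast hkm.le
          nlinarith [Int.natCast_nonneg m]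
        rw [Nat.cast_natAbs]
        exact_mod_cast h2
    _ = _ := by
      rw [sum_const, Int.card_Icc, nsmul_eq_mul]
      congr 1
      rw [show ((J : ℤ) + 1 - -J) = ((2 * J + 1 : ℕ) : ℤ) by push_cast; ring, Int.toNat_natCast]
      push_cast; ring

section
variable {q E R m L : ℕ}

/-- The exponential sum of the residues `quot p m s` for a single prime `p`. -/
lemma norm_sum_quot_le (hq : 1 ≤ q) (hE : 1 ≤ E) {T : Finset ℕ} (hTq : T ⊆ range q)
    (hT : ∀ k : ℤ, ¬ (q : ℤ) ∣ k →
      ‖∑ t ∈ T, Complex.exp (2 * Real.pi * Complex.I * k * t / q)‖ ≤ T.card / (4 * E))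
    (hR : R = (40 * E ^ 2 + 1) * q) {p k : ℕ} (hp : p ∈ goodPrimes R m) (hkm : k < m)
    (hbad : ¬ ∃ i : ℤ, |i| ≤ (160 * E ^ 2 + 5 : ℕ) ∧ (p : ℤ) ∣ k + i * m) :
    ‖∑ i ∈ range (40 * E ^ 2), ∑ t ∈ T, e (k * quot p m (q * (i + 1) + t) / m)‖ ≤
      (40 * E ^ 2 : ℕ) * T.card / (2 * E) := by
  rw [mem_goodPrimes] at hp
  obtain ⟨⟨⟨hRp, hp8⟩, hpp⟩, hpm⟩ := hp
  have hm0 : 0 < m := by omega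
  obtain ⟨x, w, hxw, hx⟩ := exists_e_quot hpp hpm hm0 k
  simp only [hx]
  refine norm_sum_translates_le hq hE hTq hT fun b => ?_
  by_contra hc
  rw [not_lt] at hc
  apply hbad
  have hqR : (0 : ℝ) < q := by exact_mod_cast hq
  have hmR : (0 : ℝ) < m := by exact_mod_cast hm0
  have hpR : (0 : ℝ) < p := by exact_mod_cast hpp.pos
  -- If `x / m` is within `1 / (2 * q)` of `b`, then `p * (x - b * m) = k + (w - p * b) * m` has
  -- absolute value at most `8 * R * m / (2 * q) = (160 * E^2 + 4) * m`; the term `k < m` accounts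
  -- for the bound `160 * E^2 + 5`.
  refine ⟨w - p * b, ?_, x - b * m, by linear_combination -hxw⟩
  have h1 : |(p : ℝ) * (x - b * m)| ≤ 4 * (40 * E ^ 2 + 1) * m := by
    have h2 : (p : ℝ) * (x - b * m) = p * m * (x / m - b) := by field_simp
    rw [h2, abs_mul, abs_of_pos (by positivity)]
    calc (p : ℝ) * m * |(x : ℝ) / m - b| ≤ ((8 * R : ℕ) : ℝ) * m * (1 / (2 * q)) := by gcongr
      _ = _ := by rw [hR]; push_cast; field_simp; ring
  have h3 : ((w - p * b : ℤ) : ℝ) * m = p * (x - b * m) - k := by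
    have : (p : ℝ) * x = k + w * m := by exact_mod_cast hxw
    push_cast; linear_combination -this
  have h4 : |((w - p * b : ℤ) : ℝ)| * m ≤ (160 * E ^ 2 + 5 : ℕ) * m := by
    rw [← abs_of_pos hmR, ← abs_mul, abs_of_pos hmR, h3]
    refine (abs_sub _ _).trans ?_
    have hk : (k : ℝ) ≤ m := by exact_mod_cast hkm.le
    rw [Nat.abs_cast]
    push_cast
    linarith
  have h5 := le_of_mul_le_mul_right h4 hmR
  exact_mod_cast h5

/-- The exponential sum of all residues `quot p m s`. -/
lemma norm_sum_goodPrimes_le (hq : 1 ≤ q) (hE : 1 ≤ E) {T : Finset ℕ} (hTq : T ⊆ range q)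
    (hT : ∀ k : ℤ, ¬ (q : ℤ) ∣ k →
      ‖∑ t ∈ T, Complex.exp (2 * Real.pi * Complex.I * k * t / q)‖ ≤ T.card / (4 * E))
    (hR : R = (40 * E ^ 2 + 1) * q) (hR20 : 2 ^ 20 ≤ R) (hm : m < 2 ^ L) (hL : 1 ≤ L)
    (hRL : 2 ^ 20 * E ^ 5 * L ≤ R) {k : ℕ} (hk : 0 < k) (hkm : k < m) :
    ‖∑ p ∈ goodPrimes R m, ∑ i ∈ range (40 * E ^ 2), ∑ t ∈ T,
        e (k * quot p m (q * (i + 1) + t) / m)‖ ≤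
      (goodPrimes R m).card * ((40 * E ^ 2 : ℕ) * T.card) / E := by
  classical
  have hE0 : (1 : ℝ) ≤ E := by exact_mod_cast hE
  have hL0 : (1 : ℝ) ≤ L := by exact_mod_cast hL
  set J := 160 * E ^ 2 + 5 with hJ
  set P := goodPrimes R m with hP
  set W : ℝ := (40 * E ^ 2 : ℕ) * T.card with hW
  have hW0 : 0 ≤ W := by positivity
  set B := P.filter fun p : ℕ => ∃ i : ℤ, |i| ≤ J ∧ (p : ℤ) ∣ k + i * m with hB
  have hR' : (1048576 : ℝ) ≤ R := by exact_mod_cast (by omega : 1048576 ≤ R)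
  have hlogR : 0 < Real.log R := Real.log_pos (by linarith)
  have hBcard : (B.card : ℝ) ≤ P.card / (2 * E) := by
    have h1 := card_bad_mul_log_le (R := R) (J := J) (by omega) hk hkm B fun p hp => by
      simp only [hB, mem_filter, hP, mem_goodPrimes] at hp
      exact ⟨hp.1.1.2, hp.1.1.1.1, hp.2⟩
    have h2 := le_card_goodPrimes (m := m) hR20 (by omega)
    have hlogm : Real.log m ≤ L := by
      have h3 : Real.log m ≤ Real.log (2 ^ L) :=
        Real.log_le_log (by exact_mod_cast (by omega : 0 < m)) (by exact_mod_cast hm.le)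
      rw [Real.log_pow] at h3
      have := Real.log_two_lt_d9
      nlinarith
    have hlogJ : Real.log ((J + 1) * m) ≤ J + L := by
      have hm0 : (m : ℝ) ≠ 0 := by exact_mod_cast (by omega : m ≠ 0)
      rw [Real.log_mul (by positivity) hm0]
      have := Real.log_le_sub_one_of_pos (show (0 : ℝ) < J + 1 by positivity)
      linarith
    have hJE : (J : ℝ) ≤ 165 * E ^ 2 := by
      rw [hJ]; push_cast; nlinarith
    have hRL' : (2 ^ 20 * E ^ 5 * L : ℝ) ≤ R := by exact_mod_cast hRL
    have hE2 : (1 : ℝ) ≤ E ^ 2 := one_le_pow₀ hE0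
    -- The factor `E^5` in the lower bound for `R` comes from here: `J` is of order `E^2`, it enters
    -- twice, and the proportion `1 / (2 * E)` adds one more power.
    have key : 4 * E * ((2 * J + 1) * (J + L : ℝ)) ≤ R - 2 * L := by
      have a1 : (2 * J + 1 : ℝ) ≤ 331 * E ^ 2 := by linarith
      have a2 : (J + L : ℝ) ≤ 166 * E ^ 2 * L := by nlinarith
      have a3 : (2 * J + 1) * (J + L : ℝ) ≤ 331 * E ^ 2 * (166 * E ^ 2 * L) := by gcongr
      have a4 : (L : ℝ) ≤ E ^ 5 * L := le_mul_of_one_le_left (by linarith) (one_le_pow₀ hE0)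
      have a5 : 4 * E * ((2 * J + 1) * (J + L : ℝ)) ≤
          4 * E * (331 * E ^ 2 * (166 * E ^ 2 * L)) := by gcongr
      have a6 : 4 * E * (331 * E ^ 2 * (166 * E ^ 2 * L)) = 219784 * (E ^ 5 * L : ℝ) := by ring
      nlinarith
    rw [le_div_iff₀ (by positivity)]
    have h4 : (B.card : ℝ) * Real.log R ≤ (2 * J + 1) * (J + L) :=
      h1.trans (by gcongr)
    have h5 : (B.card * (2 * E)) * (2 * Real.log R) ≤ P.card * (2 * Real.log R) := by
      calc (B.card * (2 * E)) * (2 * Real.log R) = 4 * E * (B.card * Real.log R) := by ring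
        _ ≤ 4 * E * ((2 * J + 1) * (J + L)) := by gcongr
        _ ≤ R - 2 * L := key
        _ ≤ R - 2 * Real.log m := by linarith
        _ ≤ _ := h2
    exact le_of_mul_le_mul_right h5 (by positivity)
  have hnorm : ∀ p ∈ P, ‖∑ i ∈ range (40 * E ^ 2), ∑ t ∈ T,
      e (k * quot p m (q * (i + 1) + t) / m)‖ ≤ W / (2 * E) + if p ∈ B then W else 0 := by
    intro p hp
    split_ifs with hpB
    · have : ‖∑ i ∈ range (40 * E ^ 2), ∑ t ∈ T, e (k * quot p m (q * (i + 1) + t) / m)‖ ≤ W := by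
        refine (norm_sum_le_of_le _ fun i _ => norm_sum_le _ _).trans (le_of_eq ?_)
        simp [norm_e, hW]
      have : 0 ≤ W / (2 * E) := by positivity
      linarith
    · rw [add_zero]
      refine norm_sum_quot_le hq hE hTq hT hR hp hkm fun h => hpB ?_
      exact mem_filter.2 ⟨hp, h⟩
  refine (norm_sum_le_of_le _ hnorm).trans ?_
  rw [sum_add_distrib, sum_const, nsmul_eq_mul, ← sum_filter, sum_const, nsmul_eq_mul]
  have hBf : P.filter (fun p => p ∈ B) = B := by
    ext p; simp only [mem_filter]; exact ⟨fun h => h.2, fun h => ⟨(mem_filter.1 h).1, h⟩⟩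
  rw [hBf]
  calc P.card * (W / (2 * E)) + B.card * W ≤ P.card * (W / (2 * E)) + P.card / (2 * E) * W := by
        gcongr
    _ = _ := by ring

end

end SmallBias

/-! ### The output list: discrepancy, distinctness and length -/

namespace SmallBias
open Finset

lemma disc_le {Z : Finset ℕ} {m : ℕ} (hm : 2 ≤ m) (hZ : Z.Nonempty) {δ : ℝ}
    (h : ∀ k, 0 < k → k < m → ‖∑ z ∈ Z, e (k * z / m)‖ ≤ δ * Z.card) :
    disc (Z.val.map fun z : ℕ => (z : ℤ)) m ≤ δ := by
  have : Nonempty (Finset.Ico 1 m) := ⟨⟨1, by simp; omega⟩⟩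
  refine ciSup_le fun ⟨k, hk⟩ => ?_
  rw [Finset.mem_Ico] at hk
  have hc : (0 : ℝ) < Z.card := by exact_mod_cast hZ.card_pos
  rw [Multiset.card_map, Finset.card_val, Multiset.map_map, norm_mul, norm_div, norm_one,
    Complex.norm_natCast, one_div, inv_mul_le_iff₀ hc,
    mul_comm _ δ]
  refine le_trans (le_of_eq ?_) (h k (by omega) hk.2)
  congr 1
  refine Finset.sum_congr rfl fun z _ => ?_
  rw [Function.comp_apply, ← Complex.exp_int_mul, e]
  congr 1
  push_cast; ring

lemma disc_range_le {m : ℕ} (hm : 2 ≤ m) {δ : ℝ} (hδ : 0 ≤ δ) :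
    disc ((range m).val.map fun z : ℕ => (z : ℤ)) m ≤ δ := by
  refine disc_le hm ⟨0, by simp; omega⟩ fun k hk hkm => ?_
  have hm0 : (m : ℝ) ≠ 0 := by exact_mod_cast (by omega : m ≠ 0)
  have h1 : ∀ z : ℕ, e (k * z / m) = e (k / m) ^ z := fun z => by
    rw [← e_nat_mul]; congr 1; ring
  have h2 : e (k / m) ^ m = 1 := by
    rw [← e_nat_mul, mul_div_cancel₀ _ hm0]; exact_mod_cast e_intCast k
  have h3 : e (k / m) ≠ 1 := by
    intro h
    rw [e, Complex.exp_eq_one_iff] at h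
    obtain ⟨n, hn⟩ := h
    have hpi := Complex.two_pi_I_ne_zero
    rw [mul_comm] at hn
    have h4 := mul_right_cancel₀ hpi hn
    have h5 : (k : ℝ) / m = n := by exact_mod_cast h4
    rw [div_eq_iff hm0] at h5
    have h6 : (k : ℤ) = n * m := by exact_mod_cast h5
    have := Nat.le_of_dvd hk (Int.natCast_dvd_natCast.1 ⟨n, by rw [mul_comm, ← h6]⟩)
    omega
  simp only [h1]
  rw [geom_sum_eq h3, h2]
  simp; positivity

/-- The output of the main loops. -/
def outList (R m q I : ℕ) (T : Finset ℕ) : List ℕ :=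
  (List.range (7 * R)).flatMap fun a => if (R + 1 + a).Prime then
    (List.range I).flatMap fun i => (List.range q).flatMap fun t => if t ∈ T then
      (List.range (R + 1 + a)).flatMap fun j =>
        if (q * (i + 1) + t + j * m) % (R + 1 + a) = 0 then
          [(q * (i + 1) + t + j * m) / (R + 1 + a)] else []
      else [] else []

lemma sum_map_flatMap_range {α : Type*} [AddCommMonoid α] (g : ℕ → α) (f : ℕ → List ℕ) (n : ℕ) :
    (((List.range n).flatMap f).map g).sum = ∑ i ∈ range n, ((f i).map g).sum := by
  induction n with
  | zero => simp
  | succ n ih => simp [List.range_succ, sum_range_succ, ih]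

/-- If `p ∣ m`, a hit would force `p ∣ s`, which `0 < s < p` excludes. Primes that divide `m` thus
produce no output and need no separate test. -/
lemma sum_map_quot {α : Type*} [AddCommMonoid α] (g : ℕ → α) {p m s : ℕ} (hp : p.Prime)
    (hs0 : 0 < s) (hs : s < p) :
    (((List.range p).flatMap fun j =>
      if (s + j * m) % p = 0 then [(s + j * m) / p] else []).map g).sum =
      if p ∣ m then 0 else g (quot p m s) := by
  have := Fact.mk hp
  rw [sum_map_flatMap_range]
  split_ifs with hm
  · refine sum_eq_zero fun j _ => ?_
    rw [if_neg]
    · simp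
    · intro h
      have h1 : p ∣ s := (Nat.dvd_add_left (hm.mul_left j)).1 (Nat.dvd_of_mod_eq_zero h)
      exact absurd (Nat.le_of_dvd hs0 h1) (by omega)
  · rw [sum_eq_single_of_mem _ (mem_range.2 (ZMod.val_lt (-(s : ZMod p) * (m : ZMod p)⁻¹)))]
    · rw [if_pos ((quot_index_unique hm (ZMod.val_lt _)).2 rfl)]
      simp [quot]
    · intro j hj hne
      rw [if_neg (fun h => hne ((quot_index_unique hm (mem_range.1 hj)).1 h))]
      simp

section
variable {R m q I : ℕ} {T : Finset ℕ}

lemma shift_lt (hR : R = (I + 1) * q) {i t : ℕ} (hi : i < I) (ht : t < q) :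
    q * (i + 1) + t < R := by
  rw [hR]
  have : (i + 1) * q ≤ I * q := Nat.mul_le_mul_right _ hi
  nlinarith

/-- Stated for an arbitrary additive statistic: the length, the multiplicity of an entry and the
exponential sum are all instances. -/
lemma sum_map_outList {α : Type*} [AddCommMonoid α] (g : ℕ → α) (hR : R = (I + 1) * q)
    (hT : T ⊆ range q) :
    ((outList R m q I T).map g).sum = ∑ p ∈ goodPrimes R m, ∑ i ∈ range I, ∑ t ∈ T,
      g (quot p m (q * (i + 1) + t)) := by
  have h1 : ∀ p, p.Prime → R < p → (((List.range I).flatMap fun i => (List.range q).flatMap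
      fun t => if t ∈ T then (List.range p).flatMap fun j =>
        if (q * (i + 1) + t + j * m) % p = 0 then [(q * (i + 1) + t + j * m) / p] else []
      else []).map g).sum = if p ∣ m then 0 else ∑ i ∈ range I, ∑ t ∈ T,
        g (quot p m (q * (i + 1) + t)) := by
    intro p hp hRp
    rw [sum_map_flatMap_range]
    have : ∀ i ∈ range I, (((List.range q).flatMap
      fun t => if t ∈ T then (List.range p).flatMap fun j =>
        if (q * (i + 1) + t + j * m) % p = 0 then [(q * (i + 1) + t + j * m) / p] else []
      else []).map g).sum = if p ∣ m then 0 else ∑ t ∈ T, g (quot p m (q * (i + 1) + t)) := by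
      intro i hi
      rw [sum_map_flatMap_range]
      have h2 : ∀ t ∈ range q, ((if t ∈ T then (List.range p).flatMap fun j =>
        if (q * (i + 1) + t + j * m) % p = 0 then [(q * (i + 1) + t + j * m) / p] else []
        else []).map g).sum =
          if t ∈ T then if p ∣ m then 0 else g (quot p m (q * (i + 1) + t)) else 0 := by
        intro t ht
        split_ifs with htT
        all_goals try simp only [List.map_nil, List.sum_nil]
        all_goals
          rw [sum_map_quot g hp (by
              have := mem_range.1 ht
              have hq : 0 < q := by omega
              positivity)
            ((shift_lt hR (mem_range.1 hi) (mem_range.1 ht)).trans hRp)]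
          simp [*]
      rw [sum_congr rfl h2, ← sum_filter, filter_mem_eq_inter, inter_eq_right.2 hT]
      split_ifs <;> simp
    rw [sum_congr rfl this]
    split_ifs <;> simp
  rw [outList, sum_map_flatMap_range]
  have h3 : ∀ a ∈ range (7 * R), ((if (R + 1 + a).Prime then
    (List.range I).flatMap fun i => (List.range q).flatMap fun t => if t ∈ T then
      (List.range (R + 1 + a)).flatMap fun j =>
        if (q * (i + 1) + t + j * m) % (R + 1 + a) = 0 then
          [(q * (i + 1) + t + j * m) / (R + 1 + a)] else []
      else [] else []).map g).sum = if (R + 1 + a).Prime ∧ ¬ (R + 1 + a) ∣ m then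
        ∑ i ∈ range I, ∑ t ∈ T, g (quot (R + 1 + a) m (q * (i + 1) + t)) else 0 := by
    intro a _
    by_cases hp : (R + 1 + a).Prime
    · rw [if_pos hp, h1 _ hp (by omega)]
      by_cases hm : (R + 1 + a) ∣ m <;> simp [hm, hp]
    · simp [hp]
  rw [sum_congr rfl h3, ← sum_filter]
  refine sum_nbij' (fun a => R + 1 + a) (fun p => p - (R + 1)) ?_ ?_ ?_ ?_ (fun _ _ => rfl)
  · intro a ha
    simp only [mem_filter, mem_range] at ha
    rw [mem_goodPrimes]
    exact ⟨⟨by omega, ha.2.1⟩, ha.2.2⟩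
  · intro p hp
    rw [mem_goodPrimes] at hp
    have : R + 1 + (p - (R + 1)) = p := by omega
    simp only [mem_filter, mem_range, this]
    exact ⟨by omega, hp.1.2, hp.2⟩
  · intro a _; simp
  · intro p hp
    rw [mem_goodPrimes] at hp
    omega

lemma count_eq_sum_map (l : List ℕ) (z : ℕ) :
    l.count z = (l.map fun y => if y = z then 1 else 0).sum := by
  induction l with
  | nil => simp
  | cons y l ih => simp [List.count_cons, ih]; ring

lemma length_outList (hR : R = (I + 1) * q) (hT : T ⊆ range q) :
    (outList R m q I T).length = (goodPrimes R m).card * (I * T.card) := by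
  have := sum_map_outList (m := m) (fun _ => 1) hR hT
  simpa using this

lemma count_outList (hR : R = (I + 1) * q) (hT : T ⊆ range q) (z : ℕ) :
    (outList R m q I T).count z = ((goodPrimes R m ×ˢ (range I ×ˢ T)).filter fun y =>
      quot y.1 m (q * (y.2.1 + 1) + y.2.2) = z).card := by
  rw [count_eq_sum_map, sum_map_outList _ hR hT, card_filter, sum_product]
  simp only [sum_product]

/-- All shifts lie strictly between `0` and `R`, and all primes are at most `8 * R`, so `8 * R * R <
m` is what `quot_injective` needs. Division by `q` then separates `i` from `t`. -/
lemma nodup_outList (hR : R = (I + 1) * q) (hT : T ⊆ range q) (hm : 8 * R * R < m) :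
    (outList R m q I T).Nodup := by
  rw [List.nodup_iff_count_le_one]
  intro z
  rw [count_outList hR hT, card_le_one]
  rintro ⟨p, i, t⟩ h ⟨p', i', t'⟩ h'
  simp only [mem_filter, mem_product, mem_range, mem_goodPrimes] at h h'
  obtain ⟨⟨⟨⟨hRp, hp⟩, hpm⟩, hi, ht⟩, hz⟩ := h
  obtain ⟨⟨⟨⟨hRp', hp'⟩, hpm'⟩, hi', ht'⟩, hz'⟩ := h'
  have ht := mem_range.1 (hT ht)
  have ht' := mem_range.1 (hT ht')
  have hs := shift_lt hR hi ht
  have hs' := shift_lt hR hi' ht'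
  have hB : ∀ s, s < R → 8 * R * s < m := fun s hs =>
    (Nat.mul_le_mul_left _ hs.le).trans_lt hm
  have hq : 0 < q := by omega
  obtain ⟨h1, h2⟩ := quot_injective hp hp' hpm hpm' (by positivity) (by omega) (by omega)
    (by omega) hRp.2 hRp'.2 (hB _ hs) (hB _ hs') (hz.trans hz'.symm)
  have h3 : i = i' := by
    have := congrArg (· / q) h2
    simp only [Nat.mul_add_div hq, Nat.div_eq_of_lt ht, Nat.div_eq_of_lt ht'] at this
    omega
  subst h3
  simp only [Prod.mk.injEq]
  exact ⟨h1, trivial, by omega⟩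

lemma lt_of_mem_outList (hR : R = (I + 1) * q) (hT : T ⊆ range q) (hm : 8 * R * R < m) {z : ℕ}
    (hz : z ∈ outList R m q I T) : z < m := by
  have := List.count_pos_iff.2 hz
  rw [count_outList hR hT, card_pos] at this
  obtain ⟨⟨p, i, t⟩, h⟩ := this
  simp only [mem_filter, mem_product, mem_range, mem_goodPrimes] at h
  have := Fact.mk h.1.1.1.2
  have ht := mem_range.1 (hT h.1.2.2)
  rw [← h.2]
  refine quot_lt h.1.1.2 ((shift_lt hR h.1.2.1 ht).trans ?_)
  have : R * 1 ≤ R * R := Nat.mul_le_mul_left _ (by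
    have := shift_lt hR h.1.2.1 ht; omega)
  nlinarith

end

/-- The output has small discrepancy. -/
lemma disc_outList_le {q E R m L : ℕ} (hq : 1 ≤ q) (hE : 1 ≤ E) {T : Finset ℕ}
    (hTq : T ⊆ range q) (hT0 : T.Nonempty)
    (hT : ∀ k : ℤ, ¬ (q : ℤ) ∣ k →
      ‖∑ t ∈ T, Complex.exp (2 * Real.pi * Complex.I * k * t / q)‖ ≤ T.card / (4 * E))
    (hR : R = (40 * E ^ 2 + 1) * q) (hR20 : 2 ^ 20 ≤ R) (hm : m < 2 ^ L) (hL : 1 ≤ L)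
    (hRL : 2 ^ 20 * E ^ 5 * L ≤ R) (hmR : 8 * R * R < m) :
    outList R m q (40 * E ^ 2) T ≠ [] ∧
    disc ((outList R m q (40 * E ^ 2) T).toFinset.val.map fun z : ℕ => (z : ℤ)) m ≤ 1 / E := by
  have hnd := nodup_outList hR hTq hmR
  have hlen := length_outList (m := m) hR hTq
  have hm2 : 2 ≤ m := by nlinarith
  have hne : outList R m q (40 * E ^ 2) T ≠ [] := by
    rw [← List.length_pos_iff, hlen]
    have h1 := le_card_goodPrimes (m := m) hR20 (by omega)
    have hlogm : Real.log m ≤ L := by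
      have h3 : Real.log m ≤ Real.log (2 ^ L) :=
        Real.log_le_log (by exact_mod_cast (by omega : 0 < m)) (by exact_mod_cast hm.le)
      rw [Real.log_pow] at h3
      have := Real.log_two_lt_d9
      have : (1 : ℝ) ≤ L := by exact_mod_cast hL
      nlinarith
    have h4 : (2 : ℝ) * L < R := by
      have : 1 ≤ E ^ 5 := Nat.one_le_pow _ _ hE
      have : 2 * L < R := by nlinarith
      exact_mod_cast this
    have h5 : (goodPrimes R m).card ≠ 0 := by
      intro h0
      rw [h0] at h1
      norm_num at h1
      linarith
    have h6 := hT0.card_pos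
    positivity
  refine ⟨hne, ?_⟩
  refine disc_le hm2 (List.toFinset_nonempty_iff _ |>.2 hne) fun k hk hkm => ?_
  rw [List.toFinset_card_of_nodup hnd, hlen, List.sum_toFinset _ hnd, sum_map_outList _ hR hTq]
  refine (norm_sum_goodPrimes_le hq hE hTq hT hR hR20 hm hL hRL hk hkm).trans (le_of_eq ?_)
  push_cast; ring

/-- The number of elements is at most a constant times `R`. -/
lemma card_goodPrimes_mul_le {R m l : ℕ} (hl : 1 ≤ l) (hR : 2 ^ l ≤ R) :
    (goodPrimes R m).card * (l + 2) ≤ 72 * R := by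
  have h1 := card_primesAbove_mul_log_le R
  have h2 : ((goodPrimes R m).card : ℝ) ≤ (primesAbove R).card := by
    exact_mod_cast card_filter_le _ _
  have h3 : (l : ℝ) * Real.log 2 ≤ Real.log R := by
    rw [← Real.log_pow]
    exact Real.log_le_log (by positivity) (by exact_mod_cast hR)
  have h4 : Real.log 4 = 2 * Real.log 2 := by
    rw [show (4 : ℝ) = 2 ^ 2 by norm_num, Real.log_pow]; norm_num
  have hl2 : 0 < Real.log 2 := Real.log_pos (by norm_num)
  have h5 : ((goodPrimes R m).card * l : ℝ) * Real.log 2 ≤ (16 * R) * Real.log 2 := by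
    calc ((goodPrimes R m).card * l : ℝ) * Real.log 2
        = (goodPrimes R m).card * (l * Real.log 2) := by ring
      _ ≤ (primesAbove R).card * Real.log R := by gcongr
      _ ≤ _ := h1
      _ = _ := by rw [h4]; ring
  have h6 : (goodPrimes R m).card * l ≤ 16 * R := by
    exact_mod_cast le_of_mul_le_mul_right h5 hl2
  nlinarith

end SmallBias

/-! ### The algorithm and its parameters -/

namespace SmallBias
open Finset

namespace Expr

instance (n : ℕ) : OfNat Expr n := ⟨lit n⟩
instance : Add Expr := ⟨op .add⟩
instance : Sub Expr := ⟨op .sub⟩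
instance : Mul Expr := ⟨op .mul⟩
instance : Div Expr := ⟨op .div⟩
instance : Mod Expr := ⟨op .mod⟩

variable (v : Var → ℕ) (a b : Expr)

@[simp] lemma eval_ofNat (n : ℕ) : eval v (no_index (OfNat.ofNat n)) = n := rfl
@[simp] lemma eval_var (x : Var) : eval v (var x) = v x := rfl
@[simp] lemma eval_add : eval v (a + b) = eval v a + eval v b := rfl
@[simp] lemma eval_sub : eval v (a - b) = eval v a - eval v b := rfl
@[simp] lemma eval_mul : eval v (a * b) = eval v a * eval v b := rfl
@[simp] lemma eval_div : eval v (a / b) = eval v a / eval v b := rfl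
@[simp] lemma eval_mod : eval v (a % b) = eval v a % eval v b := rfl

end Expr

local prefix:max "§" => Expr.var
local infixr:60 " ;; " => Cmd.seq
local infix:62 " ::= " => Cmd.assign

namespace Cmd

open Var

/-- `L` becomes the number of binary digits of `m`. -/
def sizeLoop : Cmd := .loop x (x ::= §x / 2 ;; L ::= §L + 1)

/-- `q` becomes the least power `2 ^ l` that is at least `K`. -/
def clogLoop : Cmd := .loop g (q ::= 2 * §q ;; l ::= §l + 1 ;; g ::= §K - §q)

/-- The computation of the parameters. -/
def setup : Cmd :=
  x ::= §m ;; L ::= 0 ;; sizeLoop ;;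
  I ::= §E * §E ;; K ::= §I * §I ;; K ::= 8796093022208 * (§K * §K) * §L ;; I ::= 40 * §I ;;
  D ::= 32 * §E ;; q ::= 1 ;; l ::= 0 ;; g ::= §K - §q ;; clogLoop ;;
  n ::= 128 * (§E * §E) * (§l + 2) ;; R ::= (§I + 1) * §q ;; g ::= §m - 8 * §R * §R

/-- The output of all residues. -/
def full : Cmd := .forLoop i₁ c₁ §m (.push §i₁)

/-- The computation of the powers that the greedy choice needs. -/
def powers : Cmd :=
  M ::= 2 * §q ;;
  X ::= 1 ;; .forLoop i₁ c₁ (§n + 1) (X ::= §X * (§D + 2)) ;;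
  XM ::= 1 ;; .forLoop i₁ c₁ §M (XM ::= §XM * §X) ;;
  Q2 ::= 1 ;; .forLoop i₁ c₁ (§q - 1) (Q2 ::= §Q2 * 2)

/-- The comparison of a candidate with the best one so far. -/
def compareStep : Cmd :=
  .ite (§U / §b % 2) .skip (v ::= §F / §Y % §X ;;
    .ite (§best - §v) (best ::= §v ;; by' ::= §Y ;; bb ::= §b) .skip) ;;
  Y ::= §Y * §X * §X ;; b ::= §b * 2

/-- One step of the greedy choice. -/
def greedyStep : Cmd :=
  best ::= §XM ;; by' ::= 1 ;; bb ::= 1 ;; Y ::= §X ;; b ::= 1 ;;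
  .forLoop i₂ c₂ §q compareStep ;;
  F ::= §F * (§D + §by' + §XM / §by') % (§XM - 1) ;; U ::= §U + §bb + §Q2 / §bb

/-- The greedy choice. -/
def greedy : Cmd := F ::= 1 ;; U ::= 0 ;; .forLoop i₁ c₁ §n greedyStep

/-- The search for the quotient modulo `p`. -/
def quotLoop : Cmd :=
  .forLoop i₄ c₄ §p (.ite ((§t + §i₄ * §m) % §p) .skip (.push ((§t + §i₄ * §m) / §p)))

/-- One translate of the chosen set. -/
def translateLoop : Cmd :=
  b ::= 1 ;; .forLoop i₃ c₃ §q
    (.ite (§U / §b % 2) (t ::= §q * (§i₂ + 1) + §i₃ ;; quotLoop) .skip ;; b ::= §b * 2)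

/-- `g` becomes `1` or `0` according as `p` is prime or not. -/
def primeTest : Cmd :=
  g ::= 1 ;; .forLoop i₂ c₂ (§p - 2) (.ite (§p % (§i₂ + 2)) .skip (g ::= 0))

/-- The output of the residues for all primes. -/
def search : Cmd :=
  .forLoop i₁ c₁ (7 * §R)
    (p ::= §R + 1 + §i₁ ;; primeTest ;; .ite §g (.forLoop i₂ c₂ §I translateLoop) .skip)

/-- The whole algorithm. -/
def main : Cmd := setup ;; .ite §g (powers ;; greedy ;; search) full

lemma main_fits : main.Fits := by
  simp only [main, setup, sizeLoop, clogLoop, full, powers, compareStep, greedyStep, greedy,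
    quotLoop, translateLoop, primeTest, search, forLoop, Fits]
  repeat' apply And.intro
  all_goals trivial

lemma wp_conseq {N V : ℕ} {c : Cmd} {P Q : St → Prop} {σ : St} (h : wp N V c P σ)
    (hQ : ∀ τ, P τ → Frame c σ τ → Q τ) : wp N V c Q σ :=
  wp_mono (fun τ hτ => hQ τ hτ.1 hτ.2) (wp_frame h)

end Cmd

open Cmd

section
variable {N V m E : ℕ} {Q : St → Prop} {σ : St}

lemma wp_sizeLoop (hx : σ.v .x = m) (hL : σ.v .L = 0) (hN : m.size ≤ N) (hV : m ≤ V)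
    (hQ : ∀ τ, τ.v .L = m.size → Frame sizeLoop σ τ → Q τ) : sizeLoop.wp N V Q σ := by
  refine wp_conseq (P := fun τ => τ.v .L = m.size) (wp_loop
    (fun i τ => τ.v .x = m / 2 ^ i ∧ τ.v .L = i ∧ i ≤ m.size) ⟨by simpa using hx, hL, by omega⟩
    ?_ ?_) hQ
  · rintro i τ ⟨h1, h2, h3⟩ h0
    have hi : i < m.size := by
      rw [Nat.lt_size]
      by_contra hc
      exact h0 (by rw [h1, Nat.div_eq_of_lt (by omega)])
    have hmm : m.size ≤ m := Nat.size_le.2 m.lt_two_pow_self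
    have : m / 2 ^ i / 2 ≤ m := (Nat.div_le_self _ _).trans (Nat.div_le_self _ _)
    simp [Cmd.wp, h1, h2, Nat.div_div_eq_div_mul, ← pow_succ] at this ⊢
    omega
  · rintro i τ ⟨h1, h2, h3⟩ h0
    rw [h1, Nat.div_eq_zero_iff] at h0
    have : m.size ≤ i := Nat.size_le.2 (by have := Nat.two_pow_pos i; omega)
    omega

lemma wp_clogLoop {K : ℕ} (hK : σ.v .K = K) (hq : σ.v .q = 1) (hl : σ.v .l = 0)
    (hg : σ.v .g = K - 1) (hN : Nat.clog 2 K ≤ N) (hV : 2 ^ Nat.clog 2 K ≤ V) (hVK : K ≤ V)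
    (hQ : ∀ τ, τ.v .l = Nat.clog 2 K → τ.v .q = 2 ^ Nat.clog 2 K → Frame clogLoop σ τ → Q τ) :
    clogLoop.wp N V Q σ := by
  refine wp_conseq (P := fun τ => τ.v .l = Nat.clog 2 K ∧ τ.v .q = 2 ^ Nat.clog 2 K) (wp_loop
    (fun i τ => τ.v .K = K ∧ τ.v .q = 2 ^ i ∧ τ.v .l = i ∧ τ.v .g = K - 2 ^ i ∧
      i ≤ Nat.clog 2 K) ⟨hK, by simpa using hq, hl, by simpa using hg, by omega⟩
    ?_ ?_) (fun τ h => hQ τ h.1 h.2)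
  · rintro i τ ⟨h1, h2, h3, h4, h5⟩ h0
    have hi : i < Nat.clog 2 K := by
      rw [Nat.lt_clog_iff_pow_lt one_lt_two]; omega
    have h6 : 2 ^ (i + 1) ≤ V := (Nat.pow_le_pow_right (by norm_num) hi).trans hV
    have h7 : i + 1 < 2 ^ (i + 1) := Nat.lt_two_pow_self
    simp [Cmd.wp, h1, h2, h3, ← pow_succ']
    omega
  · rintro i τ ⟨h1, h2, h3, h4, h5⟩ h0
    have : Nat.clog 2 K ≤ i := by
      rw [Nat.clog_le_iff_le_pow one_lt_two]; omega
    have : i = Nat.clog 2 K := by omega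
    exact ⟨by omega, by rw [h2, this]⟩

end

/-- The parameter `K`. -/
def parK (m E : ℕ) : ℕ := 8796093022208 * E ^ 8 * m.size
/-- The parameter `l`. -/
def parl (m E : ℕ) : ℕ := Nat.clog 2 (parK m E)
/-- The parameter `q`. -/
def parq (m E : ℕ) : ℕ := 2 ^ parl m E
/-- The parameter `n`. -/
def parn (m E : ℕ) : ℕ := 128 * E ^ 2 * (parl m E + 2)
/-- The parameter `R`. -/
def parR (m E : ℕ) : ℕ := (40 * E ^ 2 + 1) * parq m E

/-- The parameters have their values. -/
structure Params (m E : ℕ) (σ : St) : Prop where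
  hm : σ.v .m = m
  hD : σ.v .D = 32 * E
  hI : σ.v .I = 40 * E ^ 2
  hq : σ.v .q = parq m E
  hn : σ.v .n = parn m E
  hR : σ.v .R = parR m E

section
variable {N V m E : ℕ} {Q : St → Prop} {σ : St}

lemma parK_le_parq (m E : ℕ) : parK m E ≤ parq m E := Nat.le_pow_clog one_lt_two _

lemma size_le_parK (hE : 1 ≤ E) : 8796093022208 * m.size ≤ parK m E := by
  rw [parK, mul_right_comm]
  exact Nat.le_mul_of_pos_right _ (by positivity)

lemma parq_pos (m E : ℕ) : 0 < parq m E := by rw [parq]; positivity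

lemma parq_le_parR (m E : ℕ) : parq m E ≤ parR m E := by
  rw [parR]; exact Nat.le_mul_of_pos_left _ (by positivity)

lemma one_le_size_of_two_le (hm : 2 ≤ m) : 2 ≤ m.size := by
  have : 1 < m.size := Nat.lt_size.2 (by simpa using hm)
  omega

lemma parq_lt (hE : 1 ≤ E) (hm : 2 ≤ m) : parq m E < 2 * parK m E := by
  have h1 : 1 < parK m E := by
    have := one_le_size_of_two_le hm
    have := size_le_parK (m := m) hE
    omega
  have h2 := Nat.pow_pred_clog_lt_self one_lt_two h1
  have h3 : 0 < Nat.clog 2 (parK m E) := Nat.clog_pos one_lt_two h1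
  rw [parq, parl]
  obtain ⟨c, hc⟩ : ∃ c, Nat.clog 2 (parK m E) = c + 1 := ⟨_, (Nat.succ_pred_eq_of_pos h3).symm⟩
  rw [hc] at h2 ⊢
  simp only [Nat.pred_succ] at h2
  rw [pow_succ]; omega

lemma add_two_pow_four_le {l : ℕ} (hl : 4 ≤ l) : (l + 2) ^ 4 ≤ 2 ^ 12 * 2 ^ l := by
  induction l, hl using Nat.le_induction with
  | base => norm_num
  | succ l hl ih =>
    rw [pow_succ 2 l]
    have : (l + 1 + 2) ^ 4 ≤ 2 * (l + 2) ^ 4 := by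
      obtain ⟨r, rfl⟩ := Nat.exists_eq_add_of_le hl
      ring_nf
      nlinarith [Nat.zero_le r, Nat.zero_le (r ^ 2), Nat.zero_le (r ^ 3), Nat.zero_le (r ^ 4)]
    omega

lemma pow_le_parK (hm : 2 ≤ m) : 2 ^ 44 * E ^ 8 ≤ parK m E := by
  have := one_le_size_of_two_le hm
  rw [parK]
  nlinarith [Nat.zero_le (E ^ 8)]

lemma le_parl (hE : 1 ≤ E) (hm : 2 ≤ m) : 44 ≤ parl m E := by
  have h1 := (pow_le_parK (E := E) hm).trans (parK_le_parq m E)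
  have h2 : 1 ≤ E ^ 8 := Nat.one_le_pow _ _ hE
  exact (Nat.pow_le_pow_iff_right one_lt_two).1
    ((Nat.le_mul_of_pos_right _ h2).trans h1)

/-- After squaring, the left side is `2^32 * E^8 * (l + 2)^4 ≤ 2^44 * E^8 * q`. The constant `2^43 *
E^8` in `parK`, together with `m.size ≥ 2`, makes this at most `q^2`. -/
lemma four_mul_parn_sq_le (hE : 1 ≤ E) (hm : 2 ≤ m) : 4 * parn m E ^ 2 ≤ parq m E := by
  have h1 := (pow_le_parK (E := E) hm).trans (parK_le_parq m E)
  have h2 := add_two_pow_four_le ((by norm_num : 4 ≤ 44).trans (le_parl hE hm))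
  change _ ≤ 2 ^ 12 * parq m E at h2
  refine (Nat.pow_le_pow_iff_left two_ne_zero).1 ?_
  have e1 : (4 * parn m E ^ 2) ^ 2 = 2 ^ 32 * E ^ 8 * (parl m E + 2) ^ 4 := by rw [parn]; ring
  rw [e1]
  calc 2 ^ 32 * E ^ 8 * (parl m E + 2) ^ 4 ≤ 2 ^ 32 * E ^ 8 * (2 ^ 12 * parq m E) := by gcongr
    _ = 2 ^ 44 * E ^ 8 * parq m E := by ring
    _ ≤ parq m E * parq m E := by gcongr
    _ = _ := (sq _).symm

lemma wp_setup (hE : 1 ≤ E) (hm : 2 ≤ m) (hN : parR m E ≤ N)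
    (hVm : m ≤ V) (hV : parR m E ≤ V)
    (hQ : ∀ τ, Params m E τ → τ.v .g = m - 8 * parR m E * parR m E → τ.out = [] → Q τ) :
    setup.wp N V Q (St.init m E) := by
  have hKq := parK_le_parq m E
  have hqR := parq_le_parR m E
  have hLK := size_le_parK (m := m) hE
  have hEK : E ^ 8 ≤ parK m E := by
    have := one_le_size_of_two_le hm
    rw [parK, mul_assoc, mul_left_comm]; exact Nat.le_mul_of_pos_right _ (by positivity)
  have hE2 : E ^ 2 ≤ E ^ 8 := Nat.pow_le_pow_right hE (by norm_num)
  have hE4 : E ^ 4 ≤ E ^ 8 := Nat.pow_le_pow_right hE (by norm_num)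
  have hnq : parn m E ≤ parq m E := by
    have := four_mul_parn_sq_le hE hm
    nlinarith
  have hIR : 40 * E ^ 2 ≤ parR m E := by
    rw [parR]; nlinarith [parq_pos m E]
  have hDR : 32 * E ≤ parR m E := by nlinarith
  have hl : Nat.clog 2 (parK m E) ≤ parq m E := by
    rw [parq, parl]; exact Nat.lt_two_pow_self.le
  refine ⟨by simpa [St.init] using hVm, Nat.zero_le _, ?_⟩
  refine wp_sizeLoop (m := m) (by simp [St.init]) (by simp) (by omega) hVm
    fun τ hL hF => ?_
  have em : τ.v .m = m := by rw [hF.1 .m (by decide)]; simp [St.init]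
  have eE : τ.v .E = E := by rw [hF.1 .E (by decide)]; simp [St.init]
  have eo : τ.out = [] := by rw [hF.2 rfl]; rfl
  have eK : 8796093022208 * (E * E * (E * E) * (E * E * (E * E))) * m.size = parK m E := by
    rw [parK]; ring
  have e4 : E * E * (E * E) = E ^ 4 := by ring
  have e2 : E * E = E ^ 2 := by ring
  simp only [Cmd.wp, Expr.eval_mul, Expr.eval_var, Expr.eval_ofNat, Expr.eval_sub, St.set_v,
    reduceCtorEq, if_true, if_false, eE, hL, eK]
  rw [e4, e2]
  refine ⟨by omega, by omega, by omega, by omega, by omega, by omega, by omega, by omega, ?_⟩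
  refine wp_clogLoop (K := parK m E) (by simp) (by simp) (by simp) (by simp) (by omega)
    (by exact hqR.trans hV) (by omega) fun τ' h1 h2 hF' => ?_
  have em' : τ'.v .m = m := by rw [hF'.1 .m (by decide)]; simp [em]
  have eE' : τ'.v .E = E := by rw [hF'.1 .E (by decide)]; simp [eE]
  have eI' : τ'.v .I = 40 * E ^ 2 := by rw [hF'.1 .I (by decide)]; simp
  have eD' : τ'.v .D = 32 * E := by rw [hF'.1 .D (by decide)]; simp
  have eo' : τ'.out = [] := by rw [hF'.2 rfl]; simp [eo]
  have en : 128 * E ^ 2 * (Nat.clog 2 (parK m E) + 2) = parn m E := rfl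
  have eR : (40 * E ^ 2 + 1) * 2 ^ Nat.clog 2 (parK m E) = parR m E := rfl
  simp only [Expr.eval_var, Expr.eval_ofNat, St.set_v, reduceCtorEq, if_false, Expr.eval_add, em', eE', h1, h2, eI', e2, en, eR]
  refine ⟨by omega, hV, (Nat.sub_le _ _).trans hVm, hQ _ ⟨?_, ?_, ?_, ?_, ?_, ?_⟩ ?_ ?_⟩ <;>
    simp [em', eI', eD', h2, eo', parq, parl]

end

end SmallBias

/-! ### Correctness of the greedy choice -/

namespace SmallBias
open Finset
open Cmd

/-- The base of the encoding. -/
def parX (m E : ℕ) : ℕ := (32 * E + 2) ^ (parn m E + 1)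

/-- The bounds `N` for the loops and `V` for the numbers are large enough. -/
structure Bounds (N V m E : ℕ) : Prop where
  hm : m ≤ V
  hR : 100 * parR m E ^ 3 ≤ V
  hX : parX m E ^ (2 * parq m E + 1) ≤ V
  hN : 16 * parR m E ^ 2 ≤ N

section
variable {N V m E : ℕ} {Q : St → Prop} {σ : St}

lemma two_le_parX (m E : ℕ) : 2 ≤ parX m E :=
  calc 2 ≤ 32 * E + 2 := by omega
    _ ≤ _ := Nat.le_self_pow (by omega) _

lemma parR_pos (m E : ℕ) : 0 < parR m E := (parq_pos m E).trans_le (parq_le_parR m E)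

namespace Bounds
variable (B : Bounds N V m E)
include B

lemma mul_parR_le {c : ℕ} (hc : c ≤ 100) : c * parR m E ≤ V := by
  refine le_trans ?_ B.hR
  exact Nat.mul_le_mul hc (Nat.le_self_pow (by norm_num) _)

lemma mul_parR_le_N {c : ℕ} (hc : c ≤ 16) : c * parR m E ≤ N := by
  refine le_trans ?_ B.hN
  exact Nat.mul_le_mul hc (Nat.le_self_pow (by norm_num) _)

lemma parX_pow_le {a : ℕ} (ha : a ≤ 2 * parq m E + 1) : parX m E ^ a ≤ V :=
  (Nat.pow_le_pow_right (by have := two_le_parX m E; omega) ha).trans B.hX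

lemma two_pow_le {a : ℕ} (ha : a ≤ 2 * parq m E + 1) : 2 ^ a ≤ V :=
  (Nat.pow_le_pow_left (two_le_parX m E) a).trans (B.parX_pow_le ha)

end Bounds

lemma wp_full (hm : σ.v .m = m) (ho : σ.out = []) (hN : m ≤ N) (hV : m ≤ V)
    (hQ : ∀ τ, τ.out = List.range m → Q τ) : full.wp N V Q σ := by
  refine wp_forLoop m (fun i τ => τ.out = List.range i) hm hN hV (by decide) (by decide) (by decide)
    ho (fun i τ a h => ⟨h, h⟩) (fun i hi τ h hx hF => ?_) fun τ h _ => hQ τ h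
  refine ⟨by simp [h]; omega, ?_⟩
  simp [h, hx, List.range_succ]

lemma wp_powLoop {n a : ℕ} {x : Var} {f k : Expr} (hx : σ.v x = 1) (hk : k.eval σ.v = n)
    (hxi : x ≠ .i₁) (hxc : x ≠ .c₁)
    (hf : ∀ τ, Frame (.forLoop .i₁ .c₁ k (.assign x (.var x * f))) σ τ → f.eval τ.v = a)
    (ha : 1 ≤ a) (hN : n ≤ N) (hnV : n ≤ V) (hV : a ^ n ≤ V)
    (hQ : ∀ τ, τ.v x = a ^ n → Frame (.forLoop .i₁ .c₁ k (.assign x (.var x * f))) σ τ → Q τ) :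
    (Cmd.forLoop .i₁ .c₁ k (.assign x (.var x * f))).wp N V Q σ := by
  refine wp_forLoop n (fun i τ => τ.v x = a ^ i) hk hN hnV (by decide)
    (by simpa [mods] using hxi.symm) (by simpa [mods] using hxc.symm) (by simpa using hx)
    (fun i τ b h => by simp [hxi, hxc, h]) (fun i hi τ h hi' hF => ?_) hQ
  have h1 : a ^ (i + 1) ≤ V := (Nat.pow_le_pow_right ha hi).trans hV
  simp [Cmd.wp, h, hf τ hF, ← pow_succ, h1]

lemma wp_powers (B : Bounds N V m E) (hE : 1 ≤ E) (hm : 2 ≤ m) (P : Params m E σ)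
    (hQ : ∀ τ, τ.v .X = parX m E → τ.v .XM = parX m E ^ (2 * parq m E) →
      τ.v .Q2 = 2 ^ (parq m E - 1) → Frame powers σ τ → Q τ) : powers.wp N V Q σ := by
  have hqR := parq_le_parR m E
  have hnq : parn m E + 1 ≤ parq m E := by
    have := four_mul_parn_sq_le hE hm
    have h1 : 1 ≤ parn m E := by rw [parn]; exact Nat.one_le_iff_ne_zero.2 (by positivity)
    nlinarith
  have hV2 := B.mul_parR_le (c := 2) (by norm_num)
  have hN2 := B.mul_parR_le_N (c := 2) (by norm_num)
  have hX1 : 1 ≤ parX m E := by have := two_le_parX m E; omega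
  refine wp_conseq (P := fun τ => τ.v .X = parX m E ∧ τ.v .XM = parX m E ^ (2 * parq m E) ∧
      τ.v .Q2 = 2 ^ (parq m E - 1)) ?_ fun τ h hF => hQ τ h.1 h.2.1 h.2.2 hF
  simp only [powers, Cmd.wp, Expr.eval_mul, Expr.eval_var, Expr.eval_ofNat, P.hq]
  refine ⟨by omega, by omega, ?_⟩
  refine wp_powLoop (n := parn m E + 1) (a := 32 * E + 2) (by simp) (by simp [P.hn]) (by decide)
    (by decide) (fun τ hF => ?_) (by omega) (by omega) (by omega)
    (by have := B.parX_pow_le (a := 1) (by omega); rwa [pow_one] at this) fun τ h1 hF => ?_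
  · simp [hF.1 .D (by decide), P.hD]
  have eM : τ.v .M = 2 * parq m E := by rw [hF.1 .M (by decide)]; simp
  have eq' : τ.v .q = parq m E := by rw [hF.1 .q (by decide)]; simp [P.hq]
  refine ⟨by omega, ?_⟩
  refine wp_powLoop (n := 2 * parq m E) (a := parX m E) (by simp) (by simp [eM]) (by decide)
    (by decide) (fun τ' hF' => ?_) hX1 (by omega) (by omega)
    (B.parX_pow_le (by omega)) fun τ' h2 hF' => ?_
  · rw [Expr.eval_var, hF'.1 .X (by decide)]; simp [h1, parX]
  have eX : τ'.v .X = parX m E := by rw [hF'.1 .X (by decide)]; simp [h1, parX]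
  have eq'' : τ'.v .q = parq m E := by rw [hF'.1 .q (by decide)]; simp [eq']
  refine ⟨by omega, ?_⟩
  refine wp_powLoop (n := parq m E - 1) (a := 2) (by simp) (by simp [eq'']) (by decide)
    (by decide) (fun τ'' hF'' => by simp) (by omega) (by omega) (by omega)
    (B.two_pow_le (by omega)) fun τ'' h3 hF'' => ?_
  refine ⟨?_, ?_, h3⟩
  · rw [hF''.1 .X (by decide)]; simp [eX]
  · rw [hF''.1 .XM (by decide)]; simp [h2]

lemma sum_two_pow_lt {A : Finset ℕ} {q : ℕ} (hA : A ⊆ range q) : ∑ i ∈ A, 2 ^ i < 2 ^ q :=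
  (sum_le_sum_of_subset hA).trans_lt (by
    simpa using sum_range_mul_pow_lt (X := 2) (fun _ => 1) (fun _ => by norm_num) q)

/-- The values that stay fixed during the greedy choice. -/
structure GreedyParams (m E : ℕ) (σ : St) : Prop extends Params m E σ where
  hX : σ.v .X = parX m E
  hXM : σ.v .XM = parX m E ^ (2 * parq m E)
  hQ2 : σ.v .Q2 = 2 ^ (parq m E - 1)

lemma GreedyParams.of_frame {c : Cmd} {τ : St} (P : GreedyParams m E σ) (hF : Frame c σ τ)
    (hc : ∀ x ∈ [Var.m, .D, .I, .q, .n, .R, .X, .XM, .Q2], x ∉ c.mods) : GreedyParams m E τ := by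
  refine ⟨⟨?_, ?_, ?_, ?_, ?_, ?_⟩, ?_, ?_, ?_⟩ <;> rw [hF.1 _ (hc _ (by decide))]
  exacts [P.hm, P.hD, P.hI, P.hq, P.hn, P.hR, P.hX, P.hXM, P.hQ2]

/-- The values during the comparison of the candidates below `t`. -/
structure Compare (m E : ℕ) (ts : List ℕ) (t : ℕ) (σ : St) : Prop where
  hY : σ.v .Y = parX m E ^ (2 * t + 1)
  hb : σ.v .b = 2 ^ t
  hbest : ((∀ a < t, a ∈ symm (parq m E) ts) ∧ σ.v .best = parX m E ^ (2 * parq m E)) ∨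
    ∃ τ < t, τ ∉ symm (parq m E) ts ∧
      σ.v .best = coef (parq m E) (32 * E) ts (oddRes (parq m E) τ) ∧
      σ.v .by' = parX m E ^ (2 * τ + 1) ∧ σ.v .bb = 2 ^ τ ∧
      ∀ a < t, a ∉ symm (parq m E) ts →
        σ.v .best ≤ coef (parq m E) (32 * E) ts (oddRes (parq m E) a)

instance : NeZero (parq m E) := ⟨(parq_pos m E).ne'⟩

lemma coef_lt {ts : List ℕ} (hts : ts.length < parn m E) (y : ZMod (2 * parq m E)) :
    coef (parq m E) (32 * E) ts y < parX m E := by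
  refine (coef_le _ _ _).trans_lt ?_
  exact Nat.pow_lt_pow_right (by omega) (by omega)

/-- The truncated difference of `best` and `v` is nonzero exactly when `v` is smaller. The initial
`best` exceeds every coefficient, so the first unused candidate is always accepted. -/
lemma wp_compareStep (B : Bounds N V m E) {ts : List ℕ} (hts : ts.length < parn m E)
    (hG : Greedy (parq m E) E (parn m E) ts) {t : ℕ} (ht : t < parq m E)
    (hX : σ.v .X = parX m E) (hF : σ.v .F = enc (parq m E) (parX m E)
      (coef (parq m E) (32 * E) ts)) (hU : σ.v .U = ∑ i ∈ symm (parq m E) ts, 2 ^ i)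
    (hC : Compare m E ts t σ) : compareStep.wp N V (Compare m E ts (t + 1)) σ := by
  have hV1 : parX m E ^ (2 * (t + 1) + 1) ≤ V := B.parX_pow_le (by omega)
  have hV2 : 2 ^ (t + 1) ≤ V := B.two_pow_le (by omega)
  have eY : parX m E ^ (2 * t + 1) * parX m E * parX m E = parX m E ^ (2 * (t + 1) + 1) := by
    ring
  have hbit : σ.v .U / σ.v .b % 2 = if t ∈ symm (parq m E) ts then 1 else 0 := by
    rw [hU, hC.hb, sum_two_pow_div_mod hG.symm_subset ht]
  have hval : σ.v .F / σ.v .Y % σ.v .X =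
      coef (parq m E) (32 * E) ts (oddRes (parq m E) t) := by
    rw [hF, hC.hY, hX, enc_div_mod _ (coef_lt hts) ht]
  have hlt := coef_lt hts (oddRes (parq m E) t)
  have hXV : parX m E ≤ V := by simpa using B.parX_pow_le (a := 1) (by omega)
  have hXM : parX m E ≤ parX m E ^ (2 * parq m E) :=
    Nat.le_self_pow (by have := parq_pos m E; omega) _
  simp only [compareStep, Cmd.wp, Expr.eval_mod, Expr.eval_div, Expr.eval_var, Expr.eval_ofNat,
    Expr.eval_mul, Expr.eval_sub, St.set_v, reduceCtorEq, if_true, if_false, hbit, hval]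
  by_cases hu : t ∈ symm (parq m E) ts
  · refine ⟨fun _ => ?_, fun h => by simp [hu] at h⟩
    rw [hC.hY, hX, hC.hb, eY, ← pow_succ]
    refine ⟨hV1, hV2, by simp, by simp, ?_⟩
    simp only [St.set_v, reduceCtorEq, if_false]
    rcases hC.hbest with ⟨h1, h2⟩ | ⟨τ, h1, h2, h3, h4, h5, h6⟩
    · refine Or.inl ⟨fun a ha => ?_, h2⟩
      rcases Nat.lt_succ_iff_lt_or_eq.1 ha with h | rfl
      exacts [h1 a h, hu]
    · refine Or.inr ⟨τ, by omega, h2, h3, h4, h5, fun a ha hau => ?_⟩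
      rcases Nat.lt_succ_iff_lt_or_eq.1 ha with h | rfl
      exacts [h6 a h hau, absurd hu hau]
  · refine ⟨fun h => by simp [hu] at h, fun _ => ?_⟩
    refine ⟨by omega, fun h0 => ?_, fun h0 => ?_⟩
    · rw [hC.hY, hX, hC.hb, eY, ← pow_succ]
      refine ⟨by omega, B.parX_pow_le (by omega), B.two_pow_le (by omega), hV1, hV2,
        by simp, by simp, Or.inr ⟨t, by omega, hu, by simp, by simp, by simp, fun a ha hau => ?_⟩⟩
      simp only [St.set_v, reduceCtorEq, if_true, if_false]
      rcases Nat.lt_succ_iff_lt_or_eq.1 ha with h | rfl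
      · rcases hC.hbest with ⟨h1, h2⟩ | ⟨τ, h1, h2, h3, h4, h5, h6⟩
        · exact absurd (h1 a h) hau
        · have := h6 a h hau
          omega
      · exact le_rfl
    · rw [hC.hY, hX, hC.hb, eY, ← pow_succ]
      refine ⟨hV1, hV2, by simp, by simp, ?_⟩
      simp only [St.set_v, reduceCtorEq, if_false]
      rcases hC.hbest with ⟨h1, h2⟩ | ⟨τ, h1, h2, h3, h4, h5, h6⟩
      · omega
      · refine Or.inr ⟨τ, by omega, h2, h3, h4, h5, fun a ha hau => ?_⟩
        rcases Nat.lt_succ_iff_lt_or_eq.1 ha with h | rfl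
        · exact h6 a h hau
        · omega

lemma sum_symm_cons {q τ : ℕ} {ts : List ℕ}
    (h : (τ :: ts ++ (τ :: ts).map (q - 1 - ·)).Nodup) (h' : (ts ++ ts.map (q - 1 - ·)).Nodup)
    (g : ℕ → ℕ) : ∑ i ∈ symm q (τ :: ts), g i = ∑ i ∈ symm q ts, g i + g τ + g (q - 1 - τ) := by
  rw [symm, symm, List.sum_toFinset _ h, List.sum_toFinset _ h']
  simp only [List.map_cons, List.map_append, List.sum_append, List.sum_cons]
  ring

/-- The values after some steps of the greedy choice. -/
def GreedyState (m E i : ℕ) (σ : St) : Prop :=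
  ∃ ts : List ℕ, ts.length = i ∧ Greedy (parq m E) E (parn m E) ts ∧
    σ.v .F = enc (parq m E) (parX m E) (coef (parq m E) (32 * E) ts) ∧
    σ.v .U = ∑ i ∈ symm (parq m E) ts, 2 ^ i

lemma even_parq (hE : 1 ≤ E) (hm : 2 ≤ m) : Even (parq m E) := by
  have := le_parl hE hm
  rw [parq, Nat.even_pow]
  exact ⟨even_two, by omega⟩

lemma wp_greedyStep (B : Bounds N V m E) (hE : 1 ≤ E) (hm : 2 ≤ m) (P : GreedyParams m E σ)
    {i : ℕ} (hi : i < parn m E) (hS : GreedyState m E i σ) :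
    greedyStep.wp N V (GreedyState m E (i + 1)) σ := by
  obtain ⟨ts, hlen, hG, hF, hU⟩ := hS
  have hts : ts.length < parn m E := by omega
  have hqpos := parq_pos m E
  have hqR := parq_le_parR m E
  have hV1 := B.mul_parR_le (c := 1) (by norm_num)
  have hN1 := B.mul_parR_le_N (c := 1) (by norm_num)
  have hn2 : 2 * parn m E ≤ parq m E := by
    have := four_mul_parn_sq_le hE hm
    nlinarith
  have hX2 := two_le_parX m E
  simp only [greedyStep, Cmd.wp, Expr.eval_var, Expr.eval_ofNat, St.set_v, reduceCtorEq, if_false,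
    P.hX, P.hXM]
  refine ⟨B.parX_pow_le (by omega), by omega, by omega,
    by simpa using B.parX_pow_le (a := 1) (by omega), by omega, ?_⟩
  refine wp_forLoop (parq m E) (Compare m E ts) (by simp [P.hq]) (by omega) (by omega) (by decide)
    (by decide) (by decide) ?_ ?_ ?_ ?_
  · refine ⟨by simp, by simp, Or.inl ⟨by simp, by simp⟩⟩
  · intro j τ a h
    constructor <;>
    · refine ⟨by simpa using h.hY, by simpa using h.hb, ?_⟩
      simpa using h.hbest
  · intro t ht τ h _ hFr
    refine wp_compareStep B hts hG ht ?_ ?_ ?_ h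
    · rw [hFr.1 .X (by decide)]; simp [P.hX]
    · rw [hFr.1 .F (by decide)]; simp [hF]
    · rw [hFr.1 .U (by decide)]; simp [hU]
  · intro τ h hFr
    have eF : τ.v .F = enc (parq m E) (parX m E) (coef (parq m E) (32 * E) ts) := by
      rw [hFr.1 .F (by decide)]; simp [hF]
    have eU : τ.v .U = ∑ i ∈ symm (parq m E) ts, 2 ^ i := by
      rw [hFr.1 .U (by decide)]; simp [hU]
    have eD : τ.v .D = 32 * E := by rw [hFr.1 .D (by decide)]; simp [P.hD]
    have eXM : τ.v .XM = parX m E ^ (2 * parq m E) := by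
      rw [hFr.1 .XM (by decide)]; simp [P.hXM]
    have eQ2 : τ.v .Q2 = 2 ^ (parq m E - 1) := by rw [hFr.1 .Q2 (by decide)]; simp [P.hQ2]
    rcases h.hbest with ⟨h1, -⟩ | ⟨c, h1, h2, h3, h4, h5, h6⟩
    · obtain ⟨a, ha, hau⟩ := hG.exists_unused hts hn2
      exact absurd (h1 a ha) hau
    have hcons := hG.cons hE (even_parq hE hm) hts hn2 h1 h2 fun a ha hau => h3 ▸ h6 a ha hau
    -- Exact division turns the stored powers into those for the inverse exponent and, in `e2`, for
    -- the mirror image.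
    have e1 : parX m E ^ (2 * parq m E) / parX m E ^ (2 * c + 1) =
        parX m E ^ (2 * parq m E - (2 * c + 1)) := Nat.pow_div (by omega) (by omega)
    have e2 : 2 ^ (parq m E - 1) / 2 ^ c = 2 ^ (parq m E - 1 - c) :=
      Nat.pow_div (by omega) (by norm_num)
    have e3 : (32 * E + 2) ^ (ts.length + 1) + 2 ≤ parX m E := by
      rw [parX]
      have h7 : (32 * E + 2) ^ (ts.length + 1) ≤ (32 * E + 2) ^ parn m E :=
        Nat.pow_le_pow_right (by omega) (by omega)
      have h8 : 2 ≤ (32 * E + 2) ^ parn m E :=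
        (by omega : 2 ≤ 32 * E + 2).trans (Nat.le_self_pow (by omega) _)
      rw [pow_succ (32 * E + 2) (parn m E)]
      nlinarith
    have e4 := enc_coef_cons (q := parq m E) e3 h1
    have e5 : ∑ i ∈ symm (parq m E) ts, 2 ^ i + 2 ^ c + 2 ^ (parq m E - 1 - c) =
        ∑ i ∈ symm (parq m E) (c :: ts), 2 ^ i := (sum_symm_cons hcons.nodup hG.nodup _).symm
    simp only [Expr.eval_mod, Expr.eval_add, Expr.eval_sub, Expr.eval_mul, Expr.eval_div,
      Expr.eval_var, Expr.eval_ofNat, St.set_v, reduceCtorEq, if_false, eF, eU, eD, eXM, eQ2,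
      h4, h5, e1, e2, e5]
    rw [← e4]
    refine ⟨?_, ?_, c :: ts, by simp [hlen], hcons, by simp, by simp⟩
    · refine (Nat.le_of_lt ?_).trans (B.parX_pow_le (a := 2 * parq m E) (by omega))
      rw [e4]
      have h9 : 2 ≤ parX m E ^ (2 * parq m E) := hX2.trans (Nat.le_self_pow (by omega) _)
      exact (Nat.mod_lt _ (by omega)).trans (by omega)
    · exact (sum_two_pow_lt hcons.symm_subset).le.trans (B.two_pow_le (by omega))

lemma wp_greedy (B : Bounds N V m E) (hE : 1 ≤ E) (hm : 2 ≤ m) (P : GreedyParams m E σ)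
    (hQ : ∀ τ, GreedyState m E (parn m E) τ → Frame greedy σ τ → Q τ) : greedy.wp N V Q σ := by
  have hqR := parq_le_parR m E
  have hqpos := parq_pos m E
  have hV1 := B.mul_parR_le (c := 1) (by norm_num)
  have hN1 := B.mul_parR_le_N (c := 1) (by norm_num)
  have hn2 : 2 * parn m E ≤ parq m E := by
    have := four_mul_parn_sq_le hE hm
    nlinarith
  refine wp_conseq (P := GreedyState m E (parn m E)) ?_ hQ
  simp only [greedy, Cmd.wp, Expr.eval_ofNat]
  refine ⟨by omega, by omega, ?_⟩
  refine wp_forLoop (parn m E) (GreedyState m E) (by simp [P.hn]) (by omega) (by omega) (by decide)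
    (by decide) (by decide) ?_ ?_ ?_ fun τ h _ => h
  · exact ⟨[], rfl, Greedy.nil _ _ _, by simp [enc_nil], by simp [symm]⟩
  · intro i τ a h
    simpa [GreedyState] using h
  · intro i hi τ h _ hFr
    refine wp_greedyStep B hE hm (GreedyParams.of_frame (σ := (σ.set .F 1).set .U 0) ?_ hFr
      (by decide)) hi h
    exact ⟨⟨by simp [P.hm], by simp [P.hD], by simp [P.hI], by simp [P.hq], by simp [P.hn],
      by simp [P.hR]⟩, by simp [P.hX], by simp [P.hXM], by simp [P.hQ2]⟩

end

end SmallBias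

/-! ### Correctness of the search over primes -/

namespace SmallBias
open Finset
open Cmd

/-- The quotients by `p` that are congruent to the quotient of `s`. -/
def quotList (m p s : ℕ) : List ℕ :=
  (List.range p).flatMap fun j => if (s + j * m) % p = 0 then [(s + j * m) / p] else []

/-- The output for one translate. -/
def translateList (m p q : ℕ) (T : Finset ℕ) (i : ℕ) : List ℕ :=
  (List.range q).flatMap fun t => if t ∈ T then quotList m p (q * (i + 1) + t) else []

/-- The output for one number `p`. -/
def primeList (m q I : ℕ) (T : Finset ℕ) (p : ℕ) : List ℕ :=
  if p.Prime then (List.range I).flatMap (translateList m p q T) else []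

lemma outList_eq (R m q I : ℕ) (T : Finset ℕ) :
    outList R m q I T = (List.range (7 * R)).flatMap fun a => primeList m q I T (R + 1 + a) :=
  rfl

lemma flatMap_range_succ (f : ℕ → List ℕ) (n : ℕ) :
    (List.range (n + 1)).flatMap f = (List.range n).flatMap f ++ f n := by
  simp [List.range_succ]

lemma length_flatMap_range_le {f : ℕ → List ℕ} {n c : ℕ} (h : ∀ i < n, (f i).length ≤ c) :
    ((List.range n).flatMap f).length ≤ n * c := by
  induction n with
  | zero => simp
  | succ n ih =>
    rw [flatMap_range_succ, List.length_append, add_one_mul]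
    exact add_le_add (ih fun i hi => h i (by omega)) (h n (by omega))

lemma length_quotList_le (m p s : ℕ) : (quotList m p s).length ≤ p :=
  (length_flatMap_range_le (c := 1) fun j _ => by split_ifs <;> simp).trans (mul_one p).le

lemma length_translateList_le (m p q : ℕ) (T : Finset ℕ) (i : ℕ) :
    (translateList m p q T i).length ≤ q * p := by
  refine length_flatMap_range_le fun t _ => ?_
  split_ifs
  exacts [length_quotList_le _ _ _, Nat.zero_le _]

lemma length_primeList_le (m q I : ℕ) (T : Finset ℕ) (p : ℕ) :
    (primeList m q I T p).length ≤ I * (q * p) := by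
  rw [primeList]
  split_ifs
  exacts [length_flatMap_range_le fun i _ => length_translateList_le _ _ _ _ _, Nat.zero_le _]

section
variable {N V : ℕ} {Q : St → Prop} {σ : St}

/-- A counting loop with output. -/
lemma wp_forLoop_out {x y : Var} {e : Expr} {c : Cmd} {P : ℕ → St → Prop} (n k : ℕ)
    (f : ℕ → List ℕ) (hf : ∀ i < n, (f i).length ≤ k) (hn : e.eval σ.v = n) (hN : n ≤ N)
    (hV : n ≤ V) (hout : σ.out.length + n * k ≤ V)
    (hxy : x ≠ y) (hx : x ∉ c.mods) (hy : y ∉ c.mods) (h0 : P 0 σ)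
    (hI : ∀ i τ a, P i τ → P i (τ.set x a) ∧ P i (τ.set y a))
    (hstep : ∀ i < n, ∀ τ, P i τ → τ.v x = i → Frame (forLoop x y e c) σ τ →
      τ.out.length + k ≤ V → wp N V c (fun τ' => τ'.out = τ.out ++ f i ∧ P (i + 1) τ') τ)
    (hQ : ∀ τ, τ.out = σ.out ++ (List.range n).flatMap f → P n τ →
      Frame (forLoop x y e c) σ τ → Q τ) : wp N V (forLoop x y e c) Q σ := by
  refine wp_forLoop n (fun i τ => τ.out = σ.out ++ (List.range i).flatMap f ∧ P i τ) hn hN hV hxy hx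
    hy ⟨by simp, h0⟩ (fun i τ a h => ⟨⟨h.1, (hI i τ a h.2).1⟩, ⟨h.1, (hI i τ a h.2).2⟩⟩)
    (fun i hi τ h hix hF => ?_) fun τ h hF => hQ τ h.1 h.2 hF
  refine wp_mono (fun τ' h' => ⟨?_, h'.2⟩) (hstep i hi τ h.2 hix hF ?_)
  · rw [h'.1, h.1, flatMap_range_succ, List.append_assoc]
  · have h1 := length_flatMap_range_le (n := i) fun j hj => hf j (by omega)
    have h2 : (i + 1) * k ≤ n * k := Nat.mul_le_mul_right _ hi
    rw [h.1, List.length_append]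
    rw [add_one_mul] at h2
    omega

lemma wp_quotLoop {m p s : ℕ} (hm : σ.v .m = m) (hp : σ.v .p = p) (ht : σ.v .t = s)
    (hN : p ≤ N) (hout : σ.out.length + p ≤ V) :
    quotLoop.wp N V (fun τ => τ.out = σ.out ++ quotList m p s) σ := by
  refine wp_forLoop_out (P := fun _ _ => True) p 1 _ (fun i _ => by split_ifs <;> simp) (by simp [hp])
    hN (by omega) (by omega) (by decide) (by decide) (by decide) trivial
    (fun _ _ _ _ => ⟨trivial, trivial⟩) (fun i hi τ _ hix hF hl => ?_) fun τ h _ _ => h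
  have em : τ.v .m = m := by rw [hF.1 .m (by decide), hm]
  have ep : τ.v .p = p := by rw [hF.1 .p (by decide), hp]
  have et : τ.v .t = s := by rw [hF.1 .t (by decide), ht]
  simp only [Cmd.wp, Expr.eval_mod, Expr.eval_div, Expr.eval_add, Expr.eval_mul, Expr.eval_var,
    hix, em, ep, et]
  refine ⟨fun h => ?_, fun h => ⟨by omega, ?_⟩⟩ <;> simp [h]

lemma wp_translateLoop {m p q i : ℕ} {T : Finset ℕ} (hT : T ⊆ range q) (hm : σ.v .m = m)
    (hp : σ.v .p = p) (hq : σ.v .q = q) (hi : σ.v .i₂ = i) (hU : σ.v .U = ∑ t ∈ T, 2 ^ t)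
    (hpN : p ≤ N) (hqN : q ≤ N) (hqV : q * (i + 1) + q ≤ V) (h2V : 2 ^ q ≤ V)
    (hout : σ.out.length + q * p ≤ V) :
    translateLoop.wp N V (fun τ => τ.out = σ.out ++ translateList m p q T i) σ := by
  refine ⟨Nat.one_le_two_pow.trans h2V, ?_⟩
  refine wp_forLoop_out (P := fun t τ => τ.v .b = 2 ^ t) q p
    (fun t => if t ∈ T then quotList m p (q * (i + 1) + t) else [])
    (fun t _ => by split_ifs; exacts [length_quotList_le _ _ _, Nat.zero_le _]) (by simp [hq])
    hqN (by omega) hout (by decide) (by decide) (by decide) (by simp)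
    (fun _ _ _ h => by simp [h]) (fun t ht τ hb hix hF hl => ?_) fun τ h _ _ => h
  have em : τ.v .m = m := by rw [hF.1 .m (by decide)]; simp [hm]
  have ep : τ.v .p = p := by rw [hF.1 .p (by decide)]; simp [hp]
  have eq' : τ.v .q = q := by rw [hF.1 .q (by decide)]; simp [hq]
  have ei : τ.v .i₂ = i := by rw [hF.1 .i₂ (by decide)]; simp [hi]
  have eU : τ.v .U = ∑ t ∈ T, 2 ^ t := by rw [hF.1 .U (by decide)]; simp [hU]
  have hpow : 2 ^ (t + 1) ≤ V := (Nat.pow_le_pow_right (by norm_num) ht).trans h2V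
  have hbit := sum_two_pow_div_mod hT ht
  simp only [Cmd.wp, Expr.eval_mod, Expr.eval_div, Expr.eval_add, Expr.eval_mul, Expr.eval_var,
    Expr.eval_ofNat, eU, hb, hbit, eq', ei, hix]
  by_cases htT : t ∈ T
  · refine ⟨fun _ => ⟨by omega, ?_⟩, fun h => by simp [htT] at h⟩
    refine wp_conseq (wp_quotLoop (m := m) (p := p) (s := q * (i + 1) + t) (by simp [em])
      (by simp [ep]) (by simp) hpN (by simpa using hl)) fun τ' h hF' => ?_
    rw [hF'.1 .b (by decide)]
    simp [h, htT, hb, ← pow_succ, hpow]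
  · refine ⟨fun h => by simp [htT] at h, fun _ => ?_⟩
    simp [htT, ← pow_succ, hpow]

/-- Trial division by `2, …, p - 1`; it is affordable because `p` is only of order `log m` for fixed
`E`. -/
lemma wp_primeTest {p : ℕ} (hp : σ.v .p = p) (hp2 : 2 ≤ p) (hN : p ≤ N) (hV : p ≤ V)
    (hQ : ∀ τ, (τ.v .g ≠ 0 ↔ p.Prime) → Frame primeTest σ τ → Q τ) : primeTest.wp N V Q σ := by
  refine wp_conseq (P := fun τ => τ.v .g ≠ 0 ↔ p.Prime) ⟨by simp; omega, ?_⟩ hQ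
  refine wp_forLoop (p - 2) (fun i τ => τ.v .g ≠ 0 ↔ ∀ d < i, p % (d + 2) ≠ 0) (by simp [hp])
    (by omega) (by omega) (by decide) (by decide) (by decide) (by simp)
    (fun i τ a h => by simpa using h) (fun i hi τ h hix hF => ?_) fun τ h _ => ?_
  · have ep : τ.v .p = p := by rw [hF.1 .p (by decide)]; simp [hp]
    simp only [Cmd.wp, Expr.eval_mod, Expr.eval_add, Expr.eval_var, Expr.eval_ofNat, ep, hix,
      St.set_v, if_true]
    refine ⟨fun h0 => ?_, fun h0 => ⟨Nat.zero_le _, ?_⟩⟩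
    · rw [h]
      refine ⟨fun h' d hd => ?_, fun h' d hd => h' d (by omega)⟩
      rcases Nat.lt_succ_iff_lt_or_eq.1 hd with hd | rfl
      exacts [h' d hd, h0]
    · simp only [ne_eq, not_true_eq_false, false_iff]
      exact fun h' => h' i (by omega) h0
  · rw [h, Nat.prime_def_lt']
    refine ⟨fun h' => ⟨hp2, fun d h2 hd hdp => ?_⟩, fun h' d hd h0 => ?_⟩
    · exact h' (d - 2) (by omega) (by
        rw [show d - 2 + 2 = d by omega]; exact Nat.mod_eq_zero_of_dvd hdp)
    · exact h'.2 (d + 2) (by omega) (by omega) (Nat.dvd_of_mod_eq_zero h0)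

variable {m E : ℕ}

/-- The length of the list must stay below `V`. The estimate allows one output for every `j` and
every number in the interval, at most `56 * R^3` in all, so no arithmetic of primes enters. -/
lemma wp_search (B : Bounds N V m E) (P : Params m E σ) {T : Finset ℕ}
    (hT : T ⊆ range (parq m E)) (hU : σ.v .U = ∑ t ∈ T, 2 ^ t) (hout : σ.out = []) :
    search.wp N V
      (fun τ => τ.out = outList (parR m E) m (parq m E) (40 * E ^ 2) T) σ := by
  have hR1 := parR_pos m E
  have hqR := parq_le_parR m E
  have hIq : 40 * E ^ 2 * parq m E ≤ parR m E := by rw [parR]; gcongr; omega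
  have hqIq : parq m E * (40 * E ^ 2) + parq m E = parR m E := by rw [parR]; ring
  have hV8 := B.mul_parR_le (c := 8) (by norm_num)
  have hN8 := B.mul_parR_le_N (c := 8) (by norm_num)
  have hIR : 40 * E ^ 2 ≤ parR m E := (Nat.le_mul_of_pos_right _ (parq_pos m E)).trans hIq
  have hlen : 7 * parR m E * (40 * E ^ 2 * (parq m E * (8 * parR m E))) ≤ V := by
    refine le_trans ?_ B.hR
    calc _ = 7 * parR m E * (40 * E ^ 2 * parq m E * (8 * parR m E)) := by ring
      _ ≤ 7 * parR m E * (parR m E * (8 * parR m E)) := by gcongr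
      _ = 56 * parR m E ^ 3 := by ring
      _ ≤ _ := by gcongr; norm_num
  rw [outList_eq]
  refine wp_forLoop_out (P := fun _ _ => True) (7 * parR m E)
    (40 * E ^ 2 * (parq m E * (8 * parR m E)))
    (fun a => primeList m (parq m E) (40 * E ^ 2) T (parR m E + 1 + a))
    (fun a ha => (length_primeList_le _ _ _ _ _).trans
      (by gcongr; exact (by omega : parR m E + 1 + a ≤ 8 * parR m E))) (by simp [P.hR])
    (by omega) (by omega) (by simpa [hout] using hlen) (by decide) (by decide) (by decide) trivial
    (fun _ _ _ _ => ⟨trivial, trivial⟩) (fun a ha τ _ hix hF hl => ?_)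
    fun τ h _ _ => by simpa [hout] using h
  have em : τ.v .m = m := by rw [hF.1 .m (by decide), P.hm]
  have eq' : τ.v .q = parq m E := by rw [hF.1 .q (by decide), P.hq]
  have eI : τ.v .I = 40 * E ^ 2 := by rw [hF.1 .I (by decide), P.hI]
  have eR : τ.v .R = parR m E := by rw [hF.1 .R (by decide), P.hR]
  have eU : τ.v .U = ∑ t ∈ T, 2 ^ t := by rw [hF.1 .U (by decide), hU]
  simp only [Cmd.wp, Expr.eval_add, Expr.eval_var, Expr.eval_ofNat, hix, eR]
  set p := parR m E + 1 + a with hp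
  have hp8 : p ≤ 8 * parR m E := by omega
  refine ⟨by omega, wp_primeTest (p := p) (by simp) (by omega) (by omega) (by omega)
    fun τ₁ hg hF₁ => ?_⟩
  have eo₁ : τ₁.out = τ.out := hF₁.2 rfl
  rw [primeList]
  refine ⟨fun h => ?_, fun h => ?_⟩
  · rw [if_pos (hg.1 h)]
    refine wp_forLoop_out (P := fun _ _ => True) (40 * E ^ 2) (parq m E * p) _
      (fun i _ => length_translateList_le _ _ _ _ _) ?_
      (by omega) (by omega) ?_ (by decide) (by decide) (by decide) trivial
      (fun _ _ _ _ => ⟨trivial, trivial⟩) (fun i hi τ₂ _ hix₂ hF₂ hl₂ => ?_)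
      fun τ h _ _ => ⟨by rw [h, eo₁], trivial⟩
    · rw [Expr.eval_var, hF₁.1 .I (by decide)]; simp [eI]
    · rw [eo₁]
      refine le_trans ?_ hl
      gcongr
    · have hi' : parq m E * (i + 1) + parq m E ≤ V := by
        have : parq m E * (i + 1) ≤ parq m E * (40 * E ^ 2) := Nat.mul_le_mul_left _ hi
        omega
      refine wp_mono (fun τ' h' => ⟨h', trivial⟩) (wp_translateLoop (m := m) (p := p) hT ?_ ?_ ?_
        hix₂ ?_ (by omega) (by omega) hi' (B.two_pow_le (by omega)) hl₂)
      · rw [hF₂.1 .m (by decide), hF₁.1 .m (by decide)]; simp [em]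
      · rw [hF₂.1 .p (by decide), hF₁.1 .p (by decide)]; simp
      · rw [hF₂.1 .q (by decide), hF₁.1 .q (by decide)]; simp [eq']
      · rw [hF₂.1 .U (by decide), hF₁.1 .U (by decide)]; simp [eU]
  · rw [if_neg fun h' => hg.2 h' h]
    simp [eo₁]

lemma Params.of_frame {c : Cmd} {τ : St} (P : Params m E σ) (hF : Frame c σ τ)
    (hc : ∀ x ∈ [Var.m, .D, .I, .q, .n, .R], x ∉ c.mods) : Params m E τ := by
  refine ⟨?_, ?_, ?_, ?_, ?_, ?_⟩ <;> rw [hF.1 _ (hc _ (by decide))]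
  exacts [P.hm, P.hD, P.hI, P.hq, P.hn, P.hR]

/-- The output is everything if `m` is small, and the list for a greedily chosen set if `m` is
large. -/
def IsOutput (m E : ℕ) (Z : List ℕ) : Prop :=
  (m ≤ 8 * parR m E * parR m E ∧ Z = List.range m) ∨
  (8 * parR m E * parR m E < m ∧ ∃ ts : List ℕ, ts.length = parn m E ∧
    Greedy (parq m E) E (parn m E) ts ∧
    Z = outList (parR m E) m (parq m E) (40 * E ^ 2) (symm (parq m E) ts))

lemma wp_main (B : Bounds N V m E) (hE : 1 ≤ E) (hm : 2 ≤ m) :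
    main.wp N V (fun σ => IsOutput m E σ.out) (St.init m E) := by
  have hV1 := B.mul_parR_le (c := 1) (by norm_num)
  have hN1 := B.mul_parR_le_N (c := 1) (by norm_num)
  refine wp_setup hE hm (by omega) B.hm (by omega) fun τ P hg ho => ?_
  refine ⟨fun h0 => ?_, fun h0 => ?_⟩ <;> rw [Expr.eval_var, hg] at h0
  · have h : 8 * parR m E * parR m E < m := by omega
    refine wp_powers B hE hm P fun τ₁ hX hXM hQ2 hF₁ => ?_
    have P₁ : GreedyParams m E τ₁ := ⟨P.of_frame hF₁ (by decide), hX, hXM, hQ2⟩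
    refine wp_greedy B hE hm P₁ fun τ₂ ⟨ts, hlen, hG, _, hU⟩ hF₂ => ?_
    refine wp_mono (fun τ₃ h₃ => Or.inr ⟨h, ts, hlen, hG, h₃⟩)
      (wp_search B (P₁.toParams.of_frame hF₂ (by decide)) hG.symm_subset hU ?_)
    rw [hF₂.2 rfl, hF₁.2 rfl, ho]
  · have h : m ≤ 8 * parR m E * parR m E := by omega
    -- In this case `m ≤ 8 * R^2 ≤ N`, so counting up to `m` respects the loop bound.
    refine wp_full P.hm ho ?_ B.hm fun τ h' => Or.inl ⟨h, h'⟩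
    have := B.hN
    nlinarith

end

end SmallBias

/-! ### Size of the output and the polynomial time bound -/

namespace SmallBias
open Finset

section
variable {m E : ℕ}

lemma size_eq_log_add_one (hm : m ≠ 0) : m.size = Nat.log 2 m + 1 :=
  le_antisymm (Nat.size_le.2 (Nat.lt_pow_succ_log_self one_lt_two m))
    (Nat.lt_size.2 (Nat.pow_log_le_self 2 hm))

lemma parR_le (hE : 1 ≤ E) (hm : 2 ≤ m) : parR m E ≤ 2 ^ 50 * E ^ 10 * m.size := by
  have h1 := parq_lt hE hm
  have h2 : 1 ≤ E ^ 2 := Nat.one_le_pow _ _ hE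
  calc parR m E ≤ (41 * E ^ 2) * (2 * parK m E) := by
        rw [parR]; exact Nat.mul_le_mul (by omega) h1.le
    _ = (82 * 8796093022208) * (E ^ 10 * m.size) := by rw [parK]; ring
    _ ≤ 2 ^ 50 * (E ^ 10 * m.size) := Nat.mul_le_mul_right _ (by norm_num)
    _ = _ := by ring

lemma size_pow_four_le (hm : 2 ≤ m) : m.size ^ 4 ≤ 2 ^ 11 * m := by
  have h1 := one_le_size_of_two_le hm
  by_cases h : 6 ≤ m.size
  · obtain ⟨l, hl⟩ := Nat.exists_eq_add_of_le' h1
    have h2 := add_two_pow_four_le (l := l) (by omega)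
    have h3 : 2 ^ (l + 1) ≤ m := Nat.lt_size.1 (by omega)
    rw [pow_succ] at h3
    rw [hl]
    omega
  · have : m.size ^ 4 ≤ 5 ^ 4 := Nat.pow_le_pow_left (by omega) 4
    omega

lemma mul_log_le (m E : ℕ) :
    128 * (E : ℝ) ^ 2 * Real.log (4 * (parq m E : ℕ)) ≤ parn m E := by
  have h1 : (4 * (parq m E : ℕ) : ℝ) = 2 ^ (parl m E + 2) := by
    rw [parq]; push_cast; ring
  have h2 : Real.log 2 ≤ 1 := by have := Real.log_two_lt_d9; linarith
  rw [h1, Real.log_pow, parn]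
  push_cast
  have h3 : ((parl m E : ℝ) + 2) * Real.log 2 ≤ (parl m E : ℝ) + 2 :=
    mul_le_of_le_one_right (by positivity) h2
  gcongr

lemma two_pow_twenty_mul_le (hE : 1 ≤ E) : 2 ^ 20 * E ^ 5 * m.size ≤ parR m E := by
  refine le_trans ?_ ((parK_le_parq m E).trans (parq_le_parR m E))
  rw [parK]
  gcongr <;> norm_num

/-- The output has all the required properties. -/
lemma IsOutput.spec (hE : 1 ≤ E) (hm : 2 ≤ m) {Z : List ℕ} (h : IsOutput m E Z) :
    ∃ F : Finset ℕ, F.val = (Z : Multiset ℕ) ∧ F.Nonempty ∧ (∀ z ∈ F, z < m) ∧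
      disc (F.val.map fun z : ℕ => (z : ℤ)) m ≤ 1 / E ∧
      F.card ≤ 2 ^ 217 * E ^ 40 * Nat.log 2 m := by
  have hR := parR_le hE hm
  have hlog : 1 ≤ Nat.log 2 m := Nat.log_pos one_lt_two hm
  rcases h with ⟨h, rfl⟩ | ⟨h, ts, hlen, hG, rfl⟩
  · refine ⟨range m, rfl, ⟨0, by simp; omega⟩, fun z hz => mem_range.1 hz,
      disc_range_le hm (by positivity), ?_⟩
    rw [card_range]
    have h1 : m ≤ 2 ^ 103 * E ^ 20 * m.size ^ 2 := by
      calc m ≤ 8 * (parR m E * parR m E) := by rw [← mul_assoc]; exact h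
        _ ≤ 8 * ((2 ^ 50 * E ^ 10 * m.size) * (2 ^ 50 * E ^ 10 * m.size)) := by gcongr
        _ = _ := by ring
    -- Squaring `h1` brings in `m.size^4 ≤ 2^11 * m`; one factor `m` cancels, so `m` is bounded in
    -- terms of `E` alone. This fixes the constant: `217 = 2 * 103 + 11`.
    have h2 : m * m ≤ (2 ^ 217 * E ^ 40) * m := by
      calc m * m ≤ (2 ^ 103 * E ^ 20 * m.size ^ 2) * (2 ^ 103 * E ^ 20 * m.size ^ 2) :=
            Nat.mul_le_mul h1 h1
        _ = 2 ^ 206 * E ^ 40 * m.size ^ 4 := by ring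
        _ ≤ 2 ^ 206 * E ^ 40 * (2 ^ 11 * m) := Nat.mul_le_mul_left _ (size_pow_four_le hm)
        _ = _ := by ring
    exact (Nat.le_of_mul_le_mul_right h2 (by omega)).trans (Nat.le_mul_of_pos_right _ hlog)
  · have hRdef : parR m E = (40 * E ^ 2 + 1) * parq m E := rfl
    have hcard := hG.card_symm
    have hT0 : (symm (parq m E) ts).Nonempty := by
      rw [← card_pos, hcard, hlen, parn]; positivity
    have hsize := one_le_size_of_two_le hm
    have hqR := (parK_le_parq m E).trans (parq_le_parR m E)
    have hR20 : 2 ^ 20 ≤ parR m E := by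
      have := size_le_parK (m := m) hE
      omega
    have hnd := nodup_outList (R := parR m E) (I := 40 * E ^ 2) hRdef hG.symm_subset h
    obtain ⟨hne, hdisc⟩ := disc_outList_le (L := m.size) (parq_pos m E) hE hG.symm_subset hT0
      (fun k hk => hG.norm_sum_le hE hlen (four_mul_parn_sq_le hE hm) (mul_log_le m E) k hk)
      hRdef hR20 m.lt_size_self (by omega) (two_pow_twenty_mul_le hE) h
    refine ⟨_, by rw [List.toFinset_val, hnd.dedup], List.toFinset_nonempty_iff _ |>.2 hne,
      fun z hz => lt_of_mem_outList hRdef hG.symm_subset h (List.mem_toFinset.1 hz), hdisc, ?_⟩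
    rw [List.toFinset_card_of_nodup hnd, length_outList hRdef hG.symm_subset, hcard, hlen, parn]
    have hP := card_goodPrimes_mul_le (R := parR m E) (m := m) (l := parl m E)
      (by have := le_parl hE hm; omega) (parq_le_parR m E)
    -- The factor `l + 2` from the size of the greedy set cancels against the logarithm in the count
    -- of primes; this makes the length linear in `log m`.
    calc (goodPrimes (parR m E) m).card * (40 * E ^ 2 * (2 * (128 * E ^ 2 * (parl m E + 2))))
        = 10240 * E ^ 4 * ((goodPrimes (parR m E) m).card * (parl m E + 2)) := by ring
      _ ≤ 10240 * E ^ 4 * (72 * parR m E) := by gcongr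
      _ ≤ 10240 * E ^ 4 * (72 * (2 ^ 50 * E ^ 10 * m.size)) := by gcongr
      _ = (10240 * 72 * 2 ^ 50) * E ^ 14 * m.size := by ring
      _ ≤ 2 ^ 216 * E ^ 40 * (2 * Nat.log 2 m) := by
          have : m.size ≤ 2 * Nat.log 2 m := by
            rw [size_eq_log_add_one (by omega)]; omega
          have h2 : E ^ 14 ≤ E ^ 40 := Nat.pow_le_pow_right hE (by norm_num)
          exact Nat.mul_le_mul (Nat.mul_le_mul (by norm_num) h2) this
      _ = _ := by ring

/-- A bound for `parR`, in terms of the logarithm. -/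
def boundR (E x : ℕ) : ℕ := 2 ^ 50 * E ^ 10 * (x + 1)

/-- A bound for the number of binary digits of all numbers that occur. -/
def boundSize (E x : ℕ) : ℕ :=
  (x + 1) + (7 + 3 * boundR E x) + (32 * E + 2) * (boundR E x + 1) * (2 * boundR E x + 1)

/-- The dominant number is `parX ^ (2 * parq + 1)`, whose bit length is quadratic in `boundR` up to
a factor that depends on `E`. Only the exponent of `V` enters the running time, and it is polynomial
in `log m`. -/
lemma bounds (hE : 1 ≤ E) (hm : 2 ≤ m) :
    Bounds (16 * boundR E (Nat.log 2 m) ^ 2) (2 ^ boundSize E (Nat.log 2 m)) m E := by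
  have hR : parR m E ≤ boundR E (Nat.log 2 m) := by
    have := parR_le hE hm
    rwa [size_eq_log_add_one (by omega)] at this
  have hqR := parq_le_parR m E
  have hnq : parn m E ≤ parq m E := by
    have := four_mul_parn_sq_le hE hm
    nlinarith
  set r := boundR E (Nat.log 2 m) with hr
  refine ⟨?_, ?_, ?_, by gcongr⟩
  · refine (Nat.lt_pow_succ_log_self one_lt_two m).le.trans
      (Nat.pow_le_pow_right (by norm_num) ?_)
    rw [boundSize]; omega
  · calc 100 * parR m E ^ 3 ≤ 2 ^ 7 * (2 ^ r) ^ 3 :=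
          Nat.mul_le_mul (by norm_num)
            (Nat.pow_le_pow_left (hR.trans Nat.lt_two_pow_self.le) 3)
      _ = 2 ^ (7 + 3 * r) := by ring
      _ ≤ _ := Nat.pow_le_pow_right (by norm_num) (by rw [boundSize, ← hr]; omega)
  · calc parX m E ^ (2 * parq m E + 1)
        ≤ ((2 ^ (32 * E + 2)) ^ (parn m E + 1)) ^ (2 * parq m E + 1) :=
          Nat.pow_le_pow_left (Nat.pow_le_pow_left Nat.lt_two_pow_self.le _) _
      _ = 2 ^ ((32 * E + 2) * (parn m E + 1) * (2 * parq m E + 1)) := by rw [pow_mul, pow_mul]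
      _ ≤ 2 ^ ((32 * E + 2) * (r + 1) * (2 * r + 1)) :=
          Nat.pow_le_pow_right (by norm_num) (by gcongr <;> omega)
      _ ≤ _ := Nat.pow_le_pow_right (by norm_num) (by rw [boundSize, ← hr]; omega)

/-- A polynomial bound for the running time. -/
lemma exists_polynomial (E : ℕ) (c : Polynomial ℕ) : ∃ T : Polynomial ℕ, ∀ x,
    T.eval x = (c.eval (16 * boundR E x ^ 2) + 5002) * (boundSize E x + 1) := by
  let r : Polynomial ℕ := Polynomial.C (2 ^ 50 * E ^ 10) * (Polynomial.X + 1)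
  let w : Polynomial ℕ := (Polynomial.X + 1) + (7 + 3 * r) +
    Polynomial.C (32 * E + 2) * (r + 1) * (2 * r + 1)
  refine ⟨(c.comp (16 * r ^ 2) + 5002) * (w + 1), fun x => ?_⟩
  have hr : r.eval x = boundR E x := by simp [r, boundR]
  have hw : w.eval x = boundSize E x := by simp [w, boundSize, hr]
  simp [hr, hw]

end

lemma computable_const_mul_pow (a k : ℕ) : Computable fun E : ℕ => a * E ^ k := by
  have h : Primrec₂ fun x y : ℕ => x ^ y := Primrec₂.unpaired'.1 Nat.Primrec.pow
  exact (Primrec.nat_mul.comp (Primrec.const a) (h.comp Primrec.id (Primrec.const k))).to_comp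

end SmallBias

open SmallBias

theorem mainTheorem6 :
    ∃ (A : RAM.Prog) (C : ℕ → ℕ), Computable C ∧
      ∀ ε : ℝ, 0 < ε → ε ≤ 1 →
        1 ≤ C ⌈1 / ε⌉₊ ∧
        ∃ T : Polynomial ℕ, ∀ m : ℕ, 2 ≤ m →
          ∃ Z : Finset ℕ,
            RAM.OutputsWithin (RAM.Prog.seq (RAM.Prog.const 1 ⌈1 / ε⌉₊) A) m
              (T.eval (Nat.log 2 m)) Z ∧
            Z.Nonempty ∧
            (∀ z ∈ Z, z < m) ∧
            disc (Z.val.map fun z : ℕ => (z : ℤ)) m ≤ ε ∧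
            (Z.card : ℝ) ≤ (C ⌈1 / ε⌉₊ : ℝ) * Real.logb 2 (m : ℝ) := by
  refine ⟨Cmd.main.program, fun E => 2 ^ 217 * E ^ 40, computable_const_mul_pow _ _,
    fun ε hε _ => ?_⟩
  set E := ⌈1 / ε⌉₊ with hEdef
  have hE : 1 ≤ E := Nat.ceil_pos.2 (by positivity)
  have hEε : (1 : ℝ) / E ≤ ε := by
    rw [div_le_iff₀ (by exact_mod_cast hE), mul_comm, ← div_le_iff₀ hε]
    exact Nat.le_ceil _
  refine ⟨Nat.mul_pos (by norm_num) (Nat.pow_pos hE), ?_⟩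
  obtain ⟨T, hT⟩ := exists_polynomial E Cmd.main.cost
  refine ⟨T, fun m hm => ?_⟩
  have B := bounds hE hm
  have hEV : E ≤ 2 ^ boundSize E (Nat.log 2 m) := by
    refine Nat.lt_two_pow_self.le.trans (Nat.pow_le_pow_right (by norm_num) ?_)
    rw [boundSize, mul_assoc]
    have : 32 * E + 2 ≤ (32 * E + 2) * ((boundR E (Nat.log 2 m) + 1) *
      (2 * boundR E (Nat.log 2 m) + 1)) := Nat.le_mul_of_pos_right _ (by positivity)
    omega
  obtain ⟨t, s, Z, hrun, ht, hZ, hout⟩ := Cmd.run_program _ _ m E (hm.trans B.hm) B.hm hEV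
    Cmd.main Cmd.main_fits (IsOutput m E) (fun Z hZ a ha => by
      obtain ⟨F, hF, -, h, -⟩ := hZ.spec hE hm
      have : a ∈ F := by rw [← Finset.mem_val, hF]; exact ha
      exact (h a this).le.trans B.hm) (wp_main B hE hm)
  obtain ⟨F, hF, hne, hlt, hdisc, hcard⟩ := hZ.spec hE hm
  refine ⟨F, ⟨t, s, hrun, ?_, hout.trans hF.symm⟩, hne, hlt, hdisc.trans hEε, ?_⟩
  · rw [hT]
    rwa [Nat.size_pow] at ht
  · have h1 : (F.card : ℝ) ≤ ((2 ^ 217 * E ^ 40 * Nat.log 2 m : ℕ) : ℝ) := by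
      exact_mod_cast hcard
    refine h1.trans ?_
    rw [Nat.cast_mul]
    gcongr
    exact Real.natLog_le_logb m 2
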